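/- **Setting.** A *Tanner square complex* $T$ of a CSS code has finite vertex set $V_X\sqcup V_Q\sqcup V_Z$ ($X$-checks, qubits, $Z$-checks), an edge between a check and each qubit on which it acts, and squares with boundary cycles $(x,q,z,q')$, such that every qubit shared by $x$ and $z$ lies on a square containing $x$ and $z$. Its code is the complex $\mathbb F_2^{V_X}\xrightarrow{\delta^0}\mathbb F_2^{V_Q}\xrightarrow{\delta^1}\mathbb F_2^{V_Z}$, where $\delta^0,\delta^1$ are the adjacency maps of the graph. Fix an odd $\ell\ge 3$. *The replacement $\mathcal R_X$.* For $x\in V_X$ let $X_x$ be the closure of the set of squares containing $x$ and $\partial X_x$ the closure of the set of edges of $X_x$ not containing $x$. For $q\in V_Q$ let $X_q$ be the closure of the set of edges joining $q$ to vertices in $V_Z$ and $\partial X_q$ the set of vertices of $X_q$ other than $q$. For $z\in V_Z$ let $X_z=\{z\}$ and $\partial X_z=\emptyset$. Divide every edge into $(\ell-1)/2$ edges and every square into $\frac{\ell-1}2\times\frac{\ell-1}2$ squares, let $X_v',\partial X_v'$ be the resulting subdivisions, and let $$Y_v=\big(X'_v\times\{0\}\big)\cup\big(X'_v\times\{1\}\big)\cup\big(\partial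 X'_v\times[0,1]\big).$$ The local complexes are $C_x=C^\bullet(Y_x;\mathbb F_2)$, $C_q=C^\bullet(Y_q;\mathbb F_2)[-1]$, $C_z=C^\bullet(Y_z;\mathbb F_2)[-2]$. If $v,v'$ are adjacent ($v\in V_X,v'\in V_Q$, or $v\in V_Q,v'\in V_Z$), then $Y_{v'}\subseteq Y_v$, and restriction of cochains gives a connecting map $g_{vv'}:C_v^m\to C_{v'}^{m+1}$. Put $C_X=\bigoplus_x C_x$, $C_Q=\bigoplus_q C_q$, $C_Z=\bigoplus_z C_z$, with local coboundaries $\delta_X,\delta_Q,\delta_Z$ and connecting maps $g_{XQ},g_{QZ}$. The new code is the total complex $C_X\oplus C_Q\oplus C_Z$ with differential $\delta_{\rm loc}+g$. The new Tanner square complex $\mathcal R_X(T)$ has the cells of all the $Y_v$ as vertices and this code as its code; its squares are the 4-cycles of its Tanner graph, except that a 4-cycle whose two checks come from $Y_x$ and $Y_z$ with $x\in V_X,z\in V_Z$ must come from a square of $T$. *The replacement $\mathcal R_Z$* is the same construction with the roles of $V_X$ and $V_Z$ exchanged and with all complexes and connecting maps transposed. Let $T_{(0)}$ be the $3\times3$-grid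 Tanner square complex of the $[\![5,1,2]\!]$ surface code, $T_{(i+1)}=\mathcal R_X(T_{(i)})$ for even $i$ and $T_{(i+1)}=\mathcal R_Z(T_{(i)})$ for odd $i$. Let $C_{(i)}:\mathbb F_2^{V_{X,i}}\xrightarrow{\delta^0_{(i)}}\mathbb F_2^{V_{Q,i}}\xrightarrow{\delta^1_{(i)}}\mathbb F_2^{V_{Z,i}}$ be the code of $T_{(i)}$. The *induced complex* $(H(C_{(i+1)},\delta_{\rm loc}),H(g))$ has degree-$m$ part $H^m(C_X,\delta_X)\oplus H^m(C_Q,\delta_Q)\oplus H^m(C_Z,\delta_Z)$ and the differential induced by $g$. **Statement.** (1) For every even $i$ there are isomorphisms $H^0(C_X,\delta_X)\cong\mathbb F_2^{V_{X,i}}$, $H^1(C_Q,\delta_Q)\cong\mathbb F_2^{V_{Q,i}}$, $H^2(C_Z,\delta_Z)\cong(\mathbb F_2^2)^{V_{Z,i}}$, compatible with the decompositions into local complexes, through which the induced complex (including the vanishing of all summands not shown) becomes $$\mathbb F_2^{V_{X,i}}\xrightarrow{\ \delta^0_{(i)}\ }\mathbb F_2^{V_{Q,i}}\xrightarrow{\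 (\Delta\circ\delta^1_{(i)},\,0,\,0)\ }(\mathbb F_2^2)^{V_{Z,i}}\oplus H^2(C_X,\delta_X)\oplus H^2(C_Q,\delta_Q),$$ where $\Delta(b)=(b,b)$ is the diagonal map. (2) For every odd $i$ there are isomorphisms $H^0(C_X,\delta_X)\cong(\mathbb F_2^2)^{V_{X,i}}$, $H^1(C_Q,\delta_Q)\cong\mathbb F_2^{V_{Q,i}}$, $H^2(C_Z,\delta_Z)\cong\mathbb F_2^{V_{Z,i}}$, compatible with the decompositions into local complexes, through which the induced complex (including the vanishing of all summands not shown) becomes $$(\mathbb F_2^2)^{V_{X,i}}\oplus H^0(C_Z,\delta_Z)\oplus H^0(C_Q,\delta_Q)\xrightarrow{\ \delta^0_{(i)}\circ\Delta'\ \oplus\ 0\ \oplus\ 0\ }\mathbb F_2^{V_{Q,i}}\xrightarrow{\ \delta^1_{(i)}\ }\mathbb F_2^{V_{Z,i}},$$ where $\Delta'(b,b')=b+b'$ is the codiagonal map. -/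

import Mathlib

namespace CodeReplacement

/-! ### Tanner square complexes and their cochain complexes -/

/-- A Tanner square complex of a quantum CSS code. The vertices of degree `0`, `1`, `2` are the
`X`-checks, the qubits and the `Z`-checks. The edges `inc u v` of the Tanner graph are directed
from `X`-checks to qubits and from qubits to `Z`-checks. `sq x q q' z` says that there is a square
with boundary cycle `(x, q, z, q')`. -/
structure TannerSquareComplex where
  V : Type
  finite : Finite V
  deg : V → ℕ
  deg_le : ∀ v, deg v ≤ 2
  inc : V → V → Prop
  inc_deg : ∀ {u v}, inc u v → deg v = deg u + 1
  sq : V → V → V → V → Prop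
  sq_symm : ∀ {x q q' z}, sq x q q' z → sq x q' q z
  sq_ne : ∀ {x q q' z}, sq x q q' z → q ≠ q'
  sq_left : ∀ {x q q' z}, sq x q q' z → inc x q
  sq_right : ∀ {x q q' z}, sq x q q' z → inc q z
  /-- every qubit shared by an `X`-check and a `Z`-check lies on a square with them -/
  sq_cover : ∀ {x q z}, inc x q → inc q z → ∃ q', sq x q q' z
  /-- the checks commute -/
  even_common : ∀ x z, Even {q | inc x q ∧ inc q z}.ncard

attribute [instance] TannerSquareComplex.finite

open Classical in
/-- The linear map `𝔽₂^A → 𝔽₂^B` whose matrix is the incidence matrix of a relation. -/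
noncomputable def incidenceMap {A B : Type} [Finite A] (r : A → B → Prop) :
    (A → ZMod 2) →ₗ[ZMod 2] (B → ZMod 2) :=
  letI := Fintype.ofFinite A
  { toFun := fun f b => ∑ a, if r a b then f a else 0
    map_add' := by
      intro f g
      ext b
      simp only [Pi.add_apply, ← Finset.sum_add_distrib]
      exact Finset.sum_congr rfl fun a _ => by split_ifs <;> simp
    map_smul' := by
      intro t f
      ext b
      simp only [Pi.smul_apply, smul_eq_mul, Finset.mul_sum, RingHom.id_apply]
      exact Finset.sum_congr rfl fun a _ => by split_ifs <;> simp }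

open Classical in
theorem incidenceMap_comp_apply {A B B' : Type} [Finite A] [Finite B] (r : A → B → Prop)
    (s : B → B' → Prop) (f : A → ZMod 2) (c : B') [iA : Fintype A] :
    incidenceMap s (incidenceMap r f) c =
      ∑ a, ({b | r a b ∧ s b c}.ncard : ZMod 2) * f a := by
  let _ := Fintype.ofFinite B
  obtain rfl : iA = Fintype.ofFinite A := Subsingleton.elim _ _
  have hn : ∀ a, ({b | r a b ∧ s b c}.ncard : ZMod 2) = ∑ b, if r a b ∧ s b c then 1 else 0 := by
    intro a
    rw [Finset.sum_boole, Set.ncard_eq_toFinset_card']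
    congr 2
    ext b
    simp
  simp only [hn, incidenceMap, LinearMap.coe_mk, AddHom.coe_mk, Finset.sum_mul]
  rw [Finset.sum_comm]
  refine Finset.sum_congr rfl fun b _ => ?_
  split_ifs with hs
  · exact Finset.sum_congr rfl fun a _ => by simp [hs]
  · simp [hs]

theorem incidenceMap_comp_eq {A B₁ B₂ B' : Type} [Finite A] [Finite B₁] [Finite B₂]
    {r₁ : A → B₁ → Prop} {s₁ : B₁ → B' → Prop} {r₂ : A → B₂ → Prop} {s₂ : B₂ → B' → Prop}
    (h : ∀ a c, Even ({b | r₁ a b ∧ s₁ b c}.ncard + {b | r₂ a b ∧ s₂ b c}.ncard)) :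
    incidenceMap s₁ ∘ₗ incidenceMap r₁ = incidenceMap s₂ ∘ₗ incidenceMap r₂ := by
  let _ := Fintype.ofFinite A
  refine LinearMap.ext fun f => funext fun c => ?_
  simp only [LinearMap.comp_apply, incidenceMap_comp_apply]
  refine Finset.sum_congr rfl fun a _ => ?_
  have h0 := (ZMod.natCast_eq_zero_iff_even).2 (h a c)
  rw [Nat.cast_add] at h0
  rw [CharTwo.add_eq_zero.1 h0]

theorem incidenceMap_comp_eq_zero {A B B' : Type} [Finite A] [Finite B]
    {r : A → B → Prop} {s : B → B' → Prop} (h : ∀ a c, Even {b | r a b ∧ s b c}.ncard) :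
    incidenceMap s ∘ₗ incidenceMap r = 0 := by
  let _ := Fintype.ofFinite A
  refine LinearMap.ext fun f => funext fun c => ?_
  simp only [LinearMap.comp_apply, incidenceMap_comp_apply, (ZMod.natCast_eq_zero_iff_even).2 (h _ c),
    zero_mul, Finset.sum_const_zero, LinearMap.zero_apply, Pi.zero_apply]

namespace TannerSquareComplex

variable (T : TannerSquareComplex)

/-- The vertices of degree `m`: `V_X`, `V_Q`, `V_Z` for `m = 0, 1, 2`. -/
abbrev Vert (m : ℕ) : Type := {v : T.V // T.deg v = m}

/-- The code of `T` is the cochain complex `𝔽₂^{V_X} → 𝔽₂^{V_Q} → 𝔽₂^{V_Z}`. -/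
abbrev Cochain (m : ℕ) : Type := T.Vert m → ZMod 2

/-- The coboundary maps `δ⁰`, `δ¹` of the code: the adjacency maps of the Tanner graph. -/
noncomputable def coboundary (m : ℕ) : T.Cochain m →ₗ[ZMod 2] T.Cochain (m + 1) :=
  incidenceMap fun u v => T.inc u.1 v.1

/-- The same square complex with the roles of `X`- and `Z`-checks exchanged; its code is the
transposed complex. -/
def dual : TannerSquareComplex where
  V := T.V
  finite := T.finite
  deg v := 2 - T.deg v
  deg_le v := by omega
  inc u v := T.inc v u
  inc_deg {u v} h := by
    have h1 := T.inc_deg h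
    have h2 := T.deg_le u
    omega
  sq x q q' z := T.sq z q q' x
  sq_symm h := T.sq_symm h
  sq_ne h := T.sq_ne h
  sq_left h := T.sq_right h
  sq_right h := T.sq_left h
  sq_cover h h' := T.sq_cover h' h
  even_common x z := by simpa only [and_comm] using T.even_common z x

/-! ### Cells -/

/-- The edges, oriented from `src` (lower degree) to `tgt` (higher degree). -/
@[ext] structure Edge where
  src : T.V
  tgt : T.V
  inc : T.inc src tgt

/-- The squares. Each square is listed once: its two qubits are put in an arbitrary fixed order. -/
@[ext] structure Face where
  bot : T.V
  mid₁ : T.V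
  mid₂ : T.V
  top : T.V
  sq : T.sq bot mid₁ mid₂ top
  lt : WellOrderingRel mid₁ mid₂

instance : Finite T.Edge :=
  Finite.of_injective (fun e : T.Edge => (e.src, e.tgt)) fun e e' h => by
    simp only [Prod.mk.injEq] at h
    exact Edge.ext h.1 h.2

instance : Finite T.Face :=
  Finite.of_injective (fun f : T.Face => (f.bot, f.mid₁, f.mid₂, f.top)) fun f f' h => by
    simp only [Prod.mk.injEq] at h
    exact Face.ext h.1 h.2.1 h.2.2.1 h.2.2.2

variable {T}

/-- The four sides of a square. -/
def Face.low₁ (f : T.Face) : T.Edge := ⟨f.bot, f.mid₁, T.sq_left f.sq⟩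
def Face.low₂ (f : T.Face) : T.Edge := ⟨f.bot, f.mid₂, T.sq_left (T.sq_symm f.sq)⟩
def Face.high₁ (f : T.Face) : T.Edge := ⟨f.mid₁, f.top, T.sq_right f.sq⟩
def Face.high₂ (f : T.Face) : T.Edge := ⟨f.mid₂, f.top, T.sq_right (T.sq_symm f.sq)⟩

variable (T) in
/-- The cells of the square complex. -/
inductive Cell : Type
  | vert (v : T.V)
  | edge (e : T.Edge)
  | face (f : T.Face)

namespace Cell

def dim : T.Cell → ℕ
  | vert _ => 0
  | edge _ => 1
  | face _ => 2

/-- The vertex of lowest degree of a cell. -/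
def bot : T.Cell → T.V
  | vert v => v
  | edge e => e.src
  | face f => f.bot

/-- `Le σ τ`: the cell `σ` lies in the closure of the cell `τ`. -/
def Le : T.Cell → T.Cell → Prop
  | vert u, vert v => u = v
  | vert u, edge e => u = e.src ∨ u = e.tgt
  | vert u, face f => u = f.bot ∨ u = f.mid₁ ∨ u = f.mid₂ ∨ u = f.top
  | edge e, edge e' => e = e'
  | edge e, face f => e = f.low₁ ∨ e = f.low₂ ∨ e = f.high₁ ∨ e = f.high₂
  | face f, face f' => f = f'
  | _, _ => False

theorem Le.refl (σ : T.Cell) : Le σ σ := by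
  cases σ <;> rfl

theorem Le.trans {ρ σ τ : T.Cell} (h : Le ρ σ) (h' : Le σ τ) : Le ρ τ := by
  cases ρ <;> cases σ <;> cases τ <;> simp only [Le] at h h' ⊢ <;> try subst h
  all_goals try assumption
  · subst h'; exact h
  · rcases h' with rfl | rfl | rfl | rfl <;>
      simp only [Face.low₁, Face.low₂, Face.high₁, Face.high₂] at h <;> tauto
  · subst h'; exact h
  · subst h'; exact h

theorem Le.dim_le {σ τ : T.Cell} (h : Le σ τ) : σ.dim ≤ τ.dim := by
  cases σ <;> cases τ <;> simp_all [Le, dim]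

end Cell

/-! ### The local complexes -/

/-- The complex `X_v`. For an `X`-check `v` it is the closure of the set of squares containing `v`,
for a qubit `v` the closure of the set of edges from `v` to `Z`-checks, for a `Z`-check the
point `v`. -/
def star (v : T.V) : Set T.Cell :=
  {σ | ∃ τ : T.Cell, τ.dim + T.deg v = 2 ∧ τ.bot = v ∧ σ.Le τ}

/-- The complex `∂X_v`: for an `X`-check `v` the closure of the set of edges of `X_v` that do not
contain `v`, for a qubit `v` the set of vertices of `X_v` other than `v`, for a `Z`-check `∅`. -/
def link (v : T.V) : Set T.Cell :=
  {σ | ∃ τ : T.Cell, τ.dim + T.deg v = 1 ∧ τ ∈ star v ∧ ¬ (Cell.vert v).Le τ ∧ σ.Le τ}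

variable (T) in
/-- The cells of the subdivision of `T` in which every edge is divided into `k` edges and every
square into `k × k` squares. Along an edge the position `0` is the lower endpoint, `2k` the
upper endpoint, even positions are vertices and odd positions are edges of the
subdivision; a square has the product coordinates, with the two axes through `bot` running along
the edges to `mid₁` and to `mid₂`. `edge e a` and `face f a b` are the cells in the interior of
`e` and of `f` with positions `a + 1` and `(a + 1, b + 1)`. -/
inductive SubCell (k : ℕ) : Type
  | vert (v : T.V)
  | edge (e : T.Edge) (a : Fin (2 * k - 1))
  | face (f : T.Face) (a b : Fin (2 * k - 1))

namespace SubCell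

variable {k : ℕ}

instance : Finite (T.SubCell k) :=
  Finite.of_surjective
    (fun s : T.V ⊕ (T.Edge × Fin (2 * k - 1)) ⊕ (T.Face × Fin (2 * k - 1) × Fin (2 * k - 1)) =>
      match s with
      | .inl v => vert v
      | .inr (.inl (e, a)) => edge e a
      | .inr (.inr (f, a, b)) => face f a b)
    fun c => by
      cases c with
      | vert v => exact ⟨.inl v, rfl⟩
      | edge e a => exact ⟨.inr (.inl (e, a)), rfl⟩
      | face f a b => exact ⟨.inr (.inr (f, a, b)), rfl⟩

/-- The cell of `T` whose interior contains a cell of the subdivision. -/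
def carrier : T.SubCell k → T.Cell
  | vert v => .vert v
  | edge e _ => .edge e
  | face f _ _ => .face f

def dim : T.SubCell k → ℕ
  | vert _ => 0
  | edge _ a => (a.1 + 1) % 2
  | face _ a b => (a.1 + 1) % 2 + (b.1 + 1) % 2

/-- The cell at position `a ∈ {0, …, 2k}` on a closed edge. -/
def onEdge (k : ℕ) (e : T.Edge) (a : ℕ) : T.SubCell k :=
  if a = 0 then vert e.src
  else if h : a - 1 < 2 * k - 1 then edge e ⟨a - 1, h⟩
  else vert e.tgt

/-- The cell at position `(a, b) ∈ {0, …, 2k}²` on a closed square. -/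
def onFace (k : ℕ) (f : T.Face) (a b : ℕ) : T.SubCell k :=
  if b = 0 then onEdge k f.low₁ a
  else if hb : b - 1 < 2 * k - 1 then
    if a = 0 then onEdge k f.low₂ b
    else if ha : a - 1 < 2 * k - 1 then face f ⟨a - 1, ha⟩ ⟨b - 1, hb⟩
    else onEdge k f.high₁ b
  else onEdge k f.high₂ a

/-- `Facet σ τ`: `σ` is a codimension one cell in the boundary of `τ`. -/
def Facet (σ : T.SubCell k) : T.SubCell k → Prop
  | vert _ => False
  | edge e a => Odd (a.1 + 1) ∧ (σ = onEdge k e a.1 ∨ σ = onEdge k e (a.1 + 2))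
  | face f a b =>
      (Odd (a.1 + 1) ∧ (σ = onFace k f a.1 (b.1 + 1) ∨ σ = onFace k f (a.1 + 2) (b.1 + 1))) ∨
      (Odd (b.1 + 1) ∧ (σ = onFace k f (a.1 + 1) b.1 ∨ σ = onFace k f (a.1 + 1) (b.1 + 2)))

theorem carrier_onEdge (e : T.Edge) (a : ℕ) : (onEdge k e a).carrier.Le (.edge e) := by
  unfold onEdge
  split_ifs <;> simp [carrier, Cell.Le]

theorem carrier_onFace (f : T.Face) (a b : ℕ) : (onFace k f a b).carrier.Le (.face f) := by
  unfold onFace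
  split_ifs
  · exact (carrier_onEdge _ _).trans (by simp [Cell.Le])
  · exact (carrier_onEdge _ _).trans (by simp [Cell.Le])
  · simp [carrier, Cell.Le]
  · exact (carrier_onEdge _ _).trans (by simp [Cell.Le])
  · exact (carrier_onEdge _ _).trans (by simp [Cell.Le])

theorem dim_onEdge (e : T.Edge) {a : ℕ} (ha : a ≤ 2 * k) : (onEdge k e a).dim = a % 2 := by
  unfold onEdge
  split_ifs <;> simp only [dim] <;> omega

theorem dim_onFace (f : T.Face) {a b : ℕ} (ha : a ≤ 2 * k) (hb : b ≤ 2 * k) :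
    (onFace k f a b).dim = a % 2 + b % 2 := by
  unfold onFace
  split_ifs <;> (try rw [dim_onEdge _ (by omega)]) <;> (try simp only [dim]) <;> omega

theorem Facet.carrier_le {σ τ : T.SubCell k} (h : Facet σ τ) : σ.carrier.Le τ.carrier := by
  cases τ with
  | vert v => exact h.elim
  | edge e a =>
    rcases h with ⟨-, rfl | rfl⟩ <;> exact carrier_onEdge _ _
  | face f a b =>
    rcases h with ⟨-, rfl | rfl⟩ | ⟨-, rfl | rfl⟩ <;> exact carrier_onFace _ _ _

theorem Facet.dim_eq {σ τ : T.SubCell k} (h : Facet σ τ) : τ.dim = σ.dim + 1 := by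
  cases τ with
  | vert v => exact h.elim
  | edge e a =>
    have := a.2
    rcases h with ⟨h, rfl | rfl⟩ <;> rw [dim_onEdge _ (by omega)] <;>
      rw [Nat.odd_iff] at h <;> simp only [dim] <;> omega
  | face f a b =>
    have := a.2
    have := b.2
    rcases h with ⟨h, rfl | rfl⟩ | ⟨h, rfl | rfl⟩ <;>
      rw [dim_onFace _ (by omega) (by omega)] <;>
      rw [Nat.odd_iff] at h <;> simp only [dim] <;> omega

theorem dim_le (σ : T.SubCell k) : σ.dim ≤ σ.carrier.dim := by
  cases σ <;> simp only [dim, carrier, Cell.dim] <;> omega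

theorem facet_onEdge {σ : T.SubCell k} {e : T.Edge} {b : ℕ} (hb : b < 2 * k) (ho : Odd b) :
    Facet σ (onEdge k e b) ↔ σ = onEdge k e (b - 1) ∨ σ = onEdge k e (b + 1) := by
  have h0 : b ≠ 0 := by rintro rfl; simp at ho
  have h1 : b - 1 < 2 * k - 1 := by omega
  have h2 : onEdge k e b = edge e ⟨b - 1, h1⟩ := by
    unfold onEdge; rw [if_neg h0, dif_pos h1]
  have h3 : b - 1 + 1 = b := by omega
  have h4 : b - 1 + 2 = b + 1 := by omega
  rw [h2]
  simp only [Facet, h3, h4, ho, true_and]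

theorem onEdge_zero (e : T.Edge) : onEdge k e 0 = vert e.src := by simp [onEdge]

theorem onEdge_top (e : T.Edge) (hk : k ≠ 0) : onEdge k e (2 * k) = vert e.tgt := by
  unfold onEdge
  rw [if_neg (by omega), dif_neg (by omega)]

theorem onFace_left (f : T.Face) {b : ℕ} (hb : b ≤ 2 * k) :
    onFace k f 0 b = onEdge k f.low₂ b := by
  rcases Nat.eq_zero_or_pos b with rfl | h
  · simp [onFace, onEdge, Face.low₁, Face.low₂]
  · unfold onFace
    rw [if_neg (by omega)]
    by_cases h1 : b - 1 < 2 * k - 1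
    · rw [dif_pos h1, if_pos rfl]
    · have : b = 2 * k := by omega
      subst this
      rw [dif_neg h1, onEdge_zero, onEdge_top _ (by omega)]
      rfl

theorem onFace_right (f : T.Face) {b : ℕ} (hk : k ≠ 0) (hb : b ≤ 2 * k) :
    onFace k f (2 * k) b = onEdge k f.high₁ b := by
  rcases Nat.eq_zero_or_pos b with rfl | h
  · simp only [onFace, if_true]
    rw [onEdge_zero, onEdge_top _ (by omega)]
    rfl
  · unfold onFace
    rw [if_neg (by omega)]
    split_ifs with h1 h2 h3
    · omega
    · omega
    · rfl
    · have : b = 2 * k := by omega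
      subst this
      rw [onEdge_top _ (by omega), onEdge_top _ (by omega)]
      rfl

theorem onFace_bot (f : T.Face) (a : ℕ) : onFace k f a 0 = onEdge k f.low₁ a := by
  simp [onFace]

theorem onFace_top (f : T.Face) (hk : k ≠ 0) (a : ℕ) :
    onFace k f a (2 * k) = onEdge k f.high₂ a := by
  unfold onFace
  rw [if_neg (by omega), dif_neg (by omega)]

theorem onFace_inner (f : T.Face) {a b : ℕ} (ha : a ≠ 0) (ha' : a < 2 * k) (hb : b ≠ 0)
    (hb' : b < 2 * k) :
    onFace k f a b = face f ⟨a - 1, by omega⟩ ⟨b - 1, by omega⟩ := by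
  unfold onFace
  rw [if_neg hb, dif_pos (by omega), if_neg ha, dif_pos (by omega)]

/-- The boundary of a segment of a closed square in the second direction. -/
theorem facet_onFace₂ {σ : T.SubCell k} {f : T.Face} {a b : ℕ} (ha : a ≤ 2 * k) (hae : Even a)
    (hb : b < 2 * k) (ho : Odd b) :
    Facet σ (onFace k f a b) ↔ σ = onFace k f a (b - 1) ∨ σ = onFace k f a (b + 1) := by
  have h0 : b ≠ 0 := by rintro rfl; simp at ho
  rcases eq_or_ne a 0 with rfl | h1
  · rw [onFace_left _ (by omega), onFace_left _ (by omega), onFace_left _ (by omega)]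
    exact facet_onEdge hb ho
  rcases eq_or_ne a (2 * k) with rfl | h2
  · rw [onFace_right _ (by omega) (by omega), onFace_right _ (by omega) (by omega),
      onFace_right _ (by omega) (by omega)]
    exact facet_onEdge hb ho
  · rw [onFace_inner f h1 (by omega) h0 hb]
    have h3 : a - 1 + 1 = a := by omega
    have h4 : b - 1 + 1 = b := by omega
    have h5 : b - 1 + 2 = b + 1 := by omega
    have h6 : ¬ Odd a := Nat.not_odd_iff_even.2 hae
    simp only [Facet, h3, h4, h5, h6, ho, false_and, true_and, false_or]

/-- The boundary of a segment of a closed square in the first direction. -/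
theorem facet_onFace₁ {σ : T.SubCell k} {f : T.Face} {a b : ℕ} (ha : a < 2 * k) (ho : Odd a)
    (hb : b ≤ 2 * k) (hbe : Even b) :
    Facet σ (onFace k f a b) ↔ σ = onFace k f (a - 1) b ∨ σ = onFace k f (a + 1) b := by
  have h0 : a ≠ 0 := by rintro rfl; simp at ho
  rcases eq_or_ne b 0 with rfl | h1
  · rw [onFace_bot, onFace_bot, onFace_bot]
    exact facet_onEdge ha ho
  rcases eq_or_ne b (2 * k) with rfl | h2
  · rw [onFace_top _ (by omega), onFace_top _ (by omega), onFace_top _ (by omega)]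
    exact facet_onEdge ha ho
  · rw [onFace_inner f h0 ha h1 (by omega)]
    have h3 : b - 1 + 1 = b := by omega
    have h4 : a - 1 + 1 = a := by omega
    have h5 : a - 1 + 2 = a + 1 := by omega
    have h6 : ¬ Odd b := Nat.not_odd_iff_even.2 hbe
    simp only [Facet, h3, h4, h5, h6, ho, false_and, true_and, or_false]

/-- The position of a cell of a closed square. -/
theorem onFace_injective (f : T.Face) {a b a' b' : ℕ} (ha : a ≤ 2 * k) (hb : b ≤ 2 * k)
    (ha' : a' ≤ 2 * k) (hb' : b' ≤ 2 * k) (h : onFace k f a b = onFace k f a' b') :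
    a = a' ∧ b = b' := by
  have d1 := T.inc_deg (T.sq_left f.sq)
  have d2 := T.inc_deg (T.sq_left (T.sq_symm f.sq))
  have d3 := T.inc_deg (T.sq_right f.sq)
  have n1 : f.bot ≠ f.mid₁ := fun h => by rw [h] at d1; omega
  have n2 : f.bot ≠ f.mid₂ := fun h => by rw [h] at d2; omega
  have n3 : f.bot ≠ f.top := fun h => by rw [h] at d1; omega
  have n4 : f.mid₁ ≠ f.top := fun h => by rw [h] at d3; omega
  have n5 : f.mid₂ ≠ f.top := fun h => by rw [h] at d2; omega
  have n6 := T.sq_ne f.sq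
  unfold onFace onEdge at h
  simp only [Face.low₁, Face.low₂, Face.high₁, Face.high₂] at h
  split_ifs at h <;>
    simp only [vert.injEq, edge.injEq, face.injEq, Edge.mk.injEq, Fin.mk.injEq, n1, n2, n3, n4, n5,
      n6, n1.symm, n2.symm, n3.symm, n4.symm, n5.symm, n6.symm, false_and, and_false,
      true_and, and_true] at h <;> omega

/-- Between a cell of the subdivision and a cell of codimension two in its boundary there is an
even number of cells. -/
theorem even_between (σ τ : T.SubCell k) : Even {ρ | Facet σ ρ ∧ Facet ρ τ}.ncard := by
  by_cases hE : {ρ | Facet σ ρ ∧ Facet ρ τ} = ∅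
  · simp [hE]
  obtain ⟨ρ₀, h1, h2⟩ := Set.nonempty_iff_ne_empty.2 hE
  have hd : τ.dim = σ.dim + 2 := by rw [h2.dim_eq, h1.dim_eq]
  cases τ with
  | vert v => exact h2.elim
  | edge e a => simp only [dim] at hd; omega
  | face f i j =>
    obtain ⟨i, hi⟩ := i
    obtain ⟨j, hj⟩ := j
    simp only [dim] at hd
    have ho1 : Odd (i + 1) := by rw [Nat.odd_iff]; omega
    have ho2 : Odd (j + 1) := by rw [Nat.odd_iff]; omega
    have hi0 : Even i := by rw [Nat.even_iff]; omega
    have hj0 : Even j := by rw [Nat.even_iff]; omega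
    have hi2 : Even (i + 2) := by rw [Nat.even_iff]; omega
    have hj2 : Even (j + 2) := by rw [Nat.even_iff]; omega
    have key : ∀ ρ, (Facet σ ρ ∧ Facet ρ (face f ⟨i, hi⟩ ⟨j, hj⟩)) ↔
        (ρ = onFace k f i (j + 1) ∧ (σ = onFace k f i j ∨ σ = onFace k f i (j + 2))) ∨
        (ρ = onFace k f (i + 2) (j + 1) ∧
          (σ = onFace k f (i + 2) j ∨ σ = onFace k f (i + 2) (j + 2))) ∨
        (ρ = onFace k f (i + 1) j ∧ (σ = onFace k f i j ∨ σ = onFace k f (i + 2) j)) ∨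
        (ρ = onFace k f (i + 1) (j + 2) ∧
          (σ = onFace k f i (j + 2) ∨ σ = onFace k f (i + 2) (j + 2))) := by
      intro ρ
      have e1 := facet_onFace₂ (σ := σ) (f := f) (a := i) (b := j + 1) (by omega) hi0 (by omega) ho2
      have e2 := facet_onFace₂ (σ := σ) (f := f) (a := i + 2) (b := j + 1) (by omega) hi2 (by omega)
        ho2
      have e3 := facet_onFace₁ (σ := σ) (f := f) (a := i + 1) (b := j) (by omega) ho1 (by omega) hj0
      have e4 := facet_onFace₁ (σ := σ) (f := f) (a := i + 1) (b := j + 2) (by omega) ho1 (by omega)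
        hj2
      simp only [Nat.add_sub_cancel, Nat.add_assoc, Nat.reduceAdd] at e1 e2 e3 e4
      rw [← e1, ← e2, ← e3, ← e4]
      simp only [Facet, ho1, ho2, true_and]
      constructor
      · rintro ⟨h, (rfl | rfl) | (rfl | rfl)⟩
        exacts [.inl ⟨rfl, h⟩, .inr (.inl ⟨rfl, h⟩), .inr (.inr (.inl ⟨rfl, h⟩)),
          .inr (.inr (.inr ⟨rfl, h⟩))]
      · rintro (⟨rfl, h⟩ | ⟨rfl, h⟩ | ⟨rfl, h⟩ | ⟨rfl, h⟩)
        exacts [⟨h, .inl (.inl rfl)⟩, ⟨h, .inl (.inr rfl)⟩, ⟨h, .inr (.inl rfl)⟩,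
          ⟨h, .inr (.inr rfl)⟩]
    have inj : ∀ {a b a' b' : ℕ}, a ≤ i + 2 → b ≤ j + 2 → a' ≤ i + 2 → b' ≤ j + 2 →
        (onFace k f a b = onFace k f a' b' ↔ a = a' ∧ b = b') := fun h1 h2 h3 h4 =>
      ⟨onFace_injective f (by omega) (by omega) (by omega) (by omega),
        by rintro ⟨rfl, rfl⟩; rfl⟩
    have corner : ∃ s t, (s = i ∨ s = i + 2) ∧ (t = j ∨ t = j + 2) ∧ σ = onFace k f s t := by
      rcases (key ρ₀).1 ⟨h1, h2⟩ with ⟨-, h | h⟩ | ⟨-, h | h⟩ | ⟨-, h | h⟩ | ⟨-, h | h⟩ <;>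
        exact ⟨_, _, by simp, by simp, h⟩
    obtain ⟨s, t, hs, ht, rfl⟩ := corner
    have hset : {ρ | Facet (onFace k f s t) ρ ∧ Facet ρ (face f ⟨i, hi⟩ ⟨j, hj⟩)} =
        {onFace k f s (j + 1), onFace k f (i + 1) t} := by
      ext ρ
      rw [Set.mem_ofPred_eq, key, inj, inj, inj, inj] <;> try omega
      simp only [Set.mem_insert_iff, Set.mem_singleton_iff]
      rcases hs with rfl | rfl <;> rcases ht with rfl | rfl <;> simp
    rw [hset, Set.ncard_pair]
    · exact even_two
    · rw [Ne, inj] <;> omega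

end SubCell

/-! ### The doubled complexes `Y_v` -/

variable (T) in
/-- The cells of the product of the subdivision of `T` with the interval `[0, 1]`. The heights
`some false`, `some true` and `none` stand for the two endpoints and the open interval. -/
abbrev ProdCell (k : ℕ) : Type := T.SubCell k × Option Bool

namespace ProdCell

variable {k : ℕ}

def dim (w : T.ProdCell k) : ℕ := w.1.dim + if w.2 = none then 1 else 0

/-- `Facet w w'`: `w` is a codimension one cell in the boundary of `w'`. -/
def Facet (w w' : T.ProdCell k) : Prop :=
  (SubCell.Facet w.1 w'.1 ∧ w.2 = w'.2) ∨ (w.1 = w'.1 ∧ w.2 ≠ none ∧ w'.2 = none)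

theorem Facet.dim_eq {w w' : T.ProdCell k} (h : Facet w w') : w'.dim = w.dim + 1 := by
  rcases h with ⟨h, h'⟩ | ⟨h, h', h''⟩
  · simp only [dim, h.dim_eq, h']
    omega
  · simp [dim, h, h', h'']

/-- The cells of `Y_v`: two copies of the subdivided `X_v`, joined by the product of the
subdivided `∂X_v` with the interval. -/
def localCells (k : ℕ) (v : T.V) : Set (T.ProdCell k) :=
  {w | w.1.carrier ∈ star v ∧ (w.2 = none → w.1.carrier ∈ link v)}

end ProdCell

theorem star_closed {v : T.V} {σ τ : T.Cell} (h : σ.Le τ) (hτ : τ ∈ star v) : σ ∈ star v := by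
  obtain ⟨ρ, h1, h2, h3⟩ := hτ
  exact ⟨ρ, h1, h2, h.trans h3⟩

theorem link_closed {v : T.V} {σ τ : T.Cell} (h : σ.Le τ) (hτ : τ ∈ link v) : σ ∈ link v := by
  obtain ⟨ρ, h1, h2, h3, h4⟩ := hτ
  exact ⟨ρ, h1, h2, h3, h.trans h4⟩

theorem link_subset_star {v : T.V} {σ : T.Cell} (h : σ ∈ link v) : σ ∈ star v := by
  obtain ⟨ρ, -, h2, -, h4⟩ := h
  exact star_closed h4 h2

theorem star_dim_le {v : T.V} {σ : T.Cell} (h : σ ∈ star v) : σ.dim + T.deg v ≤ 2 := by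
  obtain ⟨τ, h1, -, h3⟩ := h
  have := h3.dim_le
  omega

theorem link_dim_le {v : T.V} {σ : T.Cell} (h : σ ∈ link v) : σ.dim + T.deg v ≤ 1 := by
  obtain ⟨τ, h1, -, -, h3⟩ := h
  have := h3.dim_le
  omega

/-- For adjacent `v`, `v'` the complex `X_{v'}` lies in `∂X_v`. -/
theorem star_subset_link {v v' : T.V} (h : T.inc v v') {σ : T.Cell} (hσ : σ ∈ star v') :
    σ ∈ link v := by
  obtain ⟨τ, h1, rfl, h3⟩ := hσ
  have hd := T.inc_deg h
  refine ⟨τ, by omega, ?_, ?_, h3⟩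
  · cases τ with
    | vert z =>
      refine ⟨.edge ⟨v, z, h⟩, ?_, rfl, Or.inr rfl⟩
      simp only [Cell.dim, Cell.bot] at h1 hd ⊢
      omega
    | edge e =>
      obtain ⟨q', hq⟩ := T.sq_cover h e.inc
      simp only [Cell.dim, Cell.bot] at h1 hd hq
      rcases trichotomous_of WellOrderingRel e.src q' with hlt | heq | hlt
      · refine ⟨.face ⟨v, e.src, q', e.tgt, hq, hlt⟩, ?_, rfl, ?_⟩
        · simp only [Cell.dim]; omega
        · exact Or.inr (Or.inr (Or.inl rfl))
      · exact (T.sq_ne hq heq).elim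
      · refine ⟨.face ⟨v, q', e.src, e.tgt, T.sq_symm hq, hlt⟩, ?_, rfl, ?_⟩
        · simp only [Cell.dim]; omega
        · exact Or.inr (Or.inr (Or.inr rfl))
    | face f =>
      simp only [Cell.dim] at h1
      omega
  · cases τ with
    | vert z =>
      rintro rfl
      simp only [Cell.bot] at hd
      omega
    | edge e =>
      have := T.inc_deg e.inc
      simp only [Cell.bot] at hd
      rintro (rfl | rfl) <;> omega
    | face f =>
      simp only [Cell.dim] at h1
      omega

namespace ProdCell

variable {k : ℕ}

theorem local_closed {v : T.V} {w w' : T.ProdCell k} (h : Facet w w') (hw : w' ∈ localCells k v) :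
    w ∈ localCells k v := by
  rcases h with ⟨h, h'⟩ | ⟨h, h', h''⟩
  · exact ⟨star_closed h.carrier_le hw.1, fun hn => link_closed h.carrier_le (hw.2 (h' ▸ hn))⟩
  · exact ⟨by rw [h]; exact hw.1, fun hn => (h' hn).elim⟩

/-- For adjacent `v`, `v'` the complex `Y_{v'}` is a subcomplex of `Y_v`. -/
theorem local_mono {v v' : T.V} (h : T.inc v v') {w : T.ProdCell k} (hw : w ∈ localCells k v') :
    w ∈ localCells k v :=
  ⟨link_subset_star (star_subset_link h hw.1), fun _ => star_subset_link h hw.1⟩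

theorem local_dim_le {v : T.V} {w : T.ProdCell k} (hw : w ∈ localCells k v) :
    T.deg v + w.dim ≤ 2 := by
  have h1 := w.1.dim_le
  have h2 := star_dim_le hw.1
  unfold dim
  split_ifs with h
  · have := link_dim_le (hw.2 h)
    omega
  · omega

theorem even_between (w w'' : T.ProdCell k) : Even {w' | Facet w w' ∧ Facet w' w''}.ncard := by
  obtain ⟨σ, h⟩ := w
  obtain ⟨τ, h''⟩ := w''
  by_cases hh : h = h''
  · subst hh
    have : {w' : T.ProdCell k | Facet (σ, h) w' ∧ Facet w' (τ, h)} =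
        (fun ρ => (ρ, h)) '' {ρ | SubCell.Facet σ ρ ∧ SubCell.Facet ρ τ} := by
      ext ⟨ρ, h'⟩
      simp only [Facet, Set.mem_ofPred_eq, Set.mem_image, Prod.mk.injEq]
      constructor
      · rintro ⟨⟨h1, rfl⟩ | ⟨rfl, h1, rfl⟩, ⟨h2, h3⟩ | ⟨rfl, h2, h3⟩⟩
        · exact ⟨ρ, ⟨h1, h2⟩, rfl, rfl⟩
        · exact (h2 h3).elim
        · exact (h1 h3.symm).elim
        · exact (h2 rfl).elim
      · rintro ⟨ρ, ⟨h1, h2⟩, rfl, rfl⟩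
        exact ⟨.inl ⟨h1, rfl⟩, .inl ⟨h2, rfl⟩⟩
    rw [this, Set.ncard_image_of_injective _ fun a b hab => (Prod.mk.inj hab).1]
    exact SubCell.even_between σ τ
  · by_cases hc : h ≠ none ∧ h'' = none ∧ SubCell.Facet σ τ
    · obtain ⟨h1, rfl, h2⟩ := hc
      have : {w' : T.ProdCell k | Facet (σ, h) w' ∧ Facet w' (τ, none)} = {(τ, h), (σ, none)} := by
        ext ⟨ρ, h'⟩
        simp only [Facet, Set.mem_ofPred_eq, Set.mem_insert_iff, Set.mem_singleton_iff,
          Prod.mk.injEq]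
        constructor
        · rintro ⟨⟨h3, rfl⟩ | ⟨rfl, h3, rfl⟩, ⟨h4, h5⟩ | ⟨rfl, h4, h5⟩⟩ <;> simp_all
        · rintro (⟨rfl, rfl⟩ | ⟨rfl, rfl⟩)
          · exact ⟨.inl ⟨h2, rfl⟩, .inr ⟨rfl, h1, trivial⟩⟩
          · exact ⟨.inr ⟨rfl, h1, rfl⟩, .inl ⟨h2, rfl⟩⟩
      rw [this, Set.ncard_pair]
      · exact even_two
      · simp [h1]
    · have : {w' : T.ProdCell k | Facet (σ, h) w' ∧ Facet w' (τ, h'')} = ∅ := by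
        ext ⟨ρ, h'⟩
        simp only [Facet, Set.mem_ofPred_eq, Set.mem_empty_iff_false, iff_false]
        rintro ⟨⟨h3, rfl⟩ | ⟨rfl, h3, rfl⟩, ⟨h4, h5⟩ | ⟨rfl, h4, h5⟩⟩
        · exact hh h5
        · exact hc ⟨h4, h5, h3⟩
        · exact hc ⟨h3, h5.symm, h4⟩
        · exact h4 rfl
      simp [this]

end ProdCell
end TannerSquareComplex

open TannerSquareComplex

/-! ### Embedded codes and the replacement steps -/

/-- A code `total` composed of local codes indexed by the vertices of `T`: every vertex of `total`
belongs to the local code of its `base`, and vertices of `total` are adjacent only within one local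
code or between the local codes of adjacent vertices of `T`. -/
structure EmbeddedCode (T : TannerSquareComplex) where
  total : TannerSquareComplex
  base : total.V → T.V
  base_inc : ∀ {c c'}, total.inc c c' → base c = base c' ∨ T.inc (base c) (base c')

namespace ReplaceX

/-- The pairs `(v, w)` of a vertex `v` of `T` and a cell `w` of `Y_v`. -/
abbrev Vertex (T : TannerSquareComplex) (k : ℕ) : Type :=
  {p : T.V × T.ProdCell k // p.2 ∈ ProdCell.localCells k p.1}

variable {T : TannerSquareComplex} {k : ℕ}

/-- Adjacency is incidence of cells within a `Y_v`, and equality of cells under the inclusion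
`Y_{v'} ⊆ Y_v` for adjacent `v`, `v'`. -/
def Inc (p p' : Vertex T k) : Prop :=
  (p.1.1 = p'.1.1 ∧ ProdCell.Facet p.1.2 p'.1.2) ∨ (T.inc p.1.1 p'.1.1 ∧ p.1.2 = p'.1.2)

/-- The squares are the 4-cycles of the Tanner graph, except that a 4-cycle whose two checks lie
over an `X`-check and a `Z`-check of `T` has to lie over a square of `T`. -/
def Sq (p p₁ p₂ p' : Vertex T k) : Prop :=
  p₁ ≠ p₂ ∧ Inc p p₁ ∧ Inc p₁ p' ∧ Inc p p₂ ∧ Inc p₂ p' ∧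
    (T.deg p'.1.1 = T.deg p.1.1 + 2 → T.sq p.1.1 p₁.1.1 p₂.1.1 p'.1.1)

theorem even_common (p p' : Vertex T k) : Even {p₁ | Inc p p₁ ∧ Inc p₁ p'}.ncard := by
  obtain ⟨⟨v, w⟩, hw⟩ := p
  obtain ⟨⟨v', w'⟩, hw'⟩ := p'
  simp only at hw hw'
  by_cases hv : v = v'
  · subst hv
    have : {w₁ | ProdCell.Facet w w₁ ∧ ProdCell.Facet w₁ w'} =
        (fun p : Vertex T k => p.1.2) '' {p₁ | Inc ⟨(v, w), hw⟩ p₁ ∧ Inc p₁ ⟨(v, w'), hw'⟩} := by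
      ext w₁
      simp only [Set.mem_image, Set.mem_ofPred_eq, Inc]
      constructor
      · rintro ⟨h1, h2⟩
        exact ⟨⟨(v, w₁), ProdCell.local_closed h2 hw'⟩, ⟨.inl ⟨rfl, h1⟩, .inl ⟨rfl, h2⟩⟩, rfl⟩
      · rintro ⟨⟨⟨v₁, w₂⟩, h₁⟩, ⟨⟨rfl, h1⟩ | ⟨h1, h1'⟩, ⟨h2, h2'⟩ | ⟨h2, h2'⟩⟩, rfl⟩
        · exact ⟨h1, h2'⟩
        · have := T.inc_deg h2
          simp only at this
          omega
        · simp only at h1 h2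
          subst h2
          have := T.inc_deg h1
          omega
        · have := T.inc_deg h1
          have := T.inc_deg h2
          simp only at *
          omega
    rw [← Set.InjOn.ncard_image (f := fun p : Vertex T k => p.1.2), ← this]
    · exact ProdCell.even_between w w'
    · have hfst : ∀ p₁ : Vertex T k,
          (Inc ⟨(v, w), hw⟩ p₁ ∧ Inc p₁ ⟨(v, w'), hw'⟩) → p₁.1.1 = v := by
        rintro ⟨⟨v₁, w₂⟩, h₁⟩ ⟨⟨rfl, h1⟩ | ⟨h1, h1'⟩, ⟨h2, h2'⟩ | ⟨h2, h2'⟩⟩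
        · rfl
        · rfl
        · exact h2
        · have := T.inc_deg h1
          have := T.inc_deg h2
          simp only at *
          omega
      intro a ha b hb hab
      exact Subtype.ext (Prod.ext ((hfst a ha).trans (hfst b hb).symm) hab)
  by_cases hi : T.inc v v'
  · have hd := T.inc_deg hi
    by_cases hf : ProdCell.Facet w w'
    · have : {p₁ | Inc ⟨(v, w), hw⟩ p₁ ∧ Inc p₁ ⟨(v', w'), hw'⟩} =
          {⟨(v', w), ProdCell.local_closed hf hw'⟩, ⟨(v, w'), ProdCell.local_mono hi hw'⟩} := by
        ext ⟨⟨v₁, w₁⟩, h₁⟩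
        simp only [Inc, Set.mem_ofPred_eq, Set.mem_insert_iff, Set.mem_singleton_iff,
          Subtype.mk.injEq, Prod.mk.injEq]
        constructor
        · rintro ⟨⟨h1, h1'⟩ | ⟨h1, h1'⟩, ⟨h2, h2'⟩ | ⟨h2, h2'⟩⟩
          · exact (hv (h1.trans h2)).elim
          · exact .inr ⟨h1.symm, h2'⟩
          · exact .inl ⟨h2, h1'.symm⟩
          · have := T.inc_deg h1
            have := T.inc_deg h2
            omega
        · rintro (⟨rfl, rfl⟩ | ⟨rfl, rfl⟩)
          · exact ⟨.inr ⟨hi, rfl⟩, .inl ⟨rfl, hf⟩⟩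
          · exact ⟨.inl ⟨rfl, hf⟩, .inr ⟨hi, rfl⟩⟩
      rw [this, Set.ncard_pair]
      · exact even_two
      · intro h
        exact hv (Prod.mk.inj (Subtype.mk.inj h)).1.symm
    · have : {p₁ | Inc ⟨(v, w), hw⟩ p₁ ∧ Inc p₁ ⟨(v', w'), hw'⟩} = ∅ := by
        ext ⟨⟨v₁, w₁⟩, h₁⟩
        simp only [Inc, Set.mem_ofPred_eq, Set.mem_empty_iff_false, iff_false]
        rintro ⟨⟨h1, h1'⟩ | ⟨h1, h1'⟩, ⟨h2, h2'⟩ | ⟨h2, h2'⟩⟩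
        · exact hv (h1.trans h2)
        · exact hf (h2' ▸ h1')
        · exact hf (h1' ▸ h2')
        · have := T.inc_deg h1
          have := T.inc_deg h2
          omega
      simp [this]
  by_cases hww : w = w'
  · subst hww
    have : {v₁ | T.inc v v₁ ∧ T.inc v₁ v'} =
        (fun p : Vertex T k => p.1.1) '' {p₁ | Inc ⟨(v, w), hw⟩ p₁ ∧ Inc p₁ ⟨(v', w), hw'⟩} := by
      ext v₁
      simp only [Set.mem_image, Set.mem_ofPred_eq, Inc]
      constructor
      · rintro ⟨h1, h2⟩
        exact ⟨⟨(v₁, w), ProdCell.local_mono h2 hw'⟩, ⟨.inr ⟨h1, rfl⟩, .inr ⟨h2, rfl⟩⟩, rfl⟩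
      · rintro ⟨⟨⟨v₁, w₁⟩, h₁⟩, ⟨⟨rfl, h1⟩ | ⟨h1, h1'⟩, ⟨h2, h2'⟩ | ⟨h2, h2'⟩⟩, rfl⟩
        · exact (hv h2).elim
        · exact (hi h2).elim
        · simp only at h1 h2
          exact (hi (h2 ▸ h1)).elim
        · exact ⟨h1, h2⟩
    rw [← Set.InjOn.ncard_image (f := fun p : Vertex T k => p.1.1), ← this]
    · exact T.even_common v v'
    · have hsnd : ∀ p₁ : Vertex T k,
          (Inc ⟨(v, w), hw⟩ p₁ ∧ Inc p₁ ⟨(v', w), hw'⟩) → p₁.1.2 = w := by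
        rintro ⟨⟨v₁, w₂⟩, h₁⟩ ⟨⟨h1, h1'⟩ | ⟨h1, h1'⟩, ⟨h2, h2'⟩ | ⟨h2, h2'⟩⟩
        · exact (hv (h1.trans h2)).elim
        · exact h2'
        · exact h1'.symm
        · exact h2'
      intro a ha b hb hab
      exact Subtype.ext (Prod.ext hab ((hsnd a ha).trans (hsnd b hb).symm))
  · have : {p₁ | Inc ⟨(v, w), hw⟩ p₁ ∧ Inc p₁ ⟨(v', w'), hw'⟩} = ∅ := by
      ext ⟨⟨v₁, w₁⟩, h₁⟩
      simp only [Inc, Set.mem_ofPred_eq, Set.mem_empty_iff_false, iff_false]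
      rintro ⟨⟨h1, h1'⟩ | ⟨h1, h1'⟩, ⟨h2, h2'⟩ | ⟨h2, h2'⟩⟩
      · exact hv (h1.trans h2)
      · exact hi (h1 ▸ h2)
      · exact hi (h2 ▸ h1)
      · exact hww (h1'.trans h2')
    simp [this]

theorem sq_cover {p p₁ p' : Vertex T k} (h : Inc p p₁) (h' : Inc p₁ p') : ∃ p₂, Sq p p₁ p₂ p' := by
  by_cases hd : T.deg p'.1.1 = T.deg p.1.1 + 2
  · have h1 : T.inc p.1.1 p₁.1.1 ∧ p.1.2 = p₁.1.2 := by
      rcases h with h | h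
      · rcases h' with h' | h'
        · have := congrArg T.deg (h.1.trans h'.1)
          omega
        · have := T.inc_deg h'.1
          rw [← h.1] at this
          omega
      · exact h
    have h2 : T.inc p₁.1.1 p'.1.1 ∧ p₁.1.2 = p'.1.2 := by
      rcases h' with h' | h'
      · have := T.inc_deg h1.1
        rw [h'.1] at this
        omega
      · exact h'
    obtain ⟨q, hq⟩ := T.sq_cover h1.1 h2.1
    have hqr : T.inc q p'.1.1 := T.sq_right (T.sq_symm hq)
    refine ⟨⟨(q, p'.1.2), ProdCell.local_mono hqr p'.2⟩, ?_, h, h',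
      .inr ⟨T.sq_left (T.sq_symm hq), h1.2.trans h2.2⟩, .inr ⟨hqr, rfl⟩, fun _ => hq⟩
    intro he
    exact T.sq_ne hq (congrArg (fun p : Vertex T k => p.1.1) he)
  · have hmem : p₁ ∈ {p₁ | Inc p p₁ ∧ Inc p₁ p'} := ⟨h, h'⟩
    have hpos : 0 < {p₁ | Inc p p₁ ∧ Inc p₁ p'}.ncard :=
      (Set.ncard_pos (Set.toFinite _)).2 ⟨p₁, hmem⟩
    have hone : 1 < {p₁ | Inc p p₁ ∧ Inc p₁ p'}.ncard := by
      obtain ⟨n, hn⟩ := even_common p p'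
      omega
    obtain ⟨p₂, h2, hne⟩ := Set.exists_ne_of_one_lt_ncard hone p₁
    exact ⟨p₂, hne.symm, h, h', h2.1, h2.2, fun hc => (hd hc).elim⟩

end ReplaceX

/-- The Tanner square complex of the `X`-replacement. Its vertices are the pairs `(v, w)` of a
vertex `v` of `T` and a cell `w` of `Y_v`, in degree `deg v + dim w`. -/
def replaceXTotal (T : TannerSquareComplex) (k : ℕ) : TannerSquareComplex where
  V := ReplaceX.Vertex T k
  finite := inferInstance
  deg p := T.deg p.1.1 + p.1.2.dim
  deg_le p := ProdCell.local_dim_le p.2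
  inc := ReplaceX.Inc
  inc_deg := by
    rintro p p' (⟨h, h'⟩ | ⟨h, h'⟩)
    · rw [h, h'.dim_eq, add_assoc]
    · rw [h', T.inc_deg h]
      omega
  sq := ReplaceX.Sq
  sq_symm h := ⟨h.1.symm, h.2.2.2.1, h.2.2.2.2.1, h.2.1, h.2.2.1, fun hd =>
    T.sq_symm (h.2.2.2.2.2 hd)⟩
  sq_ne h := h.1
  sq_left h := h.2.1
  sq_right h := h.2.2.1
  sq_cover := ReplaceX.sq_cover
  even_common := ReplaceX.even_common

/-- The `X`-replacement, in which every edge of `T` is divided into `k` edges. The local code over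
`v` is the cellular cochain complex of `Y_v`, shifted by `deg v`. -/
def replaceX (T : TannerSquareComplex) (k : ℕ) : EmbeddedCode T where
  total := replaceXTotal T k
  base p := p.1.1
  base_inc := by
    rintro c c' (h | h)
    exacts [.inl h.1, .inr h.1]

/-- The `Z`-replacement: the `X`-replacement with the roles of `X`- and `Z`-checks exchanged and
with the transposed local complexes. -/
def replaceZ (T : TannerSquareComplex) (k : ℕ) : EmbeddedCode T where
  total := (replaceXTotal T.dual k).dual
  base p := p.1.1
  base_inc := by
    rintro c c' (h | h)
    exacts [.inl h.1.symm, .inr h.1]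

namespace SurfaceCode

def deg (v : Fin 3 × Fin 3) : ℕ :=
  if Odd v.1.1 ∧ Even v.2.1 then 0 else if Even v.1.1 ∧ Odd v.2.1 then 2 else 1

def Inc (u v : Fin 3 × Fin 3) : Prop :=
  Nat.dist u.1.1 v.1.1 + Nat.dist u.2.1 v.2.1 = 1 ∧ deg v = deg u + 1

instance : DecidableRel Inc := fun _ _ => inferInstanceAs (Decidable (_ ∧ _))

end SurfaceCode

open SurfaceCode in
/-- The Tanner square complex of the `⟦5, 1, 2⟧` surface code: a `3 × 3` grid of vertices with
four squares. The qubits are the four corners and the center, the `X`-checks are `(1, 0)` and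
`(1, 2)`, the `Z`-checks are `(0, 1)` and `(2, 1)`. -/
def surfaceCode : TannerSquareComplex where
  V := Fin 3 × Fin 3
  finite := inferInstance
  deg := deg
  deg_le := by decide
  inc := Inc
  inc_deg h := h.2
  sq x q q' z := q ≠ q' ∧ Inc x q ∧ Inc q z ∧ Inc x q' ∧ Inc q' z
  sq_symm h := ⟨h.1.symm, h.2.2.2.1, h.2.2.2.2, h.2.1, h.2.2.1⟩
  sq_ne h := h.1
  sq_left h := h.2.1
  sq_right h := h.2.2.1
  sq_cover {x q z} h h' := by
    have key : ∀ x q z, Inc x q ∧ Inc q z → ∃ q', q ≠ q' ∧ Inc x q' ∧ Inc q' z := by decide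
    obtain ⟨q', h1, h2⟩ := key x q z ⟨h, h'⟩
    exact ⟨q', h1, h, h', h2⟩
  even_common x z := by
    have key : ∀ x z : Fin 3 × Fin 3, Even (Finset.univ.filter fun q => Inc x q ∧ Inc q z).card := by
      decide
    rw [Set.ncard_eq_toFinset_card']
    convert key x z using 2
    ext q
    simp

/-- The Tanner square complexes `T_(i)` of the construction with scale parameter `ℓ`: starting from
the surface code, `X`-replacements (`i` even) and `Z`-replacements (`i` odd) alternate, and in each
of them every edge is divided into `(ℓ - 1) / 2` edges. -/
def level (ℓ : ℕ) : ℕ → TannerSquareComplex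
  | 0 => surfaceCode
  | i + 1 =>
    if Even i then (replaceX (level ℓ i) ((ℓ - 1) / 2)).total
    else (replaceZ (level ℓ i) ((ℓ - 1) / 2)).total

/-! ### The induced complex -/

namespace EmbeddedCode

variable {T : TannerSquareComplex} (E : EmbeddedCode T)

/-- The basis of `C_R^m`, the degree `m` part of the direct sum of the local complexes over the
vertices of `T` of degree `R`; the rows `C_X`, `C_Q`, `C_Z` are `R = 0, 1, 2`. -/
abbrev Basis (R m : ℕ) : Type := {c : E.total.V // T.deg (E.base c) = R ∧ E.total.deg c = m}

abbrev C (R m : ℕ) : Type := E.Basis R m → ZMod 2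

/-- The local coboundary maps `δ_X`, `δ_Q`, `δ_Z`. -/
noncomputable def locD (R m : ℕ) : E.C R m →ₗ[ZMod 2] E.C R (m + 1) :=
  incidenceMap fun c c' => E.total.inc c.1 c'.1 ∧ E.base c.1 = E.base c'.1

/-- The connecting maps `g_XQ` (`R = 0`) and `g_QZ` (`R = 1`). -/
noncomputable def conn (R m : ℕ) : E.C R m →ₗ[ZMod 2] E.C (R + 1) (m + 1) :=
  incidenceMap fun c c' => E.total.inc c.1 c'.1 ∧ T.inc (E.base c.1) (E.base c'.1)

/-- The coboundaries in `C_R^m` for the local coboundary map. -/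
noncomputable def locB (R : ℕ) : (m : ℕ) → Submodule (ZMod 2) (E.C R m)
  | 0 => ⊥
  | m + 1 => LinearMap.range (E.locD R m)

/-- The cocycles in `C_R^m` for the local coboundary map. -/
noncomputable abbrev locZ (R m : ℕ) : Submodule (ZMod 2) (E.C R m) := LinearMap.ker (E.locD R m)

/-- The local cohomology `H^m(C_R, δ_R)`. -/
abbrev H (R m : ℕ) : Type := E.locZ R m ⧸ (E.locB R m).submoduleOf (E.locZ R m)

theorem locD_comp_locD (R m : ℕ) : E.locD R (m + 1) ∘ₗ E.locD R m = 0 := by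
  refine incidenceMap_comp_eq_zero fun a c => ?_
  by_cases hac : E.base a.1 = E.base c.1
  · convert E.total.even_common a.1 c.1 using 1
    rw [← Set.ncard_image_of_injective _ Subtype.val_injective]
    congr 1
    ext b
    simp only [Set.mem_image, Set.mem_ofPred_eq]
    constructor
    · rintro ⟨b, h, rfl⟩
      exact ⟨h.1.1, h.2.1⟩
    · rintro ⟨h1, h2⟩
      have hb : E.base a.1 = E.base b := by
        rcases E.base_inc h1 with h | h
        · exact h
        · have := T.inc_deg h
          rcases E.base_inc h2 with h' | h'
          · exact hac.trans h'.symm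
          · have := T.inc_deg h'
            rw [hac] at *
            omega
      have hm : E.total.deg b = m + 1 := by rw [E.total.inc_deg h1, a.2.2]
      exact ⟨⟨b, by rw [← hb]; exact a.2.1, hm⟩, ⟨⟨h1, hb⟩, h2, hb.symm.trans hac⟩, rfl⟩
  · have : {b : E.Basis R (m + 1) | (E.total.inc a.1 b.1 ∧ E.base a.1 = E.base b.1) ∧
        (E.total.inc b.1 c.1 ∧ E.base b.1 = E.base c.1)} = ∅ := by
      ext b
      simp only [Set.mem_ofPred_eq, Set.mem_empty_iff_false, iff_false]
      rintro ⟨h, h'⟩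
      exact hac (h.2.trans h'.2)
    simp [this]

/-- The connecting maps are compatible with the local coboundary maps. -/
theorem conn_comp_locD (R m : ℕ) :
    E.conn R (m + 1) ∘ₗ E.locD R m = E.locD (R + 1) (m + 1) ∘ₗ E.conn R m := by
  refine incidenceMap_comp_eq fun a c => ?_
  have key : {b | E.total.inc a.1 b ∧ E.total.inc b c.1} =
      (Subtype.val '' {b : E.Basis R (m + 1) | (E.total.inc a.1 b.1 ∧ E.base a.1 = E.base b.1) ∧
        (E.total.inc b.1 c.1 ∧ T.inc (E.base b.1) (E.base c.1))}) ∪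
      (Subtype.val '' {b : E.Basis (R + 1) (m + 1) |
        (E.total.inc a.1 b.1 ∧ T.inc (E.base a.1) (E.base b.1)) ∧
        (E.total.inc b.1 c.1 ∧ E.base b.1 = E.base c.1)}) := by
    ext b
    simp only [Set.mem_image, Set.mem_ofPred_eq, Set.mem_union]
    have ha := a.2.1
    have hc := c.2.1
    constructor
    · rintro ⟨h1, h2⟩
      have hm : E.total.deg b = m + 1 := by rw [E.total.inc_deg h1, a.2.2]
      rcases E.base_inc h1 with h | h <;> rcases E.base_inc h2 with h' | h'
      · rw [h, h', hc] at ha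
        omega
      · exact .inl ⟨⟨b, by rw [← h]; exact ha, hm⟩, ⟨⟨h1, h⟩, h2, h'⟩, rfl⟩
      · exact .inr ⟨⟨b, by rw [h']; exact hc, hm⟩, ⟨⟨h1, h⟩, h2, h'⟩, rfl⟩
      · have := T.inc_deg h
        have := T.inc_deg h'
        omega
    · rintro (⟨b, h, rfl⟩ | ⟨b, h, rfl⟩) <;> exact ⟨h.1.1, h.2.1⟩
  have hev := E.total.even_common a.1 c.1
  rw [key, Set.ncard_union_eq ?_ (Set.toFinite _) (Set.toFinite _),
    Set.ncard_image_of_injective _ Subtype.val_injective,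
    Set.ncard_image_of_injective _ Subtype.val_injective] at hev
  · exact hev
  · rw [Set.disjoint_left]
    rintro _ ⟨b, -, rfl⟩ ⟨b', -, h⟩
    have h1 := b.2.1
    have h2 := b'.2.1
    rw [h] at h2
    omega

theorem conn_mem_locZ (R m : ℕ) : E.locZ R m ≤ (E.locZ (R + 1) (m + 1)).comap (E.conn R m) := by
  intro f hf
  have h := LinearMap.congr_fun (E.conn_comp_locD R m) f
  simp only [LinearMap.comp_apply] at h
  rw [LinearMap.mem_ker] at hf
  rw [Submodule.mem_comap, LinearMap.mem_ker, ← h, hf, map_zero]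

theorem conn_mem_locB (R m : ℕ) : E.locB R m ≤ (E.locB (R + 1) (m + 1)).comap (E.conn R m) := by
  cases m with
  | zero => exact bot_le
  | succ m =>
    rintro _ ⟨f, rfl⟩
    exact ⟨E.conn R m f, (LinearMap.congr_fun (E.conn_comp_locD R m) f).symm⟩

/-- The maps `H(g_XQ^m)` (`R = 0`) and `H(g_QZ^m)` (`R = 1`) induced on local cohomology. -/
noncomputable def Hconn (R m : ℕ) : E.H R m →ₗ[ZMod 2] E.H (R + 1) (m + 1) :=
  Submodule.mapQ _ _ ((E.conn R m).restrict (E.conn_mem_locZ R m)) fun _ hf =>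
    E.conn_mem_locB R m hf

/-- The degree `m` part `H^m(C_X) ⊕ H^m(C_Q) ⊕ H^m(C_Z)` of the induced complex
`(H(C, δ_loc), H(g))`. -/
abbrev Induced (m : ℕ) : Type := E.H 0 m × E.H 1 m × E.H 2 m

/-- The differential `H(g)` of the induced complex. -/
noncomputable def inducedD (m : ℕ) : E.Induced m →ₗ[ZMod 2] E.Induced (m + 1) :=
  LinearMap.prod 0 (LinearMap.prod (E.Hconn 0 m ∘ₗ LinearMap.fst _ _ _)
    (E.Hconn 1 m ∘ₗ LinearMap.fst _ _ _ ∘ₗ LinearMap.snd _ _ _))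

/-- A map from `H^m(C_R)` to families indexed by the vertices `v` of `T` of degree `R` is local if
it respects the decomposition of `C_R` into local complexes: the value at `v` vanishes on
the classes of cocycles that vanish on the local complex over `v`. -/
def IsLocal {R m : ℕ} {M : Type} [Zero M] (φ : E.H R m → (T.Vert R → M)) : Prop :=
  ∀ (f : E.locZ R m) (v : T.Vert R), (∀ c, E.base c.1 = v.1 → f.1 c = 0) →
    φ (Submodule.Quotient.mk f) v = 0

end EmbeddedCode

/-- The diagonal map `𝔽₂^A → (𝔽₂²)^A`. -/
def diagonal (A : Type) : (A → ZMod 2) →ₗ[ZMod 2] (A → ZMod 2 × ZMod 2) where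
  toFun b := fun a => (b a, b a)
  map_add' _ _ := rfl
  map_smul' _ _ := rfl

/-- The codiagonal map `(𝔽₂²)^A → 𝔽₂^A`. -/
def codiagonal (A : Type) : (A → ZMod 2 × ZMod 2) →ₗ[ZMod 2] (A → ZMod 2) where
  toFun b := fun a => (b a).1 + (b a).2
  map_add' b c := by
    ext a
    simp only [Pi.add_apply, Prod.fst_add, Prod.snd_add]
    ring
  map_smul' t b := by
    ext a
    simp only [Pi.smul_apply, Prod.smul_fst, Prod.smul_snd, smul_eq_mul, RingHom.id_apply]
    ring

end CodeReplacement

namespace CodeReplacement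
namespace TannerSquareComplex

variable {T : TannerSquareComplex} {k : ℕ}

/-! Each local complex is the cochain complex of an explicit space, and the theorem is a computation
of cohomology of these spaces in low degree. Suppose `Y_x` and `Y_q` are connected. Then their
degree-zero cohomology consists of the constants, while `Y_z` is two points, with cohomology `𝔽₂²`.
Connecting maps are restrictions, so a family of constants `g` is sent to the family of constants
given by the coboundary of `g` in the old code (`conn_constMap`). Over a `Z`-check a constant takes
the same value at both points, which is the diagonal. Most other summands vanish because `C_R`
starts in degree `R`. The only one that needs geometry is `H^1(C_X)`, which is the first cohomology
of the spaces `Y_x`.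

That group vanishes because `X_x` is simply connected and `∂X_x` is connected: `Y_x` is two copies
of `X_x` glued along a cylinder over `∂X_x`. The proof constructs potentials explicitly. Inside a
square, path sums of a cocycle depend only on the endpoint (`grid_sum_eq`). Over several squares
with the same `x` and `z` they agree because these squares form a connected family
(`edgeSum_add_edgeSum`). The potentials on the two copies then differ from the prescribed vertical
values by a constant along `∂X_x`, which is absorbed into one copy (`exists_potential`).

The geometric input is the property `LocallyConnected`, and the induction over levels is an
induction on this property. It holds for the surface code, it is self-dual, and
`LocallyConnected.replaceX` shows that the replacement preserves it. The main point there is that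
the edges of `Y_x` at a vertex are connected through faces of `Y_x` (`cofacets_connected`).

The `Z`-replacement is the transpose of the `X`-replacement of the dual complex. Transposing the
inclusion of constants gives summation over a local complex, and exactness passes to transposes of
matrices (`exact_transpose`). Thus the top local cohomology over qubits and `Z`-checks is detected
by the sum, and the sum over the two points above an `X`-check is the codiagonal. -/

theorem ne_of_inc {u v : T.V} (h : T.inc u v) : u ≠ v := fun e => by
  have := T.inc_deg h
  rw [e] at this
  omega

/-! ### Stars and links -/

theorem mem_star_of_deg_zero {x : T.V} (hx : T.deg x = 0) {σ : T.Cell} :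
    σ ∈ star x ↔ ∃ f : T.Face, f.bot = x ∧ σ.Le (.face f) := by
  constructor
  · rintro ⟨τ, h1, h2, h3⟩
    cases τ with
    | vert v => simp only [Cell.dim] at h1; omega
    | edge e => simp only [Cell.dim] at h1; omega
    | face f => exact ⟨f, h2, h3⟩
  · rintro ⟨f, h1, h2⟩
    exact ⟨.face f, by simp only [Cell.dim]; omega, h1, h2⟩

theorem mem_star_of_deg_one {q : T.V} (hq : T.deg q = 1) {σ : T.Cell} :
    σ ∈ star q ↔ ∃ e : T.Edge, e.src = q ∧ σ.Le (.edge e) := by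
  constructor
  · rintro ⟨τ, h1, h2, h3⟩
    cases τ with
    | vert v => simp only [Cell.dim] at h1; omega
    | edge e => exact ⟨e, h2, h3⟩
    | face f => simp only [Cell.dim] at h1; omega
  · rintro ⟨e, h1, h2⟩
    exact ⟨.edge e, by simp only [Cell.dim]; omega, h1, h2⟩

theorem mem_star_of_deg_two {z : T.V} (hz : T.deg z = 2) {σ : T.Cell} :
    σ ∈ star z ↔ σ = .vert z := by
  constructor
  · rintro ⟨τ, h1, h2, h3⟩
    cases τ with
    | vert v =>
      cases σ <;> simp only [Cell.Le, Cell.bot] at h2 h3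
      rw [h3, h2]
    | edge e => simp only [Cell.dim] at h1; omega
    | face f => simp only [Cell.dim] at h1; omega
  · rintro rfl
    exact ⟨.vert z, by simp only [Cell.dim]; omega, rfl, rfl⟩

/-- The two lower sides of a square at `x` contain `x`, so only the upper sides remain, and these
start at qubits adjacent to `x`. Conversely, an edge starting at such a qubit lies in the star of
the qubit, hence in the link by `star_subset_link`, which rests on the covering of paths `x, q, z`
by squares. -/
theorem mem_link_of_deg_zero {x : T.V} (hx : T.deg x = 0) {σ : T.Cell} :
    σ ∈ link x ↔ ∃ e : T.Edge, T.inc x e.src ∧ σ.Le (.edge e) := by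
  constructor
  · rintro ⟨τ, h1, h2, h3, h4⟩
    cases τ with
    | vert v => simp only [Cell.dim] at h1; omega
    | edge e =>
      refine ⟨e, ?_, h4⟩
      obtain ⟨f, rfl, hf⟩ := (mem_star_of_deg_zero hx).1 h2
      rcases hf with rfl | rfl | rfl | rfl
      · exact (h3 (Or.inl rfl)).elim
      · exact (h3 (Or.inl rfl)).elim
      · exact T.sq_left f.sq
      · exact T.sq_left (T.sq_symm f.sq)
    | face f => simp only [Cell.dim] at h1; omega
  · rintro ⟨e, h1, h2⟩
    have := T.inc_deg h1
    exact star_subset_link h1 ((mem_star_of_deg_one (by omega)).2 ⟨e, rfl, h2⟩)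

theorem mem_link_of_deg_one {q : T.V} (hq : T.deg q = 1) {σ : T.Cell} :
    σ ∈ link q ↔ ∃ z, T.inc q z ∧ σ = .vert z := by
  constructor
  · rintro ⟨τ, h1, h2, h3, h4⟩
    cases τ with
    | vert v =>
      obtain ⟨e, rfl, he⟩ := (mem_star_of_deg_one hq).1 h2
      rcases he with rfl | rfl
      · exact (h3 rfl).elim
      · refine ⟨_, e.inc, ?_⟩
        cases σ <;> simp only [Cell.Le] at h4
        rw [h4]
    | edge e => simp only [Cell.dim] at h1; omega
    | face f => simp only [Cell.dim] at h1; omega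
  · rintro ⟨z, h1, rfl⟩
    have := T.inc_deg h1
    exact star_subset_link h1 ((mem_star_of_deg_two (by omega)).2 rfl)

theorem not_mem_link_of_deg_two {z : T.V} (hz : T.deg z = 2) {σ : T.Cell} : σ ∉ link z := by
  intro h
  have := link_dim_le h
  omega

namespace SubCell

/-! ### Positions on edges and squares -/

theorem carrier_le_edge {s : T.SubCell k} {e : T.Edge} (hk : k ≠ 0) :
    s.carrier.Le (.edge e) ↔ ∃ a ≤ 2 * k, s = onEdge k e a := by
  constructor
  · intro h
    cases s with
    | vert v =>
      rcases h with rfl | rfl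
      · exact ⟨0, by omega, (onEdge_zero _).symm⟩
      · exact ⟨2 * k, le_rfl, (onEdge_top _ hk).symm⟩
    | edge e' a =>
      obtain rfl : e' = e := h
      refine ⟨a + 1, by omega, ?_⟩
      unfold onEdge
      rw [if_neg (by omega), dif_pos (by omega)]
      simp
    | face f a b => exact h.elim
  · rintro ⟨a, -, rfl⟩
    exact carrier_onEdge _ _

theorem onEdge_inner (e : T.Edge) {a : ℕ} (ha : a ≠ 0) (ha' : a < 2 * k) :
    onEdge k e a = edge e ⟨a - 1, by omega⟩ := by
  unfold onEdge
  rw [if_neg ha, dif_pos (by omega)]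

theorem onEdge_injective (e : T.Edge) {a a' : ℕ} (ha : a ≤ 2 * k) (ha' : a' ≤ 2 * k)
    (h : onEdge k e a = onEdge k e a') : a = a' := by
  have := ne_of_inc e.inc
  unfold onEdge at h
  split_ifs at h <;>
    simp only [vert.injEq, edge.injEq, Fin.mk.injEq, this, this.symm, true_and] at h <;>
    omega

/-- The cell at position `(a, b)` on the square `(x, q, q', z)`, with the axes through `x` running
along the edges to `q` and to `q'`, in either order of the two qubits. -/
noncomputable def onSq (k : ℕ) {x q q' z : T.V} (h : T.sq x q q' z) (a b : ℕ) : T.SubCell k :=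
  open Classical in
  if hlt : WellOrderingRel q q' then onFace k ⟨x, q, q', z, h, hlt⟩ a b
  else onFace k ⟨x, q', q, z, T.sq_symm h, ((trichotomous_of WellOrderingRel q q').resolve_left
    hlt).resolve_left (T.sq_ne h)⟩ b a

variable {x q q' z : T.V}

/-- This symmetry allows statements to be proved in one coordinate direction and transferred to the
other. -/
theorem onSq_symm (h : T.sq x q q' z) (a b : ℕ) :
    onSq k (T.sq_symm h) a b = onSq k h b a := by
  unfold onSq
  rcases trichotomous_of WellOrderingRel q q' with hlt | heq | hlt
  · have : ¬ WellOrderingRel q' q := asymm_of WellOrderingRel hlt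
    rw [dif_neg this, dif_pos hlt]
  · exact (T.sq_ne h heq).elim
  · have : ¬ WellOrderingRel q q' := asymm_of WellOrderingRel hlt
    rw [dif_neg this, dif_pos hlt]

theorem onSq_face (f : T.Face) (a b : ℕ) : onSq k f.sq a b = onFace k f a b := by
  unfold onSq
  rw [dif_pos f.lt]

/-- Up to the order of its two qubits, every square is one of the listed squares. -/
theorem exists_face_of_sq (h : T.sq x q q' z) :
    (∃ f : T.Face, f.bot = x ∧ ∀ a b, onSq k h a b = onFace k f a b) ∨
    (∃ f : T.Face, f.bot = x ∧ ∀ a b, onSq k h a b = onFace k f b a) := by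
  by_cases hlt : WellOrderingRel q q'
  · exact .inl ⟨⟨x, q, q', z, h, hlt⟩, rfl, fun a b => by unfold onSq; rw [dif_pos hlt]⟩
  · exact .inr ⟨⟨x, q', q, z, T.sq_symm h, ((trichotomous_of WellOrderingRel q q').resolve_left
      hlt).resolve_left (T.sq_ne h)⟩, rfl, fun a b => by unfold onSq; rw [dif_neg hlt]⟩

theorem onSq_bot (h : T.sq x q q' z) {a : ℕ} (ha : a ≤ 2 * k) :
    onSq k h a 0 = onEdge k ⟨x, q, T.sq_left h⟩ a := by
  unfold onSq
  split_ifs with hlt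
  · exact onFace_bot _ _
  · exact onFace_left _ ha

theorem onSq_left (h : T.sq x q q' z) {b : ℕ} (hb : b ≤ 2 * k) :
    onSq k h 0 b = onEdge k ⟨x, q', T.sq_left (T.sq_symm h)⟩ b := by
  rw [← onSq_symm, onSq_bot _ hb]

theorem onSq_right (h : T.sq x q q' z) (hk : k ≠ 0) {b : ℕ} (hb : b ≤ 2 * k) :
    onSq k h (2 * k) b = onEdge k ⟨q, z, T.sq_right h⟩ b := by
  unfold onSq
  split_ifs with hlt
  · exact onFace_right _ hk hb
  · exact onFace_top _ hk _

theorem onSq_top (h : T.sq x q q' z) (hk : k ≠ 0) {a : ℕ} (ha : a ≤ 2 * k) :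
    onSq k h a (2 * k) = onEdge k ⟨q', z, T.sq_right (T.sq_symm h)⟩ a := by
  rw [← onSq_symm, onSq_right _ hk ha]

theorem onSq_injective (h : T.sq x q q' z) {a b a' b' : ℕ} (ha : a ≤ 2 * k) (hb : b ≤ 2 * k)
    (ha' : a' ≤ 2 * k) (hb' : b' ≤ 2 * k) (he : onSq k h a b = onSq k h a' b') :
    a = a' ∧ b = b' := by
  unfold onSq at he
  split_ifs at he
  · exact onFace_injective _ ha hb ha' hb' he
  · exact (onFace_injective _ hb ha hb' ha' he).symm

theorem dim_onSq (h : T.sq x q q' z) {a b : ℕ} (ha : a ≤ 2 * k) (hb : b ≤ 2 * k) :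
    (onSq k h a b).dim = a % 2 + b % 2 := by
  unfold onSq
  split_ifs
  · exact dim_onFace _ ha hb
  · rw [dim_onFace _ hb ha, add_comm]

theorem facet_onEdge_odd (e : T.Edge) {σ : T.SubCell k} {i : ℕ} (hi : i < k) :
    Facet σ (onEdge k e (2 * i + 1)) ↔ σ = onEdge k e (2 * i) ∨ σ = onEdge k e (2 * i + 2) :=
  facet_onEdge (by omega) (by simp)

theorem facet_onSq₁ (h : T.sq x q q' z) {σ : T.SubCell k} {i j : ℕ} (hi : i < k) (hj : j ≤ k) :
    Facet σ (onSq k h (2 * i + 1) (2 * j)) ↔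
      σ = onSq k h (2 * i) (2 * j) ∨ σ = onSq k h (2 * i + 2) (2 * j) := by
  unfold onSq
  split_ifs
  · exact facet_onFace₁ (by omega) (by simp) (by omega) (by simp)
  · exact facet_onFace₂ (by omega) (by simp) (by omega) (by simp)

theorem facet_onFace_odd (f : T.Face) {σ : T.SubCell k} {i j : ℕ} (hi : i < k) (hj : j < k) :
    Facet σ (onFace k f (2 * i + 1) (2 * j + 1)) ↔
      (σ = onFace k f (2 * i) (2 * j + 1) ∨ σ = onFace k f (2 * i + 2) (2 * j + 1)) ∨
      (σ = onFace k f (2 * i + 1) (2 * j) ∨ σ = onFace k f (2 * i + 1) (2 * j + 2)) := by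
  rw [onFace_inner f (by omega) (by omega) (by omega) (by omega)]
  simp [Facet]

theorem facet_onSq (h : T.sq x q q' z) {σ : T.SubCell k} {i j : ℕ} (hi : i < k) (hj : j < k) :
    Facet σ (onSq k h (2 * i + 1) (2 * j + 1)) ↔
      (σ = onSq k h (2 * i) (2 * j + 1) ∨ σ = onSq k h (2 * i + 2) (2 * j + 1)) ∨
      (σ = onSq k h (2 * i + 1) (2 * j) ∨ σ = onSq k h (2 * i + 1) (2 * j + 2)) := by
  unfold onSq
  split_ifs
  · exact facet_onFace_odd _ hi hj
  · rw [facet_onFace_odd _ hj hi, or_comm]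

/-! ### The cells of stars and links by position -/

theorem onSq_mem_star (h : T.sq x q q' z) (hx : T.deg x = 0) (a b : ℕ) :
    (onSq k h a b).carrier ∈ star x := by
  rcases exists_face_of_sq (k := k) h with ⟨f, hf, hs⟩ | ⟨f, hf, hs⟩ <;> rw [hs] <;>
    exact (mem_star_of_deg_zero hx).2 ⟨f, hf, carrier_onFace _ _ _⟩

theorem exists_onSq (hx : T.deg x = 0) (hk : k ≠ 0) {s : T.SubCell k} (hs : s.carrier ∈ star x) :
    ∃ (q q' z : T.V) (h : T.sq x q q' z) (a b : ℕ), a ≤ 2 * k ∧ b ≤ 2 * k ∧ s = onSq k h a b := by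
  obtain ⟨f, rfl, hf⟩ := (mem_star_of_deg_zero hx).1 hs
  refine ⟨f.mid₁, f.mid₂, f.top, f.sq, ?_⟩
  simp only [onSq_face]
  have low : ∀ e : T.Edge, s.carrier.Le (.edge e) → (e = f.low₁ ∨ e = f.low₂ ∨ e = f.high₁ ∨
      e = f.high₂) → ∃ a b, a ≤ 2 * k ∧ b ≤ 2 * k ∧ s = onFace k f a b := by
    intro e he hc
    obtain ⟨a, ha, rfl⟩ := (carrier_le_edge hk).1 he
    rcases hc with rfl | rfl | rfl | rfl
    · exact ⟨a, 0, ha, by omega, (onFace_bot _ _).symm⟩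
    · exact ⟨0, a, by omega, ha, (onFace_left _ ha).symm⟩
    · exact ⟨2 * k, a, by omega, ha, (onFace_right _ hk ha).symm⟩
    · exact ⟨a, 2 * k, ha, by omega, (onFace_top _ hk _).symm⟩
  cases s with
  | vert v =>
    rcases hf with rfl | rfl | rfl | rfl
    · exact low f.low₁ (Or.inl rfl) (by simp)
    · exact low f.low₁ (Or.inr rfl) (by simp)
    · exact low f.low₂ (Or.inr rfl) (by simp)
    · exact low f.high₁ (Or.inr rfl) (by simp)
  | edge e a => exact low e (Cell.Le.refl _) hf
  | face f' a b =>
    obtain rfl : f' = f := hf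
    refine ⟨a + 1, b + 1, by omega, by omega, ?_⟩
    rw [onFace_inner _ (by omega) (by omega) (by omega) (by omega)]
    rfl

theorem exists_onSq_zero (hx : T.deg x = 0) (hk : k ≠ 0) {s : T.SubCell k}
    (hs : s.carrier ∈ star x) (hd : s.dim = 0) :
    ∃ (q q' z : T.V) (h : T.sq x q q' z) (i j : ℕ), i ≤ k ∧ j ≤ k ∧
      s = onSq k h (2 * i) (2 * j) := by
  obtain ⟨q, q', z, h, a, b, ha, hb, rfl⟩ := exists_onSq hx hk hs
  rw [dim_onSq h ha hb] at hd
  refine ⟨q, q', z, h, a / 2, b / 2, by omega, by omega, ?_⟩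
  rw [Nat.mul_div_cancel' (by omega), Nat.mul_div_cancel' (by omega)]

/-- A segment has exactly one odd coordinate. Exchanging the two qubits makes it the first one, so
later arguments need to treat only one direction. -/
theorem exists_onSq_one (hx : T.deg x = 0) (hk : k ≠ 0) {s : T.SubCell k}
    (hs : s.carrier ∈ star x) (hd : s.dim = 1) :
    ∃ (q q' z : T.V) (h : T.sq x q q' z) (i j : ℕ), i < k ∧ j ≤ k ∧
      s = onSq k h (2 * i + 1) (2 * j) := by
  obtain ⟨q, q', z, h, a, b, ha, hb, rfl⟩ := exists_onSq hx hk hs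
  rw [dim_onSq h ha hb] at hd
  rcases Nat.even_or_odd' a with ⟨i, rfl | rfl⟩
  · rcases Nat.even_or_odd' b with ⟨j, rfl | rfl⟩
    · omega
    · exact ⟨q', q, z, T.sq_symm h, j, i, by omega, by omega, (onSq_symm _ _ _).symm⟩
  · exact ⟨q, q', z, h, i, b / 2, by omega, by omega, by rw [Nat.mul_div_cancel' (by omega)]⟩

theorem onEdge_mem_link (hx : T.deg x = 0) {e : T.Edge} (he : T.inc x e.src) (a : ℕ) :
    (onEdge k e a).carrier ∈ link x :=
  (mem_link_of_deg_zero hx).2 ⟨e, he, carrier_onEdge _ _⟩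

theorem exists_onEdge_of_mem_link (hx : T.deg x = 0) (hk : k ≠ 0) {s : T.SubCell k}
    (hs : s.carrier ∈ link x) : ∃ e : T.Edge, T.inc x e.src ∧ ∃ a ≤ 2 * k, s = onEdge k e a := by
  obtain ⟨e, h1, h2⟩ := (mem_link_of_deg_zero hx).1 hs
  exact ⟨e, h1, (carrier_le_edge hk).1 h2⟩

theorem exists_onEdge_of_mem_link_zero (hx : T.deg x = 0) (hk : k ≠ 0) {s : T.SubCell k}
    (hs : s.carrier ∈ link x) (hd : s.dim = 0) :
    ∃ e : T.Edge, T.inc x e.src ∧ ∃ i ≤ k, s = onEdge k e (2 * i) := by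
  obtain ⟨e, h1, a, ha, rfl⟩ := exists_onEdge_of_mem_link hx hk hs
  rw [dim_onEdge e ha] at hd
  exact ⟨e, h1, a / 2, by omega, by rw [Nat.mul_div_cancel' (by omega)]⟩

theorem onEdge_mem_star (hq : T.deg q = 1) {e : T.Edge} (he : e.src = q) (a : ℕ) :
    (onEdge k e a).carrier ∈ star q :=
  (mem_star_of_deg_one hq).2 ⟨e, he, carrier_onEdge _ _⟩

theorem exists_onEdge_zero (hq : T.deg q = 1) (hk : k ≠ 0) {s : T.SubCell k}
    (hs : s.carrier ∈ star q) (hd : s.dim = 0) :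
    ∃ e : T.Edge, e.src = q ∧ ∃ i ≤ k, s = onEdge k e (2 * i) := by
  obtain ⟨e, h1, h2⟩ := (mem_star_of_deg_one hq).1 hs
  obtain ⟨a, ha, rfl⟩ := (carrier_le_edge hk).1 h2
  rw [dim_onEdge e ha] at hd
  exact ⟨e, h1, a / 2, by omega, by rw [Nat.mul_div_cancel' (by omega)]⟩

theorem vert_mem_link (hq : T.deg q = 1) (hz : T.inc q z) :
    (vert z : T.SubCell k).carrier ∈ link q :=
  (mem_link_of_deg_one hq).2 ⟨z, hz, rfl⟩

/-- A cell of the closed square `(x, q, q', z)` lies in `∂X_x` if and only if it lies on one of the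
two sides that do not contain `x`. -/
theorem onSq_mem_link_iff (hx : T.deg x = 0) (hk : k ≠ 0) (h : T.sq x q q' z) {a b : ℕ}
    (ha : a ≤ 2 * k) (hb : b ≤ 2 * k) :
    (onSq k h a b).carrier ∈ link x ↔ a = 2 * k ∨ b = 2 * k := by
  constructor
  · intro hm
    by_contra! hc
    -- The lower sides do not meet the link before their far end: at position `0` the cell is `x`,
    -- which has the wrong degree to be an endpoint of an edge above `x`, and at later positions the
    -- carrier is an edge starting at `x`.
    have hv : ∀ {q q' z : T.V} (h : T.sq x q q' z) (a : ℕ), a < 2 * k →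
        (onSq k h a 0).carrier ∉ link x := by
      intro q q' z h a ha hm
      rw [onSq_bot h ha.le] at hm
      obtain ⟨e, h1, h2⟩ := (mem_link_of_deg_zero hx).1 hm
      have := T.inc_deg h1
      have := T.inc_deg e.inc
      by_cases h0 : a = 0
      · rw [h0, onEdge_zero] at h2
        rcases h2 with h2 | h2 <;> simp only at h2 <;> rw [h2] at hx <;> omega
      · rw [onEdge_inner _ h0 ha] at h2
        obtain rfl : _ = e := h2
        exact ne_of_inc h1 rfl
    by_cases hb0 : b = 0
    · subst hb0
      exact hv h a (by omega) hm
    by_cases ha0 : a = 0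
    · subst ha0
      rw [← onSq_symm] at hm
      exact hv _ b (by omega) hm
    obtain ⟨e, h1, h2⟩ := (mem_link_of_deg_zero hx).1 hm
    rcases exists_face_of_sq (k := k) h with ⟨f, hf, hs⟩ | ⟨f, hf, hs⟩ <;>
      rw [hs, onFace_inner f (by omega) (by omega) (by omega) (by omega)] at h2 <;> exact h2
  · rintro (rfl | rfl)
    · rw [onSq_right _ hk hb]
      exact onEdge_mem_link hx (T.sq_left h) _
    · rw [onSq_top _ hk ha]
      exact onEdge_mem_link hx (T.sq_left (T.sq_symm h)) _

end SubCell
end TannerSquareComplex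
end CodeReplacement

namespace CodeReplacement
namespace TannerSquareComplex

variable {T : TannerSquareComplex} {k : ℕ}

/-! ### Local connectivity -/

/-- The local connectivity properties of a Tanner square complex that make the local complexes
connected and the complexes over the checks simply connected: every vertex lies on edges in all
possible directions, the links of all checks are connected, and any two qubits shared by two checks
are joined by a chain of squares containing these checks. Connectivity is expressed by
induction principles. -/
structure LocallyConnected (T : TannerSquareComplex) : Prop where
  exists_up : ∀ v, T.deg v < 2 → ∃ w, T.inc v w
  exists_down : ∀ v, 0 < T.deg v → ∃ u, T.inc u v
  link_up : ∀ x, T.deg x = 0 → ∀ S : T.V → Prop,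
    (∀ q q' z, T.inc x q → T.inc x q' → T.inc q z → T.inc q' z → S q → S q') →
    ∀ q q', T.inc x q → T.inc x q' → S q → S q'
  link_down : ∀ z, T.deg z = 2 → ∀ S : T.V → Prop,
    (∀ q q' x, T.inc q z → T.inc q' z → T.inc x q → T.inc x q' → S q → S q') →
    ∀ q q', T.inc q z → T.inc q' z → S q → S q'
  sq_connected : ∀ x z, ∀ S : T.V → Prop, (∀ q q', T.sq x q q' z → S q → S q') →
    ∀ q q', T.inc x q → T.inc q z → T.inc x q' → T.inc q' z → S q → S q'

/-- The conditions are exchanged in pairs by reversing the degree, and the last one is symmetric.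
This makes the `Z`-replacement accessible through the `X`-replacement. -/
theorem LocallyConnected.dual (hT : T.LocallyConnected) : T.dual.LocallyConnected where
  exists_up v hv := hT.exists_down v (by
    have hv : 2 - T.deg v < 2 := hv
    omega)
  exists_down v hv := hT.exists_up v (by
    have hv : 0 < 2 - T.deg v := hv
    omega)
  link_up x hx := hT.link_down x (by
    have hx : 2 - T.deg x = 0 := hx
    have := T.deg_le x
    omega)
  link_down z hz := hT.link_up z (by
    have hz : 2 - T.deg z = 2 := hz
    omega)
  sq_connected x z S hS q q' h1 h2 h3 h4 := hT.sq_connected z x S hS q q' h2 h1 h4 h3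

/-- A finite check. Every check is adjacent to the central qubit `(1, 1)`, and each of its qubits
shares a check of the other type with the center, so all links are connected through it. Two
distinct qubits with two common checks always span a square. -/
theorem surfaceCode_locallyConnected : surfaceCode.LocallyConnected where
  exists_up := by
    have : ∀ v : Fin 3 × Fin 3, SurfaceCode.deg v < 2 → ∃ w, SurfaceCode.Inc v w := by decide
    exact this
  exists_down := by
    have : ∀ v : Fin 3 × Fin 3, 0 < SurfaceCode.deg v → ∃ u, SurfaceCode.Inc u v := by decide
    exact this
  link_up x hx S hS q q' h h' hq := by
    have key : ∀ x q : Fin 3 × Fin 3, SurfaceCode.deg x = 0 → SurfaceCode.Inc x q →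
        SurfaceCode.Inc x (1, 1) ∧ ∃ z, SurfaceCode.Inc q z ∧ SurfaceCode.Inc (1, 1) z := by decide
    obtain ⟨h1, z, h2, h3⟩ := key x q hx h
    obtain ⟨-, z', h4, h5⟩ := key x q' hx h'
    exact hS (1, 1) q' z' h1 h' h5 h4 (hS q (1, 1) z h h1 h2 h3 hq)
  link_down z hz S hS q q' h h' hq := by
    have key : ∀ z q : Fin 3 × Fin 3, SurfaceCode.deg z = 2 → SurfaceCode.Inc q z →
        SurfaceCode.Inc (1, 1) z ∧ ∃ x, SurfaceCode.Inc x q ∧ SurfaceCode.Inc x (1, 1) := by decide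
    obtain ⟨h1, x, h2, h3⟩ := key z q hz h
    obtain ⟨-, x', h4, h5⟩ := key z q' hz h'
    exact hS (1, 1) q' x' h1 h' h5 h4 (hS q (1, 1) x h h1 h2 h3 hq)
  sq_connected x z S hS q q' h1 h2 h3 h4 hq := by
    by_cases h : q = q'
    · exact h ▸ hq
    · exact hS q q' ⟨h, h1, h2, h3, h4⟩ hq

/-! ### Facets and cofacets of cells -/

namespace SubCell

/-- The boundary of an edge consists of two vertices. -/
theorem exists_facets_of_dim_one {s : T.SubCell k} (hs : s.dim = 1) :
    ∃ σ σ', σ ≠ σ' ∧ ∀ ρ, Facet ρ s ↔ ρ = σ ∨ ρ = σ' := by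
  cases s with
  | vert v => simp [dim] at hs
  | edge e a =>
    obtain ⟨a, ha⟩ := a
    refine ⟨onEdge k e a, onEdge k e (a + 2), fun h => ?_, fun ρ => ?_⟩
    · have := onEdge_injective e (by omega) (by omega) h
      omega
    · simp only [dim] at hs
      simp only [Facet, Nat.odd_iff, hs, true_and]
  | face f a b =>
    obtain ⟨a, ha⟩ := a
    obtain ⟨b, hb⟩ := b
    simp only [dim] at hs
    by_cases h : (a + 1) % 2 = 1
    · refine ⟨onFace k f a (b + 1), onFace k f (a + 2) (b + 1), fun h => ?_, fun ρ => ?_⟩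
      · have := onFace_injective f (by omega) (by omega) (by omega) (by omega) h
        omega
      · have hb' : ¬ (b + 1) % 2 = 1 := by omega
        simp only [Facet, Nat.odd_iff, h, true_and, hb', false_and, or_false]
    · refine ⟨onFace k f (a + 1) b, onFace k f (a + 1) (b + 2), fun h => ?_, fun ρ => ?_⟩
      · have := onFace_injective f (by omega) (by omega) (by omega) (by omega) h
        omega
      · have hb' : (b + 1) % 2 = 1 := by omega
        simp only [Facet, Nat.odd_iff, h, true_and, hb', false_and, false_or]

theorem exists_facet {s : T.SubCell k} (hs : s.dim ≠ 0) : ∃ σ, Facet σ s := by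
  cases s with
  | vert v => simp [dim] at hs
  | edge e a =>
    exact ⟨onEdge k e a, by simp only [dim] at hs; rw [Nat.odd_iff]; omega, .inl rfl⟩
  | face f a b =>
    simp only [dim] at hs
    by_cases h : (a.1 + 1) % 2 = 1
    · exact ⟨onFace k f a (b + 1), .inl ⟨by rwa [Nat.odd_iff], .inl rfl⟩⟩
    · exact ⟨onFace k f (a + 1) b, .inr ⟨by rw [Nat.odd_iff]; omega, .inl rfl⟩⟩

/-- Every vertex on a subdivided edge is an endpoint of a segment of this edge. -/
theorem exists_facet_onEdge (e : T.Edge) (hk : k ≠ 0) {i : ℕ} (hi : i ≤ k) :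
    ∃ j < k, Facet (onEdge k e (2 * i)) (onEdge k e (2 * j + 1)) := by
  rcases hi.lt_or_eq with h | rfl
  · exact ⟨i, h, by rw [facet_onEdge_odd _ h]; simp⟩
  · refine ⟨i - 1, by omega, ?_⟩
    rw [facet_onEdge_odd _ (by omega)]
    right
    congr 1
    omega

variable {x q q' z : T.V}

/-- Both parities of `b` are allowed: an even `b` gives the endpoints of a segment, an odd `b` two
opposite sides of a small square. -/
theorem facet_onSq_odd_left (h : T.sq x q q' z) {i b : ℕ} (hi : i < k) (hb : b ≤ 2 * k) :
    Facet (onSq k h (2 * i) b) (onSq k h (2 * i + 1) b) ∧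
      Facet (onSq k h (2 * i + 2) b) (onSq k h (2 * i + 1) b) := by
  rcases Nat.even_or_odd' b with ⟨j, rfl | rfl⟩
  · rw [facet_onSq₁ _ hi (by omega), facet_onSq₁ _ hi (by omega)]
    simp
  · rw [facet_onSq _ hi (by omega), facet_onSq _ hi (by omega)]
    simp

theorem facet_onSq_odd_right (h : T.sq x q q' z) {a j : ℕ} (ha : a ≤ 2 * k) (hj : j < k) :
    Facet (onSq k h a (2 * j)) (onSq k h a (2 * j + 1)) ∧
      Facet (onSq k h a (2 * j + 2)) (onSq k h a (2 * j + 1)) := by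
  simp only [← onSq_symm h]
  exact facet_onSq_odd_left _ hj ha

/-- The cells of `X_x` of dimension at most one lie in the boundary of cells of `X_x`. -/
theorem exists_cofacet_of_mem_star (hx : T.deg x = 0) (hk : k ≠ 0) {s : T.SubCell k}
    (hs : s.carrier ∈ star x) (hd : s.dim < 2) :
    ∃ s' : T.SubCell k, s'.carrier ∈ star x ∧ Facet s s' := by
  obtain ⟨q, q', z, h, a, b, ha, hb, rfl⟩ := exists_onSq hx hk hs
  rw [dim_onSq h ha hb] at hd
  -- A cell with an even coordinate bounds the cell with that coordinate increased by one, or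
  -- decreased by one at the far side `i = k`.
  have key : ∀ {q q' z : T.V} (h : T.sq x q q' z) (i b : ℕ), 2 * i ≤ 2 * k → b ≤ 2 * k →
      ∃ s' : T.SubCell k, s'.carrier ∈ star x ∧ Facet (onSq k h (2 * i) b) s' := by
    intro q q' z h i b hi hb
    by_cases hik : i < k
    · exact ⟨_, onSq_mem_star h hx _ _, (facet_onSq_odd_left h hik hb).1⟩
    · obtain ⟨j, rfl⟩ : ∃ j, i = j + 1 := ⟨i - 1, by omega⟩
      exact ⟨_, onSq_mem_star h hx _ _, (facet_onSq_odd_left h (i := j) (by omega) hb).2⟩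
  rcases Nat.even_or_odd' a with ⟨i, rfl | rfl⟩
  · exact key h i b ha hb
  · obtain ⟨j, rfl | rfl⟩ := Nat.even_or_odd' b
    · rw [← onSq_symm]
      exact key _ j _ hb ha
    · omega

end SubCell

open SubCell

namespace ProdCell

theorem mem_some {v : T.V} {s : T.SubCell k} {b : Bool} :
    ((s, some b) : T.ProdCell k) ∈ localCells k v ↔ s.carrier ∈ star v := by
  simp [localCells]

theorem mem_none {v : T.V} {s : T.SubCell k} :
    ((s, none) : T.ProdCell k) ∈ localCells k v ↔ s.carrier ∈ link v :=
  ⟨fun h => h.2 rfl, fun h => ⟨link_subset_star h, fun _ => h⟩⟩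

theorem dim_some (s : T.SubCell k) (b : Bool) : dim (s, some b) = s.dim := by simp [dim]

theorem dim_none (s : T.SubCell k) : dim (s, none) = s.dim + 1 := by simp [dim]

theorem facet_some {w : T.ProdCell k} {s : T.SubCell k} {b : Bool} :
    Facet w (s, some b) ↔ ∃ σ, SubCell.Facet σ s ∧ w = (σ, some b) := by
  obtain ⟨σ, h⟩ := w
  simp [Facet]

theorem facet_none {w : T.ProdCell k} {s : T.SubCell k} :
    Facet w (s, none) ↔ (∃ σ, SubCell.Facet σ s ∧ w = (σ, none)) ∨ ∃ b, w = (s, some b) := by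
  obtain ⟨σ, h⟩ := w
  cases h <;> simp [Facet]

theorem facet_some_some {σ s : T.SubCell k} (b : Bool) (h : SubCell.Facet σ s) :
    Facet (σ, some b) (s, some b) := .inl ⟨h, rfl⟩

theorem facet_none_none {σ s : T.SubCell k} (h : SubCell.Facet σ s) :
    Facet (σ, none) (s, none) := .inl ⟨h, rfl⟩

theorem facet_some_none (s : T.SubCell k) (b : Bool) : Facet (s, some b) (s, none) :=
  .inr ⟨rfl, by simp, rfl⟩

theorem exists_facet {w : T.ProdCell k} (hw : w.dim ≠ 0) : ∃ u, Facet u w := by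
  obtain ⟨s, _ | b⟩ := w
  · exact ⟨_, facet_some_none s true⟩
  · rw [dim_some] at hw
    obtain ⟨σ, h⟩ := SubCell.exists_facet hw
    exact ⟨_, facet_some_some b h⟩

/-- The boundary of an edge consists of two vertices. -/
theorem exists_facets_of_dim_one {w : T.ProdCell k} (hw : w.dim = 1) :
    ∃ u u', u ≠ u' ∧ ∀ c, Facet c w ↔ c = u ∨ c = u' := by
  obtain ⟨s, _ | b⟩ := w
  · rw [dim_none] at hw
    refine ⟨(s, some false), (s, some true), by simp, fun c => ?_⟩
    rw [facet_none]
    constructor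
    · rintro (⟨σ, h, -⟩ | ⟨_ | _, h⟩)
      · have := h.dim_eq
        omega
      · exact .inl h
      · exact .inr h
    · rintro (h | h) <;> exact .inr ⟨_, h⟩
  · rw [dim_some] at hw
    obtain ⟨σ, σ', hne, h⟩ := SubCell.exists_facets_of_dim_one hw
    refine ⟨(σ, some b), (σ', some b), by simpa using hne, fun c => ?_⟩
    rw [facet_some]
    simp [h]

/-- The complexes `Y_v` are pure of dimension `2 - deg v`. -/
theorem exists_cofacet {v : T.V} (hk : k ≠ 0) {w : T.ProdCell k} (hw : w ∈ localCells k v)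
    (hd : T.deg v + w.dim < 2) : ∃ w' ∈ localCells k v, Facet w w' := by
  obtain ⟨s, _ | b⟩ := w
  · rw [mem_none] at hw
    rw [dim_none] at hd
    -- The open interval contributes one dimension, so only a vertex of the link of an `X`-check is
    -- possible here.
    have hv : T.deg v = 0 := by omega
    obtain ⟨e, h1, i, h2, rfl⟩ := exists_onEdge_of_mem_link_zero hv hk hw (by omega)
    obtain ⟨j, -, hj⟩ := exists_facet_onEdge e hk h2
    exact ⟨_, mem_none.2 (onEdge_mem_link hv h1 _), facet_none_none hj⟩
  · rw [mem_some] at hw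
    rw [dim_some] at hd
    by_cases hv : T.deg v = 0
    · obtain ⟨s', h1, h2⟩ := exists_cofacet_of_mem_star hv hk hw (by omega)
      exact ⟨_, mem_some.2 h1, facet_some_some b h2⟩
    · have hv : T.deg v = 1 := by omega
      obtain ⟨e, h1, i, h2, rfl⟩ := exists_onEdge_zero hv hk hw (by omega)
      obtain ⟨j, -, hj⟩ := exists_facet_onEdge e hk h2
      exact ⟨_, mem_some.2 (onEdge_mem_star hv h1 _), facet_some_some b hj⟩

/-- The boundary of a two-dimensional cell of the subdivision is connected. -/
theorem facets_connected_face {s : T.SubCell k} (hs : s.dim = 2) (S : T.SubCell k → Prop)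
    (hS : ∀ e e' u, SubCell.Facet e s → SubCell.Facet e' s → SubCell.Facet u e →
      SubCell.Facet u e' → S e → S e') {e e' : T.SubCell k} (he : SubCell.Facet e s)
    (he' : SubCell.Facet e' s) (h : S e) : S e' := by
  cases s with
  | vert v => simp [SubCell.dim] at hs
  | edge e a => simp only [SubCell.dim] at hs; omega
  | face f a b =>
    obtain ⟨i, hi⟩ := a
    obtain ⟨j, hj⟩ := b
    simp only [SubCell.dim] at hs
    obtain ⟨i, rfl⟩ : ∃ i', i = 2 * i' := ⟨i / 2, by omega⟩
    obtain ⟨j, rfl⟩ : ∃ j', j = 2 * j' := ⟨j / 2, by omega⟩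
    have hface : face f ⟨2 * i, hi⟩ ⟨2 * j, hj⟩ = onFace k f (2 * i + 1) (2 * j + 1) := by
      rw [onFace_inner f (by omega) (by omega) (by omega) (by omega)]
      rfl
    rw [hface] at hS he he'
    rw [← onSq_face] at he he' hS
    simp only [facet_onSq f.sq (show i < k by omega) (show j < k by omega)] at he he' hS
    -- Sides of the small square in different directions meet at the corner `(s, t)`. Three of the
    -- four corners already connect all four sides.
    have side : ∀ s t, (s = 2 * i ∨ s = 2 * i + 2) → (t = 2 * j ∨ t = 2 * j + 2) →
        (S (onSq k f.sq s (2 * j + 1)) ↔ S (onSq k f.sq (2 * i + 1) t)) := by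
      intro s t h1 h2
      have f1 : SubCell.Facet (onSq k f.sq s t) (onSq k f.sq s (2 * j + 1)) := by
        rcases h2 with rfl | rfl
        · exact (facet_onSq_odd_right f.sq (by omega) (by omega)).1
        · exact (facet_onSq_odd_right f.sq (by omega) (by omega)).2
      have f2 : SubCell.Facet (onSq k f.sq s t) (onSq k f.sq (2 * i + 1) t) := by
        rcases h1 with rfl | rfl
        · exact (facet_onSq_odd_left f.sq (by omega) (by omega)).1
        · exact (facet_onSq_odd_left f.sq (by omega) (by omega)).2
      have g1 : (onSq k f.sq s (2 * j + 1) = onSq k f.sq (2 * i) (2 * j + 1) ∨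
          onSq k f.sq s (2 * j + 1) = onSq k f.sq (2 * i + 2) (2 * j + 1)) := by
        rcases h1 with rfl | rfl <;> simp
      have g2 : (onSq k f.sq (2 * i + 1) t = onSq k f.sq (2 * i + 1) (2 * j) ∨
          onSq k f.sq (2 * i + 1) t = onSq k f.sq (2 * i + 1) (2 * j + 2)) := by
        rcases h2 with rfl | rfl <;> simp
      exact ⟨hS _ _ _ (.inl g1) (.inr g2) f1 f2, hS _ _ _ (.inr g2) (.inl g1) f2 f1⟩
    have a1 := side (2 * i) (2 * j) (.inl rfl) (.inl rfl)
    have a2 := side (2 * i) (2 * j + 2) (.inl rfl) (.inr rfl)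
    have a3 := side (2 * i + 2) (2 * j) (.inr rfl) (.inl rfl)
    rcases he with (rfl | rfl) | (rfl | rfl) <;> rcases he' with (rfl | rfl) | (rfl | rfl) <;> tauto

/-- The boundary of a two-dimensional cell is connected. -/
theorem facets_connected {w : T.ProdCell k} (hw : w.dim = 2) (S : T.ProdCell k → Prop)
    (hS : ∀ e e' u, Facet e w → Facet e' w → Facet u e → Facet u e' → S e → S e')
    {e e' : T.ProdCell k} (he : Facet e w) (he' : Facet e' w) (h : S e) : S e' := by
  obtain ⟨s, _ | b⟩ := w
  · rw [dim_none] at hw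
    -- The face is a segment times the interval: each vertical side meets each horizontal one, at
    -- `(σ, some b)`.
    have key : ∀ σ b, SubCell.Facet σ s → (S (σ, none) ↔ S (s, some b)) := fun σ b hσ =>
      ⟨hS _ _ (σ, some b) (facet_none_none hσ) (facet_some_none _ _) (facet_some_none _ _)
        (facet_some_some _ hσ), hS _ _ (σ, some b) (facet_some_none _ _) (facet_none_none hσ)
        (facet_some_some _ hσ) (facet_some_none _ _)⟩
    obtain ⟨σ₀, h₀⟩ := SubCell.exists_facet (s := s) (by omega)
    have all : ∀ e, Facet e (s, none) → (S e ↔ S (σ₀, none)) := by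
      intro e he
      rcases facet_none.1 he with ⟨σ, h, rfl⟩ | ⟨b, rfl⟩
      · rw [key σ true h, key σ₀ true h₀]
      · rw [key σ₀ b h₀]
    rwa [all e' he', ← all e he]
  · rw [dim_some] at hw
    obtain ⟨σ, h1, rfl⟩ := facet_some.1 he
    obtain ⟨σ', h2, rfl⟩ := facet_some.1 he'
    exact facets_connected_face hw (fun σ => S (σ, some b)) (fun e e' u h1 h2 h3 h4 =>
      hS _ _ _ (facet_some_some b h1) (facet_some_some b h2) (facet_some_some b h3)
      (facet_some_some b h4)) h1 h2 h

end ProdCell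
end TannerSquareComplex
end CodeReplacement

namespace CodeReplacement
namespace TannerSquareComplex

variable {T : TannerSquareComplex} {k : ℕ}

open SubCell

/-! ### Connectedness of the vertex links in `Y_x` -/

namespace ProdCell

/-- The edges of `Y_x` at a vertex over `∂X_x` are connected through the faces of `Y_x`. -/
theorem cofacets_connected_of_mem_link {x : T.V} (hx : T.deg x = 0) (hk : k ≠ 0)
    {s : T.SubCell k} (hd : s.dim = 0) (hs : s.carrier ∈ link x) (b : Bool)
    (S : T.ProdCell k → Prop)
    (hS : ∀ e e' w, w ∈ localCells k x → Facet (s, some b) e → Facet (s, some b) e' →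
      Facet e w → Facet e' w → (S e ↔ S e'))
    {e : T.ProdCell k} (he : e ∈ localCells k x) (hse : Facet (s, some b) e) :
    S e ↔ S (s, none) := by
  obtain ⟨t, _ | c⟩ := e
  · rcases facet_none.1 hse with ⟨σ, -, h⟩ | ⟨_, h⟩
    · simp at h
    · simp only [Prod.mk.injEq] at h
      rw [h.1]
  obtain ⟨σ, hst, h⟩ := facet_some.1 hse
  simp only [Prod.mk.injEq, Option.some.injEq] at h
  obtain ⟨rfl, rfl⟩ := h
  rw [mem_some] at he
  -- For a segment `t` inside `∂X_x`, the face `t × [0, 1]` contains both `t` and the vertical edge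
  -- at `s`.
  have inLink : ∀ t : T.SubCell k, t.carrier ∈ link x → SubCell.Facet s t →
      (S (t, some b) ↔ S (s, none)) := fun t ht hst =>
    hS _ _ (t, none) (mem_none.2 ht) (facet_some_some b hst) (facet_some_none _ _)
      (facet_some_none _ _) (facet_none_none hst)
  by_cases ht : t.carrier ∈ link x
  · exact inLink t ht hst
  obtain ⟨q, q', z, h, i, j, hi, hj, rfl⟩ := exists_onSq_one hx hk he (by rw [hst.dim_eq, hd])
  have hjk : j < k := by
    rw [onSq_mem_link_iff hx hk h (by omega) (by omega)] at ht
    omega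
  -- A segment outside the link can touch it only with its far endpoint, on the side at position `2
  -- * k`.
  have hik : s = onSq k h (2 * k) (2 * j) ∧ 2 * i + 2 = 2 * k := by
    rcases (facet_onSq₁ h hi hj).1 hst with rfl | rfl <;>
      rw [onSq_mem_link_iff hx hk h (by omega) (by omega)] at hs
    · omega
    · have : 2 * i + 2 = 2 * k := by omega
      exact ⟨by rw [this], this⟩
  obtain ⟨rfl, hik⟩ := hik
  -- The small square next to the segment joins it to the segment `(2 * k, 2 * j + 1)` at `s`, which
  -- lies in the link and is covered by `inLink`.
  have f1 := (facet_onSq_odd_right (k := k) h (a := 2 * k) le_rfl hjk).1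
  have f2 := (facet_onSq_odd_left (k := k) h hi (b := 2 * j + 1) (by omega)).2
  have f3 := (facet_onSq_odd_right (k := k) h (a := 2 * i + 1) (by omega) hjk).1
  rw [hik] at f2
  rw [← inLink _ ((onSq_mem_link_iff hx hk h (by omega) (by omega)).2 (.inl rfl)) f1]
  exact hS _ _ (onSq k h (2 * i + 1) (2 * j + 1), some b) (mem_some.2 (onSq_mem_star h hx _ _)) hse
    (facet_some_some b f1) (facet_some_some b f3) (facet_some_some b f2)

/-- The edges of `X_x` at a vertex outside `∂X_x` are connected through the faces of `X_x`. -/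
theorem cofacets_connected_of_not_mem_link (hT : T.LocallyConnected) {x : T.V} (hx : T.deg x = 0)
    (hk : k ≠ 0) {s : T.SubCell k} (hd : s.dim = 0) (hs : s.carrier ∉ link x)
    (S : T.SubCell k → Prop)
    (hS : ∀ e e' w, w.carrier ∈ star x → SubCell.Facet s e → SubCell.Facet s e' →
      SubCell.Facet e w → SubCell.Facet e' w → (S e ↔ S e'))
    {e e' : T.SubCell k} (he : e.carrier ∈ star x) (he' : e'.carrier ∈ star x)
    (hse : SubCell.Facet s e) (hse' : SubCell.Facet s e') : S e ↔ S e' := by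
  -- The two segments leaving `s` in increasing directions bound the same small square.
  have corner : ∀ {q q' z : T.V} (h : T.sq x q q' z) (i j : ℕ), i < k → j < k →
      s = onSq k h (2 * i) (2 * j) →
      (S (onSq k h (2 * i + 1) (2 * j)) ↔ S (onSq k h (2 * i) (2 * j + 1))) := by
    rintro q q' z h i j hi hj rfl
    exact hS _ _ (onSq k h (2 * i + 1) (2 * j + 1)) (onSq_mem_star h hx _ _)
      (facet_onSq_odd_left h hi (by omega)).1 (facet_onSq_odd_right h (by omega) hj).1
      (facet_onSq_odd_right h (by omega) hj).1 (facet_onSq_odd_left h hi (by omega)).1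
  -- Every segment at `s` can be exchanged for the two outgoing ones of some square: a segment
  -- arriving at `s` borders a small square that also contains the outgoing segment in the other
  -- direction. The outgoing segments exist because `s` is not in the link, which forces `i, j < k`.
  have chart : ∀ e : T.SubCell k, e.carrier ∈ star x → SubCell.Facet s e →
      ∃ (q q' z : T.V) (h : T.sq x q q' z) (i j : ℕ), i < k ∧ j < k ∧
        s = onSq k h (2 * i) (2 * j) ∧ (S e ↔ S (onSq k h (2 * i + 1) (2 * j))) ∧
        (S e ↔ S (onSq k h (2 * i) (2 * j + 1))) := by
    intro e he hse
    obtain ⟨q, q', z, h, i, j, hi, hj, rfl⟩ := exists_onSq_one hx hk he (by rw [hse.dim_eq, hd])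
    rcases (facet_onSq₁ h hi hj).1 hse with rfl | rfl <;>
      rw [onSq_mem_link_iff hx hk h (by omega) (by omega)] at hs
    · have hj' : j < k := by omega
      exact ⟨q, q', z, h, i, j, hi, hj', rfl, Iff.rfl, corner h i j hi hj' rfl⟩
    · have hj' : j < k := by omega
      have hi' : i + 1 < k := by omega
      have h1 := corner h (i + 1) j hi' hj' rfl
      have h2 : S (onSq k h (2 * i + 1) (2 * j)) ↔ S (onSq k h (2 * (i + 1)) (2 * j + 1)) :=
        hS _ _ (onSq k h (2 * i + 1) (2 * j + 1)) (onSq_mem_star h hx _ _)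
          (facet_onSq_odd_left h hi (by omega)).2
          (facet_onSq_odd_right h (a := 2 * i + 2) (by omega) hj').1
          (facet_onSq_odd_right h (by omega) hj').1 (facet_onSq_odd_left h hi (by omega)).2
      exact ⟨q, q', z, h, i + 1, j, hi', hj', rfl, h2.trans h1.symm, h2⟩
  obtain ⟨q₁, q₁', z₁, h₁, i₁, j₁, hi₁, hj₁, e₁, a₁, b₁⟩ := chart e he hse
  obtain ⟨q₂, q₂', z₂, h₂, i₂, j₂, hi₂, hj₂, e₂, a₂, b₂⟩ := chart e' he' hse'
  -- the vertex is `x`, inside an edge at `x`, or inside a square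
  cases s with
  | vert v =>
    -- Of the four corners of the square, only the one at `x` has both coordinates below `2 * k`.
    have zero : ∀ {q q' z : T.V} (h : T.sq x q q' z) (i j : ℕ), i < k → j < k →
        vert v = onSq k h (2 * i) (2 * j) → i = 0 ∧ j = 0 := by
      intro q q' z h i j hi hj hv
      by_cases hj0 : j = 0
      · subst hj0
        rw [Nat.mul_zero, onSq_bot h (by omega)] at hv
        by_contra hi0
        rw [onEdge_inner _ (by omega) (by omega)] at hv
        simp at hv
      · by_cases hi0 : i = 0
        · subst hi0
          rw [Nat.mul_zero, onSq_left h (by omega), onEdge_inner _ (by omega) (by omega)] at hv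
          simp at hv
        · rcases exists_face_of_sq (k := k) h with ⟨f, -, hf⟩ | ⟨f, -, hf⟩ <;>
            rw [hf, onFace_inner f (by omega) (by omega) (by omega) (by omega)] at hv <;>
            simp at hv
    obtain ⟨rfl, rfl⟩ := zero h₁ _ _ hi₁ hj₁ e₁
    obtain ⟨rfl, rfl⟩ := zero h₂ _ _ hi₂ hj₂ e₂
    rw [a₁, a₂]
    simp only [Nat.mul_zero, Nat.zero_add] at *
    obtain rfl : v = x := by
      rw [onSq_bot h₁ (by omega), onEdge_zero] at e₁
      simpa using e₁
    rw [onSq_bot h₁ (by omega), onSq_bot h₂ (by omega)]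
    have edge_eq : ∀ {q q' z : T.V} (h : T.sq v q q' z),
        (S (onEdge k ⟨v, q, T.sq_left h⟩ 1) ↔ S (onEdge k ⟨v, q', T.sq_left (T.sq_symm h)⟩ 1)) := by
      intro q q' z h
      rw [← onSq_bot h (by omega), ← onSq_left h (by omega)]
      refine corner h 0 0 (by omega) (by omega) ?_
      rw [Nat.mul_zero, onSq_bot h (by omega), onEdge_zero]
    -- Segments at the vertex `v = x` correspond to the qubits adjacent to it. A square identifies
    -- its two qubits by `edge_eq`, chains of squares reach all qubits with a common `z`, and
    -- connectedness of the link does the rest.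
    refine hT.link_up v hx (fun q => ∀ hq : T.inc v q, S (onEdge k ⟨v, q₁, T.sq_left h₁⟩ 1) ↔
      S (onEdge k ⟨v, q, hq⟩ 1)) ?_ q₁ q₂ (T.sq_left h₁) (T.sq_left h₂) (fun _ => Iff.rfl) _
    intro q q' z g1 g2 g3 g4 hq hq'
    refine hT.sq_connected v z (fun q => ∀ hq : T.inc v q, S (onEdge k ⟨v, q₁, T.sq_left h₁⟩ 1) ↔
      S (onEdge k ⟨v, q, hq⟩ 1)) ?_ q q' g1 g3 g2 g4 hq hq'
    intro a a' haa ha ha'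
    exact (ha (T.sq_left haa)).trans (edge_eq haa)
  | edge d a =>
    -- The cell `edge d a` has position `a + 1`, so `onEdge k d (a + 2)` is the next segment along
    -- `d`. It does not depend on the square, and serves as common reference for all squares through
    -- `d`.
    have one : ∀ {q q' z : T.V} (h : T.sq x q q' z) (i j : ℕ) (e : T.SubCell k), i < k → j < k →
        edge d a = onSq k h (2 * i) (2 * j) → (S e ↔ S (onSq k h (2 * i + 1) (2 * j))) →
        (S e ↔ S (onSq k h (2 * i) (2 * j + 1))) → (S e ↔ S (onEdge k d (a + 2))) := by
      have wlog : ∀ {q q' z : T.V} (h : T.sq x q q' z) (i : ℕ) (e : T.SubCell k), i < k →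
        edge d a = onSq k h (2 * i) 0 → (S e ↔ S (onSq k h (2 * i + 1) 0)) →
        (S e ↔ S (onEdge k d (a + 2))) := by
        intro q q' z h i e hi hv he
        rw [onSq_bot h (by omega)] at hv he
        by_cases hi0 : i = 0
        · rw [hi0, Nat.mul_zero, onEdge_zero] at hv
          simp at hv
        · rw [onEdge_inner _ (by omega) (by omega)] at hv
          obtain ⟨rfl, ha⟩ := SubCell.edge.inj hv
          rw [he, ha]
          simp only
          rw [show 2 * i - 1 + 2 = 2 * i + 1 by omega]
      intro q q' z h i j e hi hj hv h1 h2
      by_cases hj0 : j = 0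
      · subst hj0
        exact wlog h i e hi hv h1
      · by_cases hi0 : i = 0
        · subst hi0
          refine wlog (T.sq_symm h) j e hj ?_ ?_
          · rw [onSq_symm]
            exact hv
          · rw [onSq_symm]
            exact h2
        · rcases exists_face_of_sq (k := k) h with ⟨f, -, hf⟩ | ⟨f, -, hf⟩ <;>
            rw [hf, onFace_inner f (by omega) (by omega) (by omega) (by omega)] at hv <;>
            simp at hv
    rw [one h₁ i₁ j₁ e hi₁ hj₁ e₁ a₁ b₁, one h₂ i₂ j₂ e' hi₂ hj₂ e₂ a₂ b₂]
  | face f a b =>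
    -- Inside a square the only ambiguity is the order of the two qubits. The reference is the
    -- segment following position `(a + 1, b + 1)` in the first direction of the listed face.
    have two : ∀ {q q' z : T.V} (h : T.sq x q q' z) (i j : ℕ) (e : T.SubCell k), i < k → j < k →
        face f a b = onSq k h (2 * i) (2 * j) → (S e ↔ S (onSq k h (2 * i + 1) (2 * j))) →
        (S e ↔ S (onSq k h (2 * i) (2 * j + 1))) → (S e ↔ S (onFace k f (a + 2) (b + 1))) := by
      intro q q' z h i j e hi hj hv h1 h2
      by_cases hj0 : j = 0
      · subst hj0
        rw [Nat.mul_zero, onSq_bot h (by omega)] at hv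
        unfold onEdge at hv
        split_ifs at hv
      by_cases hi0 : i = 0
      · subst hi0
        rw [Nat.mul_zero, onSq_left h (by omega)] at hv
        unfold onEdge at hv
        split_ifs at hv
      rcases exists_face_of_sq (k := k) h with ⟨g, -, hg⟩ | ⟨g, -, hg⟩
      · rw [hg, onFace_inner g (by omega) (by omega) (by omega) (by omega)] at hv
        obtain ⟨rfl, ha, hb⟩ := SubCell.face.inj hv
        rw [h1, hg, ha, hb]
        simp only
        rw [show 2 * i - 1 + 2 = 2 * i + 1 by omega, show 2 * j - 1 + 1 = 2 * j by omega]
      · rw [hg, onFace_inner g (by omega) (by omega) (by omega) (by omega)] at hv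
        obtain ⟨rfl, ha, hb⟩ := SubCell.face.inj hv
        rw [h2, hg, ha, hb]
        simp only
        rw [show 2 * j - 1 + 2 = 2 * j + 1 by omega, show 2 * i - 1 + 1 = 2 * i by omega]
    rw [two h₁ i₁ j₁ e hi₁ hj₁ e₁ a₁ b₁, two h₂ i₂ j₂ e' hi₂ hj₂ e₂ a₂ b₂]

/-- The edges of `Y_x` at a vertex are connected through the faces of `Y_x`. -/
theorem cofacets_connected (hT : T.LocallyConnected) {x : T.V} (hx : T.deg x = 0) (hk : k ≠ 0)
    {u : T.ProdCell k} (hd : u.dim = 0) (S : T.ProdCell k → Prop)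
    (hS : ∀ e e' w, w ∈ localCells k x → Facet u e → Facet u e' → Facet e w → Facet e' w →
      S e → S e')
    {e e' : T.ProdCell k} (he : e ∈ localCells k x) (he' : e' ∈ localCells k x)
    (hue : Facet u e) (hue' : Facet u e') (h : S e) : S e' := by
  have hS' : ∀ e e' w, w ∈ localCells k x → Facet u e → Facet u e' → Facet e w → Facet e' w →
      (S e ↔ S e') := fun e e' w h1 h2 h3 h4 h5 =>
    ⟨hS e e' w h1 h2 h3 h4 h5, hS e' e w h1 h3 h2 h5 h4⟩
  obtain ⟨s, _ | b⟩ := u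
  · rw [dim_none] at hd
    omega
  rw [dim_some] at hd
  by_cases hs : s.carrier ∈ link x
  · rwa [cofacets_connected_of_mem_link hx hk hd hs b S hS' he' hue',
      ← cofacets_connected_of_mem_link hx hk hd hs b S hS' he hue]
  -- Away from the link there is no vertical edge, so the problem stays in one copy of `X_x`.
  · have form : ∀ e ∈ localCells k x, Facet (s, some b) e →
        ∃ t : T.SubCell k, t.carrier ∈ star x ∧ SubCell.Facet s t ∧ e = (t, some b) := by
      rintro ⟨t, _ | c⟩ he hue
      · rcases facet_none.1 hue with ⟨σ, -, h⟩ | ⟨_, h⟩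
        · simp at h
        · simp only [Prod.mk.injEq] at h
          exact (hs (h.1 ▸ mem_none.1 he)).elim
      · obtain ⟨σ, hst, h⟩ := facet_some.1 hue
        simp only [Prod.mk.injEq, Option.some.injEq] at h
        obtain ⟨rfl, rfl⟩ := h
        exact ⟨t, mem_some.1 he, hst, rfl⟩
    obtain ⟨t, h1, h2, rfl⟩ := form e he hue
    obtain ⟨t', h3, h4, rfl⟩ := form e' he' hue'
    refine (cofacets_connected_of_not_mem_link hT hx hk hd hs (fun t => S (t, some b)) ?_ h1 h3 h2
      h4).1 h
    exact fun e e' w g1 g2 g3 g4 g5 => hS' _ _ (w, some b) (mem_some.2 g1) (facet_some_some b g2)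
      (facet_some_some b g3) (facet_some_some b g4) (facet_some_some b g5)

end ProdCell

/-! ### Preservation of local connectivity -/

open ProdCell

/-- The `X`-replacement preserves local connectivity. -/
theorem LocallyConnected.replaceX (hT : T.LocallyConnected) (hk : k ≠ 0) :
    (replaceXTotal T k).LocallyConnected where
  exists_up := by
    rintro ⟨⟨v, w⟩, hw⟩ hv
    obtain ⟨w', h1, h2⟩ := exists_cofacet hk hw hv
    exact ⟨⟨(v, w'), h1⟩, .inl ⟨rfl, h2⟩⟩
  exists_down := by
    rintro ⟨⟨v, w⟩, hw⟩ hv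
    by_cases hd : w.dim = 0
    · have hv : 0 < T.deg v := by
        change 0 < T.deg v + w.dim at hv
        omega
      obtain ⟨u, hu⟩ := hT.exists_down v hv
      exact ⟨⟨(u, w), local_mono hu hw⟩, .inr ⟨hu, rfl⟩⟩
    · obtain ⟨u, hu⟩ := ProdCell.exists_facet hd
      exact ⟨⟨(v, u), local_closed hu hw⟩, .inl ⟨rfl, hu⟩⟩
  link_up := by
    rintro ⟨⟨x, u⟩, hu⟩ hx S hS p p' hp hp' hSp
    change T.deg x + u.dim = 0 at hx
    have hx0 : T.deg x = 0 := by omega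
    have hu0 : u.dim = 0 := by omega
    -- A neighbour `(v, u)` over a qubit `v` can be exchanged for an edge of `Y_x`: by purity `u`
    -- lies on an edge `e` of `Y_v`, and `(v, e)` is adjacent to both `(v, u)` and `(x, e)`.
    have hxe : ∀ p : ReplaceX.Vertex T k, ReplaceX.Inc ⟨(x, u), hu⟩ p →
        ∃ e, ∃ he : e ∈ localCells k x, ProdCell.Facet u e ∧ (S p ↔ S ⟨(x, e), he⟩) := by
      rintro ⟨⟨v, e⟩, he⟩ (⟨h1, h2⟩ | ⟨h1, h2⟩)
      · simp only at h1 h2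
        subst h1
        exact ⟨e, he, h2, Iff.rfl⟩
      · simp only at h1 h2
        subst h2
        have := T.inc_deg h1
        obtain ⟨e, he', hue⟩ := exists_cofacet (v := v) (w := u) hk he (by omega)
        have hex := local_mono h1 he'
        have i1 : ReplaceX.Inc ⟨(x, u), hu⟩ ⟨(x, e), hex⟩ := .inl ⟨rfl, hue⟩
        have i2 : ReplaceX.Inc ⟨(x, u), hu⟩ ⟨(v, u), he⟩ := .inr ⟨h1, rfl⟩
        have i3 : ReplaceX.Inc ⟨(v, u), he⟩ ⟨(v, e), he'⟩ := .inl ⟨rfl, hue⟩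
        have i4 : ReplaceX.Inc ⟨(x, e), hex⟩ ⟨(v, e), he'⟩ := .inr ⟨h1, rfl⟩
        exact ⟨e, hex, hue, hS _ _ _ i2 i1 i3 i4, hS _ _ _ i1 i2 i4 i3⟩
    obtain ⟨e, he, hue, h1⟩ := hxe p hp
    obtain ⟨e', he', hue', h2⟩ := hxe p' hp'
    rw [h2]
    rw [h1] at hSp
    -- The quantifier over membership proofs turns `S` into a predicate on all cells. The same
    -- device is used in the other cases.
    refine cofacets_connected hT hx0 hk hu0 (fun e => ∀ he : e ∈ localCells k x, S ⟨(x, e), he⟩) ?_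
      he he' hue hue' (fun _ => hSp) he'
    intro e e' w hw g1 g2 g3 g4 hSe he'
    exact hS ⟨(x, e), local_closed g3 hw⟩ ⟨(x, e'), he'⟩ ⟨(x, w), hw⟩ (.inl ⟨rfl, g1⟩)
      (.inl ⟨rfl, g2⟩) (.inl ⟨rfl, g3⟩) (.inl ⟨rfl, g4⟩) (hSe _)
  link_down := by
    rintro ⟨⟨v, w⟩, hw⟩ hv S hS p p' hp hp' hSp
    change T.deg v + w.dim = 2 at hv
    have hv2 := T.deg_le v
    -- The cell `w` is a face, an edge or a vertex according to the degree of `v`. Over an `X`-check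
    -- the claim is connectedness of the boundary of a face.
    by_cases hv0 : T.deg v = 0
    · have form : ∀ p : ReplaceX.Vertex T k, ReplaceX.Inc p ⟨(v, w), hw⟩ →
          ∃ e, ∃ he : e ∈ localCells k v, ProdCell.Facet e w ∧ p = ⟨(v, e), he⟩ := by
        rintro ⟨⟨v', e⟩, he⟩ (⟨h1, h2⟩ | ⟨h1, h2⟩)
        · simp only at h1 h2
          subst h1
          exact ⟨e, he, h2, rfl⟩
        · have := T.inc_deg h1
          simp only at this
          omega
      obtain ⟨e, he, hew, rfl⟩ := form p hp
      obtain ⟨e', he', hew', rfl⟩ := form p' hp'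
      refine facets_connected (w := w) (by omega)
        (fun e => ∀ he : e ∈ localCells k v, S ⟨(v, e), he⟩) ?_ hew hew' (fun _ => hSp) he'
      intro e e' u g1 g2 g3 g4 hSe he'
      have he := local_closed g1 hw
      exact hS ⟨(v, e), he⟩ ⟨(v, e'), he'⟩ ⟨(v, u), local_closed g3 he⟩ (.inl ⟨rfl, g1⟩)
        (.inl ⟨rfl, g2⟩) (.inl ⟨rfl, g3⟩) (.inl ⟨rfl, g4⟩) (hSe _)
    by_cases hv1 : T.deg v = 1
    · obtain ⟨x₀, hx₀⟩ := hT.exists_down v (by omega)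
      obtain ⟨u₀, hu₀⟩ := ProdCell.exists_facet (w := w) (by omega)
      -- Over a qubit, every `(v, u)` with `u` an endpoint of `w` and every `(x, w)` with `x`
      -- adjacent to `v` share the check `(x, u)`, so the two kinds of neighbours are completely
      -- joined.
      have key : ∀ (x : T.V) (hx : T.inc x v) (u : T.ProdCell k) (hu : ProdCell.Facet u w),
          (S ⟨(v, u), local_closed hu hw⟩ ↔ S ⟨(x, w), local_mono hx hw⟩) := by
        intro x hx u hu
        have hvu := local_closed hu hw
        have i1 : ReplaceX.Inc ⟨(x, u), local_mono hx hvu⟩ ⟨(v, u), hvu⟩ := .inr ⟨hx, rfl⟩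
        have i2 : ReplaceX.Inc ⟨(x, u), local_mono hx hvu⟩ ⟨(x, w), local_mono hx hw⟩ :=
          .inl ⟨rfl, hu⟩
        have i3 : ReplaceX.Inc ⟨(v, u), hvu⟩ ⟨(v, w), hw⟩ := .inl ⟨rfl, hu⟩
        have i4 : ReplaceX.Inc ⟨(x, w), local_mono hx hw⟩ ⟨(v, w), hw⟩ := .inr ⟨hx, rfl⟩
        exact ⟨hS _ _ _ i3 i4 i1 i2, hS _ _ _ i4 i3 i2 i1⟩
      have all : ∀ p : ReplaceX.Vertex T k, ReplaceX.Inc p ⟨(v, w), hw⟩ →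
          (S p ↔ S ⟨(x₀, w), local_mono hx₀ hw⟩) := by
        rintro ⟨⟨v', u⟩, hu⟩ (⟨h1, h2⟩ | ⟨h1, h2⟩)
        · simp only at h1 h2
          subst h1
          exact key x₀ hx₀ u h2
        · simp only at h1 h2
          subst h2
          rw [← key v' h1 u₀ hu₀, key x₀ hx₀ u₀ hu₀]
      rwa [all p' hp', ← all p hp]
    · have hv2 : T.deg v = 2 := by omega
      have form : ∀ p : ReplaceX.Vertex T k, ReplaceX.Inc p ⟨(v, w), hw⟩ →
          ∃ q, ∃ hq : T.inc q v, p = ⟨(q, w), local_mono hq hw⟩ := by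
        rintro ⟨⟨v', u⟩, hu⟩ (⟨h1, h2⟩ | ⟨h1, h2⟩)
        · have := h2.dim_eq
          simp only at this
          omega
        · simp only at h1 h2
          subst h2
          exact ⟨v', h1, rfl⟩
      obtain ⟨q, hq, rfl⟩ := form p hp
      obtain ⟨q', hq', rfl⟩ := form p' hp'
      -- Over a `Z`-check the cell `w` stays fixed, and the connectedness is that of the link of `v`
      -- in `T`.
      refine hT.link_down v hv2 (fun q => ∀ hq : T.inc q v, S ⟨(q, w), local_mono hq hw⟩) ?_
        q q' hq hq' (fun _ => hSp) hq'
      intro q q' x g1 g2 g3 g4 hSq hq'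
      exact hS ⟨(q, w), local_mono g1 hw⟩ ⟨(q', w), local_mono g2 hw⟩
        ⟨(x, w), local_mono g3 (local_mono g1 hw)⟩ (.inr ⟨g1, rfl⟩) (.inr ⟨g2, rfl⟩)
        (.inr ⟨g3, rfl⟩) (.inr ⟨g4, rfl⟩) (hSq g1)
  sq_connected := by
    intro p p' S hS p₁ p₂ h1 h2 h3 h4 hSp
    -- Only for checks over an `X`-check and a `Z`-check of `T` are the squares restricted. There
    -- all cells coincide and the claim is that of `T`. Otherwise two distinct common neighbours
    -- always span a square.
    by_cases hd : T.deg p'.1.1 = T.deg p.1.1 + 2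
    · have form : ∀ p₁ : ReplaceX.Vertex T k, ReplaceX.Inc p p₁ → ReplaceX.Inc p₁ p' →
          (T.inc p.1.1 p₁.1.1 ∧ T.inc p₁.1.1 p'.1.1) ∧ p.1.2 = p₁.1.2 ∧ p₁.1.2 = p'.1.2 := by
        rintro p₁ (⟨g1, g2⟩ | ⟨g1, g2⟩) (⟨g3, g4⟩ | ⟨g3, g4⟩)
        · rw [g1, g3] at hd
          omega
        · have := T.inc_deg g3
          rw [g1] at hd
          omega
        · have := T.inc_deg g1
          rw [← g3] at hd
          omega
        · exact ⟨⟨g1, g3⟩, g2, g4⟩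
      obtain ⟨⟨a1, a2⟩, a3, a4⟩ := form p₁ h1 h2
      obtain ⟨⟨b1, b2⟩, b3, b4⟩ := form p₂ h3 h4
      have hw : p.1.2 = p'.1.2 := a3.trans a4
      have main := hT.sq_connected p.1.1 p'.1.1
        (fun q => ∀ hq : T.inc q p'.1.1, S ⟨(q, p'.1.2), local_mono hq p'.2⟩) ?_
        p₁.1.1 p₂.1.1 a1 a2 b1 b2 ?_ b2
      · have he : p₂ = ⟨(p₂.1.1, p'.1.2), local_mono b2 p'.2⟩ := Subtype.ext (Prod.ext rfl b4)
        exact (congrArg S he).mpr main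
      · intro q q' hqq hSq hq'
        exact hS ⟨(q, p'.1.2), local_mono (T.sq_right hqq) p'.2⟩
          ⟨(q', p'.1.2), local_mono hq' p'.2⟩
          ⟨fun h => T.sq_ne hqq (congrArg (fun p : ReplaceX.Vertex T k => p.1.1) h),
          .inr ⟨T.sq_left hqq, hw⟩, .inr ⟨T.sq_right hqq, rfl⟩,
          .inr ⟨T.sq_left (T.sq_symm hqq), hw⟩, .inr ⟨hq', rfl⟩, fun _ => hqq⟩
          (hSq (T.sq_right hqq))
      · intro hq
        have he : p₁ = ⟨(p₁.1.1, p'.1.2), local_mono hq p'.2⟩ := Subtype.ext (Prod.ext rfl a4)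
        exact (congrArg S he).mp hSp
    · by_cases he : p₁ = p₂
      · exact he ▸ hSp
      · exact hS p₁ p₂ ⟨he, h1, h2, h3, h4, fun h => (hd h).elim⟩ hSp

end TannerSquareComplex

open TannerSquareComplex

/-- A `Z`-step is an `X`-step conjugated by duality, and both operations preserve the property. -/
theorem level_locallyConnected {ℓ : ℕ} (hℓ : (ℓ - 1) / 2 ≠ 0) (i : ℕ) :
    (level ℓ i).LocallyConnected := by
  induction i with
  | zero => exact surfaceCode_locallyConnected
  | succ i ih =>
    unfold level
    split_ifs with h
    · exact ih.replaceX hℓ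
    · exact (ih.dual.replaceX hℓ).dual

end CodeReplacement

namespace CodeReplacement
namespace TannerSquareComplex

variable {T : TannerSquareComplex} {k : ℕ}

open SubCell

/-! ### Connectedness of the local complexes -/

theorem eq_zero_position {M : Type*} {G : ℕ → M} (hG : ∀ i < k, G (2 * i) = G (2 * i + 2)) {i : ℕ}
    (hi : i ≤ k) : G (2 * i) = G 0 := by
  induction i with
  | zero => rfl
  | succ i ih => rw [← ih (by omega), hG i (by omega)]; rfl

namespace ProdCell

/-- The complexes `Y_x` and `Y_q` are connected. -/
theorem eq_of_eq_on_edges (hk : k ≠ 0) {v : T.V} (hv : T.deg v < 2)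
    {M : Type*} (F : T.ProdCell k → M)
    (hF : ∀ e ∈ localCells k v, e.dim = 1 → ∀ u u', Facet u e → Facet u' e → F u = F u')
    {u : T.ProdCell k} (hu : u ∈ localCells k v) (hd : u.dim = 0) : F u = F (vert v, some false) := by
  have hsome : ∀ (s σ σ' : T.SubCell k) (b : Bool), s.carrier ∈ star v → SubCell.Facet σ s →
      SubCell.Facet σ' s → σ.dim = 0 → F (σ, some b) = F (σ', some b) := fun s σ σ' b hs h h' h0 =>
    hF (s, some b) (mem_some.2 hs) (by rw [dim_some, h.dim_eq, h0]) _ _ (facet_some_some b h)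
      (facet_some_some b h')
  have hnone : ∀ (s : T.SubCell k), s.carrier ∈ link v → s.dim = 0 →
      ∀ b b', F (s, some b) = F (s, some b') := fun s hs h0 b b' =>
    hF (s, none) (mem_none.2 hs) (by rw [dim_none, h0]) _ _ (facet_some_none s b)
      (facet_some_none s b')
  obtain ⟨s, _ | b⟩ := u
  · rw [dim_none] at hd
    omega
  rw [mem_some] at hu
  rw [dim_some] at hd
  by_cases hv0 : T.deg v = 0
  -- Within one copy, move along the second coordinate to an edge at `v`, then along this edge to
  -- `v`.
  · have base : ∀ {q q' z : T.V} (h : T.sq v q q' z) (i j : ℕ) (b : Bool), i ≤ k → j ≤ k →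
        F (onSq k h (2 * i) (2 * j), some b) = F (vert v, some b) := by
      intro q q' z h i j b hi hj
      have h1 := eq_zero_position (G := fun n => F (onSq k h (2 * i) n, some b)) (fun j hj =>
        hsome (onSq k h (2 * i) (2 * j + 1)) _ _ b (onSq_mem_star h hv0 _ _)
          (facet_onSq_odd_right h (by omega) hj).1 (facet_onSq_odd_right h (by omega) hj).2
          (by rw [dim_onSq h (by omega) (by omega)]; omega)) hj
      have h2 := eq_zero_position (G := fun n => F (onSq k h n 0, some b)) (fun i hi =>
        hsome (onSq k h (2 * i + 1) 0) _ _ b (onSq_mem_star h hv0 _ _)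
          (facet_onSq_odd_left h hi (by omega)).1 (facet_onSq_odd_left h hi (by omega)).2
          (by rw [dim_onSq h (by omega) (by omega)]; omega)) hi
      rw [h1, h2, onSq_bot h (by omega), onEdge_zero]
    obtain ⟨q, q', z, h, i, j, hi, hj, rfl⟩ := exists_onSq_zero hv0 hk hu hd
    -- The height is changed at the far corner `(2 * k, 2 * k)`, which lies in the link and so
    -- carries a vertical edge.
    rw [base h i j b hi hj, ← base h k k b le_rfl le_rfl, ← base h k k false le_rfl le_rfl]
    exact hnone _ ((onSq_mem_link_iff hv0 hk h le_rfl le_rfl).2 (.inl rfl))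
      (by rw [dim_onSq h le_rfl le_rfl]; omega) _ _
  · have hv1 : T.deg v = 1 := by omega
    have base : ∀ (e : T.Edge) (i : ℕ) (b : Bool), e.src = v → i ≤ k →
        F (onEdge k e (2 * i), some b) = F (vert v, some b) := by
      intro e i b he hi
      have h1 := eq_zero_position (G := fun n => F (onEdge k e n, some b)) (fun i hi =>
        hsome (onEdge k e (2 * i + 1)) _ _ b (onEdge_mem_star hv1 he _)
          ((facet_onEdge_odd e hi).2 (.inl rfl)) ((facet_onEdge_odd e hi).2 (.inr rfl))
          (by rw [dim_onEdge e (by omega)]; omega)) hi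
      rw [h1, onEdge_zero, he]
    obtain ⟨e, he, i, hi, rfl⟩ := exists_onEdge_zero hv1 hk hu hd
    rw [base e i b he hi, ← base e k b he le_rfl, ← base e k false he le_rfl, onEdge_top e hk]
    subst he
    exact hnone _ (vert_mem_link hv1 e.inc) rfl _ _

end ProdCell

/-! ### The first cohomology of `X_x` -/

/-- On a grid, the sums of a cocycle along the two monotone boundary paths agree. -/
theorem grid_sum_eq {g : ℕ → ℕ → ZMod 2}
    (hg : ∀ i j, i < k → j < k → g (2 * i) (2 * j + 1) + g (2 * i + 2) (2 * j + 1) +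
      g (2 * i + 1) (2 * j) + g (2 * i + 1) (2 * j + 2) = 0) {n m : ℕ} (hn : n ≤ k) (hm : m ≤ k) :
    (∑ i ∈ Finset.range n, g (2 * i + 1) 0) + ∑ j ∈ Finset.range m, g (2 * n) (2 * j + 1) =
      (∑ j ∈ Finset.range m, g 0 (2 * j + 1)) + ∑ i ∈ Finset.range n, g (2 * i + 1) (2 * m) := by
  -- The cocycle relations of one row of small squares, added up. The claim follows by stacking
  -- rows.
  have row : ∀ n ≤ k, ∀ j < k, (∑ i ∈ Finset.range n, g (2 * i + 1) (2 * j)) +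
      g (2 * n) (2 * j + 1) =
      g 0 (2 * j + 1) + ∑ i ∈ Finset.range n, g (2 * i + 1) (2 * j + 2) := by
    intro n hn j hj
    induction n with
    | zero => simp
    | succ n ih =>
      have h1 := ih (by omega)
      have h2 := hg n j (by omega) hj
      rw [Finset.sum_range_succ, Finset.sum_range_succ]
      rw [show 2 * (n + 1) = 2 * n + 2 by ring]
      grind
  induction m with
  | zero => simp
  | succ m ih =>
    have h1 := ih (by omega)
    have h2 := row n hn m (by omega)
    rw [Finset.sum_range_succ, Finset.sum_range_succ]
    rw [show 2 * (m + 1) = 2 * m + 2 by ring]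
    grind

section Potential

variable (G : T.SubCell k → ZMod 2)

/-- The sum of a cochain along the first `n` segments of an edge. -/
def edgeSum (e : T.Edge) (n : ℕ) : ZMod 2 := ∑ i ∈ Finset.range n, G (onEdge k e (2 * i + 1))

/-- The sum of a cochain along the path from `x` to the position `(2 n, 2 m)` on a square that
first runs along the edge to `q`. -/
noncomputable def sqSum {x q q' z : T.V} (h : T.sq x q q' z) (n m : ℕ) : ZMod 2 :=
  (∑ i ∈ Finset.range n, G (onSq k h (2 * i + 1) 0)) +
    ∑ j ∈ Finset.range m, G (onSq k h (2 * n) (2 * j + 1))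

variable {G} {x : T.V}

variable (G x) in
/-- The sum of `G` along the boundary of every small square of `X_x` vanishes. -/
def IsSqCocycle : Prop :=
  ∀ (q q' z : T.V) (h : T.sq x q q' z) (i j : ℕ), i < k → j < k →
    G (onSq k h (2 * i) (2 * j + 1)) + G (onSq k h (2 * i + 2) (2 * j + 1)) +
      G (onSq k h (2 * i + 1) (2 * j)) + G (onSq k h (2 * i + 1) (2 * j + 2)) = 0

theorem sqSum_symm (hG : IsSqCocycle G x) {q q' z : T.V} (h : T.sq x q q' z) {n m : ℕ}
    (hn : n ≤ k) (hm : m ≤ k) : sqSum G (T.sq_symm h) m n = sqSum G h n m := by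
  unfold sqSum
  simp only [onSq_symm h]
  exact (grid_sum_eq (g := fun a b => G (onSq k h a b)) (hG q q' z h) hn hm).symm

theorem sqSum_zero {q q' z : T.V} (h : T.sq x q q' z) {n : ℕ} (hn : n ≤ k) :
    sqSum G h n 0 = edgeSum G ⟨x, q, T.sq_left h⟩ n := by
  unfold sqSum edgeSum
  rw [Finset.sum_range_zero, add_zero]
  refine Finset.sum_congr rfl fun i hi => ?_
  rw [Finset.mem_range] at hi
  rw [onSq_bot h (by omega)]

theorem sqSum_top (hk : k ≠ 0) {q q' z : T.V} (h : T.sq x q q' z) {m : ℕ} (hm : m ≤ k) :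
    sqSum G h k m = edgeSum G ⟨x, q, T.sq_left h⟩ k + edgeSum G ⟨q, z, T.sq_right h⟩ m := by
  rw [← sqSum_zero h le_rfl]
  unfold sqSum edgeSum
  rw [Finset.sum_range_zero, add_zero]
  congr 1
  refine Finset.sum_congr rfl fun i hi => ?_
  rw [Finset.mem_range] at hi
  rw [onSq_right h hk (by omega)]

/-- The two boundary paths of a square from `x` to `z` have the same sum. Chains of squares with the
same `x` and `z` extend this to any two paths of two edges, so a potential at `z` is well defined.
-/
theorem edgeSum_add_edgeSum (hT : T.LocallyConnected) (hk : k ≠ 0) (hG : IsSqCocycle G x)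
    {q q' z : T.V} (hq : T.inc x q) (hqz : T.inc q z) (hq' : T.inc x q') (hqz' : T.inc q' z) :
    edgeSum G ⟨x, q, hq⟩ k + edgeSum G ⟨q, z, hqz⟩ k =
      edgeSum G ⟨x, q', hq'⟩ k + edgeSum G ⟨q', z, hqz'⟩ k := by
  refine hT.sq_connected x z (fun a => ∀ (ha : T.inc x a) (haz : T.inc a z),
    edgeSum G ⟨x, q, hq⟩ k + edgeSum G ⟨q, z, hqz⟩ k =
      edgeSum G ⟨x, a, ha⟩ k + edgeSum G ⟨a, z, haz⟩ k) ?_ q q' hq hqz hq' hqz'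
    (fun _ _ => rfl) hq' hqz'
  intro a a' h ih ha' haz'
  rw [ih (T.sq_left h) (T.sq_right h), ← sqSum_top hk h le_rfl,
    ← sqSum_top hk (T.sq_symm h) le_rfl, sqSum_symm hG h le_rfl le_rfl]

open Classical in
/-- The values at the vertices of `T` of a potential of `G` on `X_x`. -/
noncomputable def vertPotential (G : T.SubCell k → ZMod 2) (x v : T.V) : ZMod 2 :=
  if v = x then 0
  else if h : T.inc x v then edgeSum G ⟨x, v, h⟩ k
  -- The intermediate qubit is an arbitrary choice, harmless by `edgeSum_add_edgeSum`. Vertices not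
  -- reached from `x` get the default value `0`.
  else if h : ∃ q, T.inc x q ∧ T.inc q v then
    edgeSum G ⟨x, h.choose, h.choose_spec.1⟩ k + edgeSum G ⟨h.choose, v, h.choose_spec.2⟩ k
  else 0

theorem vertPotential_self : vertPotential G x x = 0 := if_pos rfl

theorem vertPotential_of_inc {q : T.V} (h : T.inc x q) :
    vertPotential G x q = edgeSum G ⟨x, q, h⟩ k := by
  unfold vertPotential
  rw [if_neg (ne_of_inc h).symm, dif_pos h]

theorem vertPotential_of_inc_of_inc (hT : T.LocallyConnected) (hk : k ≠ 0)
    (hG : IsSqCocycle G x) {q z : T.V} (h : T.inc x q) (h' : T.inc q z) :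
    vertPotential G x z = edgeSum G ⟨x, q, h⟩ k + edgeSum G ⟨q, z, h'⟩ k := by
  have d1 := T.inc_deg h
  have d2 := T.inc_deg h'
  have n1 : z ≠ x := fun e => by rw [e] at d2; omega
  have n2 : ¬ T.inc x z := fun e => by have := T.inc_deg e; omega
  have he : ∃ q, T.inc x q ∧ T.inc q z := ⟨q, h, h'⟩
  unfold vertPotential
  rw [if_neg n1, dif_neg n2, dif_pos he]
  exact edgeSum_add_edgeSum hT hk hG _ _ _ _

/-- A potential of `G` on `X_x`. -/
noncomputable def potential (G : T.SubCell k → ZMod 2) (x : T.V) : T.SubCell k → ZMod 2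
  | vert v => vertPotential G x v
  -- The position is `a + 1`, so a vertex is preceded by `(a + 1) / 2` segments. The values at cells
  -- of positive dimension have no meaning.
  | edge e a => vertPotential G x e.src + edgeSum G e ((a + 1) / 2)
  | face f a b => sqSum G f.sq ((a + 1) / 2) ((b + 1) / 2)

theorem potential_onEdge_low {q : T.V} (hk : k ≠ 0) (h : T.inc x q) {n : ℕ} (hn : n ≤ k) :
    potential G x (onEdge k ⟨x, q, h⟩ (2 * n)) = edgeSum G ⟨x, q, h⟩ n := by
  rcases Nat.eq_zero_or_pos n with rfl | h0
  · rw [Nat.mul_zero, onEdge_zero]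
    exact vertPotential_self
  rcases hn.lt_or_eq with h1 | rfl
  · rw [onEdge_inner _ (by omega) (by omega)]
    simp only [potential, vertPotential_self, zero_add]
    congr 1
    omega
  · rw [onEdge_top _ hk]
    exact vertPotential_of_inc h

theorem potential_onEdge_high (hT : T.LocallyConnected) (hk : k ≠ 0) (hG : IsSqCocycle G x)
    {q z : T.V} (h : T.inc x q) (h' : T.inc q z) {n : ℕ} (hn : n ≤ k) :
    potential G x (onEdge k ⟨q, z, h'⟩ (2 * n)) =
      edgeSum G ⟨x, q, h⟩ k + edgeSum G ⟨q, z, h'⟩ n := by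
  rcases Nat.eq_zero_or_pos n with rfl | h0
  · rw [Nat.mul_zero, onEdge_zero]
    simp only [potential, vertPotential_of_inc h, edgeSum, Finset.sum_range_zero, add_zero]
  rcases hn.lt_or_eq with h1 | rfl
  · rw [onEdge_inner _ (by omega) (by omega)]
    simp only [potential, vertPotential_of_inc h]
    congr 2
    omega
  · rw [onEdge_top _ hk]
    exact vertPotential_of_inc_of_inc hT hk hG h h'

/-- Reconciles the definition by carriers with path sums in a square read in either order. Path
independence exchanges the two orders, so the bottom side, the right side and the interior suffice.
-/
theorem potential_onSq (hT : T.LocallyConnected) (hk : k ≠ 0) (hG : IsSqCocycle G x)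
    {q q' z : T.V} (h : T.sq x q q' z) {n m : ℕ} (hn : n ≤ k) (hm : m ≤ k) :
    potential G x (onSq k h (2 * n) (2 * m)) = sqSum G h n m := by
  have bot : ∀ {q q' z : T.V} (h : T.sq x q q' z) {n : ℕ}, n ≤ k →
      potential G x (onSq k h (2 * n) 0) = sqSum G h n 0 := by
    intro q q' z h n hn
    rw [onSq_bot h (by omega), potential_onEdge_low hk _ hn, sqSum_zero h hn]
  have top : ∀ {q q' z : T.V} (h : T.sq x q q' z) {m : ℕ}, m ≤ k →
      potential G x (onSq k h (2 * k) (2 * m)) = sqSum G h k m := by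
    intro q q' z h m hm
    rw [onSq_right h hk (by omega), potential_onEdge_high hT hk hG (T.sq_left h) _ hm,
      sqSum_top hk h hm]
  by_cases hm0 : m = 0
  · subst hm0
    exact bot h hn
  by_cases hn0 : n = 0
  · subst hn0
    rw [← onSq_symm, ← sqSum_symm hG h hn hm]
    exact bot _ hm
  by_cases hnk : n = k
  · subst hnk
    exact top h hm
  by_cases hmk : m = k
  · subst hmk
    rw [← onSq_symm, ← sqSum_symm hG h hn hm]
    exact top _ hn
  have inner : ∀ (f : T.Face) (n m : ℕ), n ≠ 0 → n < k → m ≠ 0 → m < k →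
      potential G x (onFace k f (2 * n) (2 * m)) = sqSum G f.sq n m := by
    intro f n m h1 h2 h3 h4
    rw [onFace_inner f (by omega) (by omega) (by omega) (by omega)]
    simp only [potential]
    congr 1 <;> omega
  by_cases hlt : WellOrderingRel q q'
  · have := inner ⟨x, q, q', z, h, hlt⟩ n m hn0 (by omega) hm0 (by omega)
    rwa [← onSq_face] at this
  · have := inner ⟨x, q', q, z, T.sq_symm h, ((trichotomous_of WellOrderingRel q q').resolve_left
      hlt).resolve_left (T.sq_ne h)⟩ m n hm0 (by omega) hn0 (by omega)
    rw [← onSq_face, sqSum_symm hG h hn hm] at this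
    rwa [← onSq_symm]

/-- The coboundary of the potential of `G` is `G`. -/
theorem potential_add_right (hT : T.LocallyConnected) (hk : k ≠ 0) (hG : IsSqCocycle G x)
    {q q' z : T.V} (h : T.sq x q q' z) {i j : ℕ} (hi : i ≤ k) (hj : j < k) :
    potential G x (onSq k h (2 * i) (2 * j)) + potential G x (onSq k h (2 * i) (2 * j + 2)) =
      G (onSq k h (2 * i) (2 * j + 1)) := by
  rw [show 2 * j + 2 = 2 * (j + 1) by ring, potential_onSq hT hk hG h hi (by omega),
    potential_onSq hT hk hG h hi (by omega)]
  unfold sqSum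
  rw [Finset.sum_range_succ]
  grind

theorem potential_add_left (hT : T.LocallyConnected) (hk : k ≠ 0) (hG : IsSqCocycle G x)
    {q q' z : T.V} (h : T.sq x q q' z) {i j : ℕ} (hi : i < k) (hj : j ≤ k) :
    potential G x (onSq k h (2 * i) (2 * j)) + potential G x (onSq k h (2 * i + 2) (2 * j)) =
      G (onSq k h (2 * i + 1) (2 * j)) := by
  simp only [← onSq_symm h]
  exact potential_add_right hT hk hG _ hj hi

theorem potential_add_edge (hT : T.LocallyConnected) (hk : k ≠ 0) (hG : IsSqCocycle G x)
    {e : T.Edge} (he : T.inc x e.src) {i : ℕ} (hi : i < k) :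
    potential G x (onEdge k e (2 * i)) + potential G x (onEdge k e (2 * i + 2)) =
      G (onEdge k e (2 * i + 1)) := by
  -- The edge is the side at position `2 * k` of some square at `x`.
  obtain ⟨q', h⟩ := T.sq_cover he e.inc
  have := potential_add_right hT hk hG h (i := k) le_rfl hi
  rwa [onSq_right h hk (by omega), onSq_right h hk (by omega), onSq_right h hk (by omega)] at this

end Potential

/-! ### The first cohomology of `Y_x` -/

namespace ProdCell

/-- The first cohomology of `Y_x` vanishes. -/
theorem exists_potential (hT : T.LocallyConnected) (hk : k ≠ 0) {x : T.V} (hx : T.deg x = 0)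
    (F : T.ProdCell k → ZMod 2)
    (hsq : ∀ b : Bool, IsSqCocycle (fun s => F (s, some b)) x)
    (hlink : ∀ e : T.Edge, T.inc x e.src → ∀ i < k,
      F (onEdge k e (2 * i + 1), some false) + F (onEdge k e (2 * i + 1), some true) +
        F (onEdge k e (2 * i), none) + F (onEdge k e (2 * i + 2), none) = 0) :
    ∃ H : T.ProdCell k → ZMod 2, ∀ e ∈ localCells k x, e.dim = 1 →
      ∀ u u', u ≠ u' → Facet u e → Facet u' e → H u + H u' = F e := by
  -- `A false` and `A true` are potentials on the two copies of `X_x`, and `c` is their failure to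
  -- produce `F` on vertical edges. The cocycle condition on the faces over `∂X_x` makes `c`
  -- constant along each edge of the link, connectedness of the link makes it one constant `C`, and
  -- adding `C` on one copy repairs the failure.
  let A : Bool → T.SubCell k → ZMod 2 := fun b => potential (fun s => F (s, some b)) x
  let c : T.SubCell k → ZMod 2 := fun s => A false s + A true s + F (s, none)
  have hc : ∀ e : T.Edge, T.inc x e.src → ∀ i ≤ k, c (onEdge k e (2 * i)) = c (vert e.src) := by
    intro e he i hi
    rw [← onEdge_zero]
    refine eq_zero_position (G := fun n => c (onEdge k e n)) (fun i hi => ?_) hi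
    have h1 := potential_add_edge hT hk (hsq false) he hi
    have h2 := potential_add_edge hT hk (hsq true) he hi
    have h3 := hlink e he i hi
    simp only [c, A]
    grind
  obtain ⟨q₀, hq₀⟩ := hT.exists_up x (by omega)
  have hc' : ∀ q, T.inc x q → c (vert q) = c (vert q₀) := fun q hq =>
    hT.link_up x hx (fun q => c (vert q) = c (vert q₀)) (fun a a' z h1 h2 h3 h4 ih => by
      have e1 := hc ⟨a, z, h3⟩ h1 k le_rfl
      have e2 := hc ⟨a', z, h4⟩ h2 k le_rfl
      rw [onEdge_top _ hk] at e1 e2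
      exact e2.symm.trans (e1.trans ih)) q₀ q hq₀ hq rfl
  let C := c (vert q₀)
  -- No vertex has interior height, so the value `0` there is a mere default.
  let H : T.ProdCell k → ZMod 2 := fun w => match w with
    | (s, some false) => A false s
    | (s, some true) => A true s + C
    | (_, none) => 0
  have two : ∀ {P : T.ProdCell k → Prop} {w w' : T.ProdCell k} {a : ZMod 2}, H w + H w' = a →
      (∀ u, P u → u = w ∨ u = w') → ∀ u u', u ≠ u' → P u → P u' → H u + H u' = a := by
    intro P w w' a h hP u u' hne hu hu'
    rcases hP u hu with rfl | rfl <;> rcases hP u' hu' with rfl | rfl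
    · exact (hne rfl).elim
    · exact h
    · rw [add_comm]
      exact h
    · exact (hne rfl).elim
  refine ⟨H, ?_⟩
  rintro ⟨s, _ | b⟩ he hd
  · rw [mem_none] at he
    rw [dim_none] at hd
    refine two (w := (s, some false)) (w' := (s, some true)) ?_ fun u hu => ?_
    · obtain ⟨e, h1, i, h2, rfl⟩ := exists_onEdge_of_mem_link_zero hx hk he (by omega)
      have h3 : c (onEdge k e (2 * i)) = C := (hc e h1 i h2).trans (hc' _ h1)
      simp only [c] at h3
      simp only [H]
      grind
    · rcases facet_none.1 hu with ⟨σ, h, -⟩ | ⟨_ | _, h⟩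
      · have := h.dim_eq
        omega
      · exact .inl h
      · exact .inr h
  · rw [mem_some] at he
    rw [dim_some] at hd
    obtain ⟨q, q', z, h, i, j, hi, hj, rfl⟩ := exists_onSq_one hx hk he hd
    refine two (w := (onSq k h (2 * i) (2 * j), some b))
      (w' := (onSq k h (2 * i + 2) (2 * j), some b)) ?_ fun u hu => ?_
    · have := potential_add_left hT hk (hsq b) h hi hj
      cases b <;> simp only [H, A]
      · exact this
      · grind
    · obtain ⟨σ, h1, rfl⟩ := facet_some.1 hu
      rcases (facet_onSq₁ h hi hj).1 h1 with rfl | rfl <;> simp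

end ProdCell

end TannerSquareComplex
end CodeReplacement

namespace CodeReplacement

/-! ### Incidence maps -/

open Classical in
-- The tool for reading an abstract incidence sum as a sum over a concrete set, such as the facets
-- of a cell: `i` identifies the neighbours of `b` with `s`.
theorem incidenceMap_apply_eq_sum {A B A' : Type} [Finite A] {r : A → B → Prop} (f : A → ZMod 2)
    (b : B) (s : Finset A') (F : A' → ZMod 2) (i : A → A') (hi : ∀ a, r a b → i a ∈ s)
    (hinj : ∀ a a', r a b → r a' b → i a = i a' → a = a') (hsurj : ∀ c ∈ s, ∃ a, r a b ∧ i a = c)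
    (hF : ∀ a, r a b → f a = F (i a)) : incidenceMap r f b = ∑ c ∈ s, F c := by
  let _ := Fintype.ofFinite A
  change ∑ a, (if r a b then f a else 0) = _
  rw [← Finset.sum_filter]
  refine Finset.sum_bij (fun a _ => i a) ?_ ?_ ?_ ?_
  · intro a ha
    exact hi a (by simpa using ha)
  · intro a ha a' ha' h
    exact hinj a a' (by simpa using ha) (by simpa using ha') h
  · intro c hc
    obtain ⟨a, h1, h2⟩ := hsurj c hc
    exact ⟨a, by simpa using h1, h2⟩
  · intro a ha
    exact hF a (by simpa using ha)

theorem incidenceMap_reindex {A B A' B' : Type} [Finite A] [Finite A'] {r : A → B → Prop}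
    {r' : A' → B' → Prop} (eA : A' ≃ A) (eB : B' → B) (h : ∀ a b, r' a b ↔ r (eA a) (eB b))
    (f : A → ZMod 2) (b : B') : incidenceMap r' (f ∘ eA) b = incidenceMap r f (eB b) := by
  classical
  let _ := Fintype.ofFinite A
  let _ := Fintype.ofFinite A'
  change ∑ a, (if r' a b then f (eA a) else 0) = ∑ a, (if r a (eB b) then f a else 0)
  simp only [h]
  exact Equiv.sum_comp eA fun a => if r a (eB b) then f a else 0

/-- The transpose of an incidence map is the incidence map of the converse relation. -/
theorem sum_mul_incidenceMap {A B : Type} [Finite A] [Finite B] [iA : Fintype A] [iB : Fintype B]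
    (r : A → B → Prop)
    (f : A → ZMod 2) (g : B → ZMod 2) :
    ∑ b, g b * incidenceMap r f b = ∑ a, incidenceMap (fun b a => r a b) g a * f a := by
  classical
  obtain rfl : iA = Fintype.ofFinite A := Subsingleton.elim _ _
  obtain rfl : iB = Fintype.ofFinite B := Subsingleton.elim _ _
  simp only [incidenceMap, LinearMap.coe_mk, AddHom.coe_mk, Finset.mul_sum, Finset.sum_mul]
  rw [Finset.sum_comm]
  refine Finset.sum_congr rfl fun a _ => Finset.sum_congr rfl fun b _ => ?_
  split_ifs <;> simp

/-- Transposes of exact sequences of incidence maps are exact. -/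
theorem exact_transpose {A B C : Type} [Finite A] [Finite B] [Finite C]
    {r : A → B → Prop} {s : B → C → Prop}
    (h : ∀ f, incidenceMap s f = 0 → ∃ g, incidenceMap r g = f) (f : B → ZMod 2)
    (hf : incidenceMap (fun b a => r a b) f = 0) : ∃ g, incidenceMap (fun c b => s b c) g = f := by
  classical
  let _ := Fintype.ofFinite A
  let _ := Fintype.ofFinite B
  let _ := Fintype.ofFinite C
  -- If `f` is outside the range of the transpose of `s`, some functional kills this range but not
  -- `f`. Its vector `g` is then in the kernel of `s`, hence in the image of `r`. Moving `r` across
  -- the pairing with `f` gives zero, a contradiction.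
  by_contra hne
  have hmem : f ∉ LinearMap.range (incidenceMap fun c b => s b c) := hne
  obtain ⟨φ, h1, h2⟩ := Submodule.exists_le_ker_of_notMem hmem
  let g : B → ZMod 2 := fun b => φ (Pi.single b 1)
  have hφ : ∀ f, φ f = ∑ b, g b * f b := by
    intro f
    conv_lhs => rw [LinearMap.pi_apply_eq_sum_univ φ f]
    refine Finset.sum_congr rfl fun b _ => ?_
    rw [smul_eq_mul, mul_comm]
    congr 2
    ext b'
    simp [Pi.single_apply, eq_comm]
  have hg : incidenceMap s g = 0 := by
    ext c
    have h3 : φ (incidenceMap (fun c b => s b c) (Pi.single c 1)) = 0 := h2 ⟨_, rfl⟩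
    rw [hφ, sum_mul_incidenceMap] at h3
    simpa [Pi.single_apply] using h3
  obtain ⟨p, hp⟩ := h g hg
  apply h1
  rw [hφ, ← hp]
  simp only [mul_comm (incidenceMap r p _)]
  rw [sum_mul_incidenceMap, hf]
  simp

/-- Needed because the cells of the `Z`-replacement agree with those of the dual `X`-replacement
only up to relabelled degrees. -/
theorem exact_reindex {A B C A' B' C' : Type} [Finite A] [Finite B] [Finite C] [Finite A']
    [Finite B'] [Finite C'] {r : A → B → Prop} {s : B → C → Prop} {r' : A' → B' → Prop}
    {s' : B' → C' → Prop} (eA : A' ≃ A) (eB : B' ≃ B) (eC : C' ≃ C)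
    (hr : ∀ a b, r' a b ↔ r (eA a) (eB b)) (hs : ∀ b c, s' b c ↔ s (eB b) (eC c))
    (h : ∀ f, incidenceMap s f = 0 → ∃ g, incidenceMap r g = f) (f : B' → ZMod 2)
    (hf : incidenceMap s' f = 0) : ∃ g, incidenceMap r' g = f := by
  obtain ⟨g, hg⟩ := h (f ∘ eB.symm) (by
    ext c
    have := incidenceMap_reindex eB eC hs (f ∘ eB.symm) (eC.symm c)
    rw [Equiv.apply_symm_apply] at this
    rw [← this, Function.comp_assoc, Equiv.symm_comp_self, Function.comp_id, hf]
    rfl)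
  refine ⟨g ∘ eA, ?_⟩
  ext b
  rw [incidenceMap_reindex eA eB hr, hg]
  simp

open TannerSquareComplex

/-! ### Locally constant cochains, local sums and quotients -/

namespace EmbeddedCode

variable {T : TannerSquareComplex} (E : EmbeddedCode T)

/-- The map from `𝔽₂^{V_R}` to `C_R^R` whose values are constant on the local complexes. -/
noncomputable def constMap (R : ℕ) : T.Cochain R →ₗ[ZMod 2] E.C R R :=
  incidenceMap fun v c => E.base c.1 = v.1

/-- The map from `C_R^R` to `𝔽₂^{V_R}` summing over each local complex. -/
noncomputable def sumMap (R : ℕ) : E.C R R →ₗ[ZMod 2] T.Cochain R :=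
  incidenceMap fun c v => E.base c.1 = v.1

theorem constMap_apply (R : ℕ) (g : T.Cochain R) (c : E.Basis R R) :
    E.constMap R g c = g ⟨E.base c.1, c.2.1⟩ := by
  refine (incidenceMap_apply_eq_sum (A' := T.Vert R) g c {⟨E.base c.1, c.2.1⟩} g id
    (fun a h => ?_) (fun _ _ _ _ h => h) (fun v hv => ?_) (fun _ _ => rfl)).trans
    (Finset.sum_singleton _ _)
  · exact Finset.mem_singleton.2 (Subtype.ext h.symm)
  · rw [Finset.mem_singleton] at hv
    exact ⟨v, by rw [hv], rfl⟩

/-- An isomorphism from local cohomology given by a map on cochains. -/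
theorem exists_H_equiv {R m : ℕ} {M : Type} [AddCommGroup M] [Module (ZMod 2) M]
    (ev : E.C R m →ₗ[ZMod 2] M) (hker : ∀ f ∈ E.locZ R m, ev f = 0 ↔ f ∈ E.locB R m)
    (hsurj : ∀ y, ∃ f ∈ E.locZ R m, ev f = y) :
    ∃ φ : E.H R m ≃ₗ[ZMod 2] M, ∀ f : E.locZ R m, φ (Submodule.Quotient.mk f) = ev f.1 := by
  let ψ : E.locZ R m →ₗ[ZMod 2] M := ev ∘ₗ (E.locZ R m).subtype
  have h1 : (E.locB R m).submoduleOf (E.locZ R m) = LinearMap.ker ψ := by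
    ext f
    rw [Submodule.submoduleOf, Submodule.mem_comap, LinearMap.mem_ker]
    exact (hker f.1 f.2).symm
  have h2 : Function.Surjective ψ := fun y => by
    obtain ⟨f, hf, h⟩ := hsurj y
    exact ⟨⟨f, hf⟩, h⟩
  exact ⟨(Submodule.quotEquivOfEq _ _ h1).trans (ψ.quotKerEquivOfSurjective h2), fun f => rfl⟩

theorem H_subsingleton {R m : ℕ} (h : ∀ f ∈ E.locZ R m, f ∈ E.locB R m) :
    Subsingleton (E.H R m) := by
  rw [Submodule.Quotient.subsingleton_iff, eq_top_iff]
  exact fun f _ => h f.1 f.2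

theorem H_subsingleton_of_isEmpty {R m : ℕ} [IsEmpty (E.Basis R m)] : Subsingleton (E.H R m) :=
  E.H_subsingleton fun f _ => by
    rw [Subsingleton.elim f 0]
    exact Submodule.zero_mem _

theorem Hconn_mk {R m : ℕ} (f : E.locZ R m) :
    E.Hconn R m (Submodule.Quotient.mk f) =
      Submodule.Quotient.mk ⟨E.conn R m f.1, E.conn_mem_locZ R m f.2⟩ := rfl

end EmbeddedCode

end CodeReplacement

namespace CodeReplacement

open TannerSquareComplex SubCell ProdCell

variable {T : TannerSquareComplex} {k : ℕ}

/-! ### The local cohomology of the `X`-replacement -/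

/-- The star is the closure of the cells of dimension `2 - deg v` with lowest vertex `v`, so at
least one such cell has to exist. Upward edges and the squares covering them provide it. -/
theorem TannerSquareComplex.LocallyConnected.self_mem_star (hT : T.LocallyConnected) (v : T.V) :
    Cell.vert v ∈ star v := by
  have h2 := T.deg_le v
  by_cases hv0 : T.deg v = 0
  · obtain ⟨q, hq⟩ := hT.exists_up v (by omega)
    have := T.inc_deg hq
    obtain ⟨z, hz⟩ := hT.exists_up q (by omega)
    obtain ⟨q', h⟩ := T.sq_cover hq hz
    have hm := onSq_mem_star (k := 1) h hv0 0 0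
    rwa [onSq_bot h (by omega), onEdge_zero] at hm
  by_cases hv1 : T.deg v = 1
  · obtain ⟨z, hz⟩ := hT.exists_up v (by omega)
    exact (mem_star_of_deg_one hv1).2 ⟨⟨v, z, hz⟩, rfl, .inl rfl⟩
  · exact (mem_star_of_deg_two (by omega)).2 rfl

namespace ReplaceX

/-- The vertex `v` at height `b` of `Y_v`. -/
def basePoint (hT : T.LocallyConnected) (k : ℕ) (b : Bool) (v : T.V) : Vertex T k :=
  ⟨(v, (vert v, some b)), mem_some.2 (hT.self_mem_star v)⟩

theorem dim_basePoint (hT : T.LocallyConnected) (k : ℕ) (b : Bool) (v : T.V) :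
    (basePoint hT k b v).1.2.dim = 0 := by
  rw [basePoint, dim_some]
  rfl

/-- Over a `Z`-check there are only the two copies of this vertex. -/
theorem eq_basePoint (hT : T.LocallyConnected) (p : Vertex T k) (hp : T.deg p.1.1 = 2) :
    ∃ b, p = basePoint hT k b p.1.1 := by
  obtain ⟨⟨v, s, _ | b⟩, hw⟩ := p
  · exact (not_mem_link_of_deg_two hp (mem_none.1 hw)).elim
  · have := (mem_star_of_deg_two hp).1 (mem_some.1 hw)
    cases s with
    | vert u =>
      simp only [SubCell.carrier, Cell.vert.injEq] at this
      subst this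
      exact ⟨b, rfl⟩
    | edge e a => simp [SubCell.carrier] at this
    | face f a b => simp [SubCell.carrier] at this

open Classical in
/-- The part over `v` of a cochain, as a function on all cells. -/
noncomputable def extend {R m : ℕ} (f : (replaceX T k).C R m) (v : T.V) (w : T.ProdCell k) :
    ZMod 2 :=
  if h : w ∈ localCells k v ∧ T.deg v = R ∧ T.deg v + w.dim = m then f ⟨⟨(v, w), h.1⟩, h.2⟩ else 0

theorem extend_apply {R m : ℕ} (f : (replaceX T k).C R m) (c : (replaceX T k).Basis R m) :
    extend f c.1.1.1 c.1.1.2 = f c :=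
  dif_pos ⟨c.1.2, c.2⟩

theorem extend_apply_mk {R m : ℕ} (f : (replaceX T k).C R m) (v : T.V) (w : T.ProdCell k)
    (hw : w ∈ localCells k v) (h : T.deg v = R) (h' : T.deg v + w.dim = m) :
    extend f v w = f ⟨⟨(v, w), hw⟩, h, h'⟩ :=
  dif_pos ⟨hw, h, h'⟩

/-- Requiring equal base points leaves only incidences inside `Y_v`. As `Y_v` is closed under
facets, no facet of `w` is missing from the sum. -/
theorem locD_apply {R m : ℕ} (f : (replaceX T k).C R m) {v : T.V} {w : T.ProdCell k}
    (hw : w ∈ localCells k v) (h : T.deg v = R) (h' : T.deg v + w.dim = m + 1)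
    (s : Finset (T.ProdCell k)) (hs : ∀ u, ProdCell.Facet u w ↔ u ∈ s) :
    (replaceX T k).locD R m f ⟨⟨(v, w), hw⟩, h, h'⟩ = ∑ u ∈ s, extend f v u := by
  have hinc : ∀ a : (replaceX T k).Basis R m, (replaceX T k).total.inc a.1 ⟨(v, w), hw⟩ ∧
      a.1.1.1 = v → ProdCell.Facet a.1.1.2 w := by
    rintro a ⟨⟨-, h1⟩ | ⟨h1, -⟩, h2⟩
    · exact h1
    · exact (ne_of_inc h1 h2).elim
  refine incidenceMap_apply_eq_sum f _ s (extend f v) (fun a => a.1.1.2) ?_ ?_ ?_ ?_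
  · exact fun a ha => (hs _).1 (hinc a ha)
  · exact fun a a' ha ha' h => Subtype.ext (Subtype.ext (Prod.ext (ha.2.trans ha'.2.symm) h))
  · intro u hu
    have hu := (hs u).2 hu
    exact ⟨⟨⟨(v, u), local_closed hu hw⟩, h, by
      change T.deg v + u.dim = m
      have := hu.dim_eq
      omega⟩, ⟨.inl ⟨rfl, hu⟩, rfl⟩, rfl⟩
  · intro a ha
    rw [← extend_apply f a]
    exact congrArg (fun v => extend f v a.1.1.2) ha.2

theorem locD_apply_pair {R m : ℕ} (f : (replaceX T k).C R m) {v : T.V} {w : T.ProdCell k}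
    (hw : w ∈ localCells k v) (h : T.deg v = R) (h' : T.deg v + w.dim = m + 1)
    {u u' : T.ProdCell k} (hne : u ≠ u') (hu : ∀ c, ProdCell.Facet c w ↔ c = u ∨ c = u') :
    (replaceX T k).locD R m f ⟨⟨(v, w), hw⟩, h, h'⟩ = extend f v u + extend f v u' := by
  classical
  rw [locD_apply f hw h h' {u, u'} (by simpa using hu), Finset.sum_pair hne]

/-- The locally constant cochains are cocycles. -/
theorem locD_constMap (R : ℕ) (g : T.Cochain R) :
    (replaceX T k).locD R R ((replaceX T k).constMap R g) = 0 := by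
  ext ⟨⟨⟨v, w⟩, hw⟩, h, h'⟩
  change T.deg v = R at h
  change T.deg v + w.dim = R + 1 at h'
  obtain ⟨u, u', hne, hu⟩ := exists_facets_of_dim_one (w := w) (by omega)
  rw [locD_apply_pair _ hw h h' hne hu]
  have key : ∀ c, ProdCell.Facet c w →
      extend ((replaceX T k).constMap R g) v c = g ⟨v, h⟩ := by
    intro c hc
    have := hc.dim_eq
    rw [extend_apply_mk _ v c (local_closed hc hw) h (by omega), EmbeddedCode.constMap_apply]
    rfl
  rw [key u ((hu u).2 (.inl rfl)), key u' ((hu u').2 (.inr rfl)), CharTwo.add_self_eq_zero]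
  rfl

/-- The cocycles of lowest degree over an `X`-check or a qubit are constant. -/
theorem exists_constMap_eq (hk : k ≠ 0) {R : ℕ} (hR : R < 2)
    (f : (replaceX T k).C R R) (hf : (replaceX T k).locD R R f = 0) :
    ∃ g, (replaceX T k).constMap R g = f := by
  refine ⟨fun v => extend f v.1 (vert v.1, some false), ?_⟩
  ext ⟨⟨⟨v, w⟩, hw⟩, h, h'⟩
  rw [EmbeddedCode.constMap_apply]
  change T.deg v = R at h
  change T.deg v + w.dim = R at h'
  change w ∈ localCells k v at hw
  change extend f v (vert v, some false) = _
  rw [← eq_of_eq_on_edges hk (v := v) (by omega) (extend f v) ?_ hw (by omega),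
    extend_apply_mk f v w hw h h']
  intro e he hd u u' hu hu'
  obtain ⟨c, c', hne, hc⟩ := exists_facets_of_dim_one hd
  have hd' : T.deg v + e.dim = R + 1 := by omega
  have h0 : (replaceX T k).locD R R f ⟨⟨(v, e), he⟩, h, hd'⟩ = 0 := by rw [hf]; rfl
  rw [locD_apply_pair f he h hd' hne hc] at h0
  have h1 := CharTwo.add_eq_zero.1 h0
  rcases (hc u).1 hu with rfl | rfl <;> rcases (hc u').1 hu' with rfl | rfl
  exacts [rfl, h1, h1.symm, rfl]

/-- The first cohomology of the local complexes over the `X`-checks vanishes. -/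
theorem exists_locD_eq (hT : T.LocallyConnected) (hk : k ≠ 0) (f : (replaceX T k).C 0 1)
    (hf : (replaceX T k).locD 0 1 f = 0) : ∃ g, (replaceX T k).locD 0 0 g = f := by
  classical
  have hsq : ∀ x : T.V, T.deg x = 0 → ∀ b : Bool,
      IsSqCocycle (fun s => extend f x (s, some b)) x := by
    intro x hx b q q' z h i j hi hj
    have hw : ((onSq k h (2 * i + 1) (2 * j + 1), some b) : T.ProdCell k) ∈ localCells k x :=
      mem_some.2 (onSq_mem_star h hx _ _)
    have hd := dim_onSq (k := k) h (a := 2 * i + 1) (b := 2 * j + 1) (by omega) (by omega)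
    have hinj : ∀ {a b a' b' : ℕ}, a ≤ 2 * i + 2 → b ≤ 2 * j + 2 → a' ≤ 2 * i + 2 →
        b' ≤ 2 * j + 2 → (onSq k h a b = onSq k h a' b' ↔ a = a' ∧ b = b') := fun g1 g2 g3 g4 =>
      ⟨onSq_injective h (by omega) (by omega) (by omega) (by omega), by rintro ⟨rfl, rfl⟩; rfl⟩
    have hd' : T.deg x + ProdCell.dim (onSq k h (2 * i + 1) (2 * j + 1), some b) = 1 + 1 := by
      rw [dim_some]
      omega
    have h0 : (replaceX T k).locD 0 1 f ⟨⟨(x, _), hw⟩, hx, hd'⟩ = 0 := by rw [hf]; rfl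
    rw [locD_apply f hw hx hd' {(onSq k h (2 * i) (2 * j + 1), some b),
      (onSq k h (2 * i + 2) (2 * j + 1), some b), (onSq k h (2 * i + 1) (2 * j), some b),
      (onSq k h (2 * i + 1) (2 * j + 2), some b)} ?_, Finset.sum_insert, Finset.sum_insert,
      Finset.sum_pair] at h0
    · simp only
      rw [← h0]
      ring
    · simp only [ne_eq, Prod.mk.injEq, and_true]
      rw [hinj] <;> omega
    · simp only [Finset.mem_insert, Finset.mem_singleton, Prod.mk.injEq, and_true]
      rw [hinj, hinj] <;> omega
    · simp only [Finset.mem_insert, Finset.mem_singleton, Prod.mk.injEq, and_true]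
      rw [hinj, hinj, hinj] <;> omega
    · intro u
      rw [facet_some]
      simp only [facet_onSq h hi hj, Finset.mem_insert, Finset.mem_singleton]
      constructor
      · rintro ⟨σ, (rfl | rfl) | (rfl | rfl), rfl⟩ <;> simp
      · rintro (rfl | rfl | rfl | rfl) <;> simp
  have hlink : ∀ x : T.V, T.deg x = 0 → ∀ e : T.Edge, T.inc x e.src → ∀ i < k,
      extend f x (onEdge k e (2 * i + 1), some false) +
        extend f x (onEdge k e (2 * i + 1), some true) +
        extend f x (onEdge k e (2 * i), none) + extend f x (onEdge k e (2 * i + 2), none) = 0 := by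
    intro x hx e he i hi
    have hw : ((onEdge k e (2 * i + 1), none) : T.ProdCell k) ∈ localCells k x :=
      mem_none.2 (onEdge_mem_link hx he _)
    have hd := dim_onEdge (k := k) e (a := 2 * i + 1) (by omega)
    have hd' : T.deg x + ProdCell.dim (onEdge k e (2 * i + 1), none) = 1 + 1 := by
      rw [dim_none]
      omega
    have h0 : (replaceX T k).locD 0 1 f ⟨⟨(x, _), hw⟩, hx, hd'⟩ = 0 := by rw [hf]; rfl
    rw [locD_apply f hw hx hd' {(onEdge k e (2 * i + 1), some false),
      (onEdge k e (2 * i + 1), some true), (onEdge k e (2 * i), none),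
      (onEdge k e (2 * i + 2), none)} ?_, Finset.sum_insert, Finset.sum_insert,
      Finset.sum_pair] at h0
    · rw [← h0]
      ring
    · simp only [ne_eq, Prod.mk.injEq, and_true]
      intro h
      have := onEdge_injective e (by omega) (by omega) h
      omega
    · simp
    · simp
    · intro u
      rw [facet_none]
      simp only [facet_onEdge_odd e hi, Finset.mem_insert, Finset.mem_singleton]
      constructor
      · rintro (⟨σ, rfl | rfl, rfl⟩ | ⟨_ | _, rfl⟩) <;> simp
      · rintro (rfl | rfl | rfl | rfl) <;> simp
  -- A potential for every vertex at once, so that they can be assembled into one cochain. Vertices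
  -- other than `X`-checks get the filler `0`.
  have hH : ∀ x : T.V, ∃ H : T.ProdCell k → ZMod 2, T.deg x = 0 → ∀ e ∈ localCells k x,
      e.dim = 1 → ∀ u u', u ≠ u' → ProdCell.Facet u e → ProdCell.Facet u' e →
      H u + H u' = extend f x e := by
    intro x
    by_cases hx : T.deg x = 0
    · obtain ⟨H, h⟩ := exists_potential hT hk hx (extend f x) (hsq x hx) (hlink x hx)
      exact ⟨H, fun _ => h⟩
    · exact ⟨0, fun h => (hx h).elim⟩
  choose H hH using hH
  refine ⟨fun c => H c.1.1.1 c.1.1.2, ?_⟩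
  ext ⟨⟨⟨x, e⟩, he⟩, hx, hd⟩
  change T.deg x = 0 at hx
  change T.deg x + e.dim = 1 at hd
  obtain ⟨u, u', hne, hu⟩ := exists_facets_of_dim_one (w := e) (by omega)
  have hu1 := (hu u).2 (.inl rfl)
  have hu2 := (hu u').2 (.inr rfl)
  have e1 := hu1.dim_eq
  have e2 := hu2.dim_eq
  rw [locD_apply_pair _ he hx hd hne hu, ← extend_apply_mk f x e he hx hd,
    ← hH x hx e he (by omega) u u' hne hu1 hu2,
    extend_apply_mk _ x u (local_closed hu1 he) hx (by omega),
    extend_apply_mk _ x u' (local_closed hu2 he) hx (by omega)]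

/-- The connecting maps on locally constant cochains are the coboundary maps of the code. -/
theorem conn_constMap (R : ℕ) (g : T.Cochain R) :
    (replaceX T k).conn R R ((replaceX T k).constMap R g) =
      (replaceX T k).constMap (R + 1) (T.coboundary R g) := by
  classical
  let _ := Fintype.ofFinite (T.Vert R)
  ext ⟨⟨⟨v, w⟩, hw⟩, h, h'⟩
  change T.deg v = R + 1 at h
  change T.deg v + w.dim = R + 1 at h'
  rw [EmbeddedCode.constMap_apply]
  have hinc : ∀ a : (replaceX T k).Basis R R, (replaceX T k).total.inc a.1 ⟨(v, w), hw⟩ ∧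
      T.inc a.1.1.1 v → a.1.1.2 = w := by
    rintro a ⟨⟨h1, -⟩ | ⟨-, h1⟩, h2⟩
    · exact (ne_of_inc h2 h1).elim
    · exact h1
  -- The terms are the copies of `w` in `Y_u` for `u` below `v`. Each exists because `Y_v ⊆ Y_u`,
  -- and contributes `g u`.
  have h1 : (replaceX T k).conn R R ((replaceX T k).constMap R g) ⟨⟨(v, w), hw⟩, h, h'⟩ =
      ∑ u : T.Vert R with T.inc u.1 v, g u := by
    refine incidenceMap_apply_eq_sum _ _ _ g (fun a => ⟨a.1.1.1, a.2.1⟩) ?_ ?_ ?_ ?_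
    · exact fun a ha => Finset.mem_filter.2 ⟨Finset.mem_univ _, ha.2⟩
    · exact fun a a' ha ha' h => Subtype.ext (Subtype.ext (Prod.ext (congrArg Subtype.val h)
        ((hinc a ha).trans (hinc a' ha').symm)))
    · rintro ⟨u, hu⟩ hm
      have hm : T.inc u v := by simpa using hm
      exact ⟨⟨⟨(u, w), local_mono hm hw⟩, hu, by
        change T.deg u + w.dim = R
        omega⟩, ⟨.inr ⟨hm, rfl⟩, hm⟩, rfl⟩
    · exact fun a _ => EmbeddedCode.constMap_apply _ _ _ _
  rw [h1]
  symm
  exact incidenceMap_apply_eq_sum g _ _ g id (fun a ha => Finset.mem_filter.2 ⟨Finset.mem_univ _, ha⟩) (fun _ _ _ _ h => h)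
    (fun c hc => ⟨c, (Finset.mem_filter.1 hc).2, rfl⟩) (fun _ _ => rfl)

theorem isEmpty_basis {R m : ℕ} (h : m < R) : IsEmpty ((replaceX T k).Basis R m) :=
  ⟨fun c => by
    have h1 : T.deg c.1.1.1 = R := c.2.1
    have h2 : T.deg c.1.1.1 + c.1.1.2.dim = m := c.2.2
    omega⟩

theorem isEmpty_basis_of_two_lt {R m : ℕ} (h : 2 < m) : IsEmpty ((replaceX T k).Basis R m) :=
  ⟨fun c => by
    have := (replaceX T k).total.deg_le c.1
    have h2 := c.2.2
    omega⟩

/-- `C_R` starts in degree `R`, so there its cohomology is just the space of cocycles. -/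
theorem locB_eq_bot (R : ℕ) : (replaceX T k).locB R R = ⊥ := by
  cases R with
  | zero => rfl
  | succ R =>
    have := isEmpty_basis (T := T) (k := k) (show R < R + 1 by omega)
    rw [eq_bot_iff]
    rintro _ ⟨f, rfl⟩
    rw [Subsingleton.elim f 0, map_zero]
    exact Submodule.zero_mem _

end ReplaceX

end CodeReplacement

namespace CodeReplacement

open TannerSquareComplex SubCell ProdCell

variable {T : TannerSquareComplex} {k : ℕ}

/-! ### The induced complex of the `X`-replacement -/

namespace ReplaceX

/-- The vertex `v` at height `b` of `Y_v` as a basis element of the code. -/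
def basisPoint (hT : T.LocallyConnected) (k : ℕ) (b : Bool) (R : ℕ) (v : T.Vert R) :
    (replaceX T k).Basis R R :=
  ⟨basePoint hT k b v.1, v.2, by
    change T.deg v.1 + (basePoint hT k b v.1).1.2.dim = R
    rw [dim_basePoint, v.2, add_zero]⟩

/-- The cocycles are the constants, and evaluation at one point of each local complex recovers the
constant. The last clause describes `φ` without reference to the chosen point. -/
theorem exists_H_equiv_const (hT : T.LocallyConnected) (hk : k ≠ 0) {R : ℕ} (hR : R < 2) :
    ∃ φ : (replaceX T k).H R R ≃ₗ[ZMod 2] T.Cochain R, (replaceX T k).IsLocal φ ∧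
      ∀ (g : T.Cochain R) (f : (replaceX T k).locZ R R), f.1 = (replaceX T k).constMap R g →
        φ (Submodule.Quotient.mk f) = g := by
  have hev : ∀ g : T.Cochain R, LinearMap.funLeft (ZMod 2) (ZMod 2) (basisPoint hT k false R)
      ((replaceX T k).constMap R g) = g := by
    intro g
    ext v
    rw [LinearMap.funLeft_apply, EmbeddedCode.constMap_apply]
    rfl
  obtain ⟨φ, hφ⟩ := (replaceX T k).exists_H_equiv
    (LinearMap.funLeft (ZMod 2) (ZMod 2) (basisPoint hT k false R)) (fun f hf => by
      obtain ⟨g, rfl⟩ := exists_constMap_eq hk hR f hf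
      rw [hev, locB_eq_bot, Submodule.mem_bot]
      constructor
      · rintro rfl
        exact map_zero _
      · intro h
        rw [← hev g, h, map_zero])
    (fun g => ⟨_, locD_constMap R g, hev g⟩)
  refine ⟨φ, fun f v hf => ?_, fun g f hf => ?_⟩
  · rw [hφ]
    exact hf _ rfl
  · rw [hφ, hf, hev]

/-- `Y_z` is two points and `C_Z` lives only in degree two, so cohomology equals cochains and is
read off at the two heights. A constant has equal values there, hence the diagonal. -/
theorem exists_H_equiv_pair (hT : T.LocallyConnected) :
    ∃ φ : (replaceX T k).H 2 2 ≃ₗ[ZMod 2] (T.Vert 2 → ZMod 2 × ZMod 2),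
      (replaceX T k).IsLocal φ ∧
      ∀ (g : T.Cochain 2) (f : (replaceX T k).locZ 2 2), f.1 = (replaceX T k).constMap 2 g →
        φ (Submodule.Quotient.mk f) = diagonal (T.Vert 2) g := by
  have hZ : ∀ f, f ∈ (replaceX T k).locZ 2 2 := fun f => by
    have := isEmpty_basis_of_two_lt (T := T) (k := k) (R := 2) (m := 2 + 1) (by omega)
    exact Subsingleton.elim _ _
  let ev : (replaceX T k).C 2 2 →ₗ[ZMod 2] (T.Vert 2 → ZMod 2 × ZMod 2) :=
    { toFun := fun f v => (f (basisPoint hT k false 2 v), f (basisPoint hT k true 2 v))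
      map_add' := fun _ _ => rfl
      map_smul' := fun _ _ => rfl }
  have hpt : ∀ c : (replaceX T k).Basis 2 2, ∃ b, c = basisPoint hT k b 2 ⟨c.1.1.1, c.2.1⟩ := by
    intro c
    obtain ⟨b, hb⟩ := eq_basePoint hT c.1 c.2.1
    exact ⟨b, Subtype.ext hb⟩
  obtain ⟨φ, hφ⟩ := (replaceX T k).exists_H_equiv ev (fun f _ => by
      rw [locB_eq_bot, Submodule.mem_bot]
      constructor
      · intro h
        ext c
        have h' := Prod.mk.inj (congrFun h ⟨c.1.1.1, c.2.1⟩)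
        obtain ⟨_ | _, hb⟩ := hpt c <;> rw [hb]
        exacts [h'.1, h'.2]
      · rintro rfl
        exact map_zero _)
    (fun y => ⟨fun c => if c.1.1.2.2 = some true then (y ⟨c.1.1.1, c.2.1⟩).2
      else (y ⟨c.1.1.1, c.2.1⟩).1, hZ _, by
        ext v <;> simp [ev, basisPoint, basePoint]⟩)
  refine ⟨φ, fun f v hf => ?_, fun g f hf => ?_⟩
  · rw [hφ]
    exact Prod.ext (hf _ rfl) (hf _ rfl)
  · rw [hφ, hf]
    ext v <;> simp only [ev, LinearMap.coe_mk, AddHom.coe_mk, EmbeddedCode.constMap_apply] <;> rfl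

end ReplaceX

open ReplaceX in
/-- The induced complex of the `X`-replacement. -/
theorem replaceX_induced (hT : T.LocallyConnected) (hk : k ≠ 0) (E : EmbeddedCode T)
    (hE : E = replaceX T k) :
    ∃ (φX : E.H 0 0 ≃ₗ[ZMod 2] T.Cochain 0)
      (φQ : E.H 1 1 ≃ₗ[ZMod 2] T.Cochain 1)
      (φZ : E.H 2 2 ≃ₗ[ZMod 2] (T.Vert 2 → ZMod 2 × ZMod 2))
      (Φ₀ : E.Induced 0 ≃ₗ[ZMod 2] T.Cochain 0)
      (Φ₁ : E.Induced 1 ≃ₗ[ZMod 2] T.Cochain 1)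
      (Φ₂ : E.Induced 2 ≃ₗ[ZMod 2] (T.Vert 2 → ZMod 2 × ZMod 2) × E.H 0 2 × E.H 1 2),
      E.IsLocal φX ∧ E.IsLocal φQ ∧ E.IsLocal φZ ∧
      (∀ h, Φ₀ h = φX h.1) ∧ (∀ h, Φ₁ h = φQ h.2.1) ∧ (∀ h, Φ₂ h = (φZ h.2.2, h.1, h.2.1)) ∧
      (∀ h, Φ₁ (E.inducedD 0 h) = T.coboundary 0 (Φ₀ h)) ∧
      (∀ h, Φ₂ (E.inducedD 1 h) = (diagonal (T.Vert 2) (T.coboundary 1 (Φ₁ h)), 0, 0)) := by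
  subst hE
  obtain ⟨φX, lX, hX⟩ := exists_H_equiv_const hT hk (R := 0) (by omega)
  obtain ⟨φQ, lQ, hQ⟩ := exists_H_equiv_const hT hk (R := 1) (by omega)
  obtain ⟨φZ, lZ, hZ⟩ := exists_H_equiv_pair (k := k) hT
  -- The vanishing summands: in degree `0` only `C_X` is present, and in degree `1` the row `C_Z` is
  -- still absent while `H^1(C_X) = 0` by `exists_locD_eq`.
  have i10 := isEmpty_basis (T := T) (k := k) (R := 1) (m := 0) (by omega)
  have i20 := isEmpty_basis (T := T) (k := k) (R := 2) (m := 0) (by omega)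
  have i21 := isEmpty_basis (T := T) (k := k) (R := 2) (m := 1) (by omega)
  have s10 := (replaceX T k).H_subsingleton_of_isEmpty (R := 1) (m := 0)
  have s20 := (replaceX T k).H_subsingleton_of_isEmpty (R := 2) (m := 0)
  have s21 := (replaceX T k).H_subsingleton_of_isEmpty (R := 2) (m := 1)
  have s01 : Subsingleton ((replaceX T k).H 0 1) :=
    (replaceX T k).H_subsingleton fun f hf => exists_locD_eq hT hk f hf
  let Φ₀ : (replaceX T k).Induced 0 ≃ₗ[ZMod 2] T.Cochain 0 :=
    LinearEquiv.ofBijective (φX.toLinearMap ∘ₗ LinearMap.fst _ _ _)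
      ⟨fun h h' he => Prod.ext (φX.injective he) (Subsingleton.elim _ _),
        fun y => ⟨(φX.symm y, 0), φX.apply_symm_apply y⟩⟩
  let Φ₁ : (replaceX T k).Induced 1 ≃ₗ[ZMod 2] T.Cochain 1 :=
    LinearEquiv.ofBijective (φQ.toLinearMap ∘ₗ LinearMap.fst _ _ _ ∘ₗ LinearMap.snd _ _ _)
      ⟨fun h h' he => Prod.ext (Subsingleton.elim _ _)
        (Prod.ext (φQ.injective he) (Subsingleton.elim _ _)),
        fun y => ⟨(0, φQ.symm y, 0), φQ.apply_symm_apply y⟩⟩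
  let Φ₂ : (replaceX T k).Induced 2 ≃ₗ[ZMod 2]
      (T.Vert 2 → ZMod 2 × ZMod 2) × (replaceX T k).H 0 2 × (replaceX T k).H 1 2 :=
    LinearEquiv.ofBijective
      (LinearMap.prod (φZ.toLinearMap ∘ₗ LinearMap.snd _ _ _ ∘ₗ LinearMap.snd _ _ _)
        (LinearMap.prod (LinearMap.fst _ _ _) (LinearMap.fst _ _ _ ∘ₗ LinearMap.snd _ _ _)))
      ⟨fun h h' he => Prod.ext (Prod.mk.inj (Prod.mk.inj he).2).1
        (Prod.ext (Prod.mk.inj (Prod.mk.inj he).2).2 (φZ.injective (Prod.mk.inj he).1)),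
        fun y => ⟨(y.2.1, y.2.2, φZ.symm y.1), Prod.ext (φZ.apply_symm_apply y.1) rfl⟩⟩
  refine ⟨φX, φQ, φZ, Φ₀, Φ₁, Φ₂, lX, lQ, lZ, fun _ => rfl, fun _ => rfl, fun _ => rfl, ?_, ?_⟩
  · rintro ⟨h, -⟩
    obtain ⟨f, rfl⟩ := Submodule.Quotient.mk_surjective _ h
    obtain ⟨g, hg⟩ := exists_constMap_eq hk (by omega) f.1 f.2
    change φQ ((replaceX T k).Hconn 0 0 (Submodule.Quotient.mk f)) =
      T.coboundary 0 (φX (Submodule.Quotient.mk f))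
    rw [hX g f hg.symm, EmbeddedCode.Hconn_mk]
    refine hQ _ _ ?_
    rw [← conn_constMap, hg]
  · rintro ⟨h₀, h, -⟩
    obtain ⟨f, rfl⟩ := Submodule.Quotient.mk_surjective _ h
    obtain ⟨g, hg⟩ := exists_constMap_eq hk (by omega) f.1 f.2
    change (φZ ((replaceX T k).Hconn 1 1 (Submodule.Quotient.mk f)), 0,
      (replaceX T k).Hconn 0 1 h₀) =
      (diagonal (T.Vert 2) (T.coboundary 1 (φQ (Submodule.Quotient.mk f))), 0, 0)
    -- The component in `H^2(C_Q)` comes from `H^1(C_X)`, which is zero.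
    rw [Subsingleton.elim h₀ 0, map_zero, hQ g f hg.symm, EmbeddedCode.Hconn_mk]
    refine congrArg (·, 0, 0) (hZ _ _ ?_)
    rw [← conn_constMap, hg]

/-! ### The induced complex of the `Z`-replacement -/

namespace ReplaceZ

/-- The cells of the `Z`-replacement are the cells of the `X`-replacement of the dual. -/
def basisEquiv (T : TannerSquareComplex) (k : ℕ) {R R' m m' : ℕ} (h : R + R' = 2)
    (h' : m + m' = 2) : (replaceZ T k).Basis R m ≃ (replaceX T.dual k).Basis R' m' where
  toFun c := ⟨c.1, by
    have h1 : T.deg c.1.1.1 = R := c.2.1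
    have h2 : 2 - (replaceXTotal T.dual k).deg c.1 = m := c.2.2
    have h3 := (replaceXTotal T.dual k).deg_le c.1
    constructor
    · change 2 - T.deg c.1.1.1 = R'
      omega
    · change (replaceXTotal T.dual k).deg c.1 = m'
      omega⟩
  invFun c := ⟨c.1, by
    have h1 : 2 - T.deg c.1.1.1 = R' := c.2.1
    have h2 : (replaceXTotal T.dual k).deg c.1 = m' := c.2.2
    have h3 := T.deg_le c.1.1.1
    constructor
    · change T.deg c.1.1.1 = R
      omega
    · change 2 - (replaceXTotal T.dual k).deg c.1 = m
      omega⟩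
  left_inv _ := rfl
  right_inv _ := rfl

/-- The vertices of the dual. -/
def vertEquiv (T : TannerSquareComplex) {R R' : ℕ} (h : R + R' = 2) :
    T.Vert R ≃ T.dual.Vert R' where
  toFun v := ⟨v.1, by
    have h1 := v.2
    change 2 - T.deg v.1 = R'
    omega⟩
  invFun v := ⟨v.1, by
    have h1 : 2 - T.deg v.1 = R' := v.2
    have h2 := T.deg_le v.1
    omega⟩
  left_inv _ := rfl
  right_inv _ := rfl

/-- The transpose of the fact that lowest-degree cocycles of the dual `X`-replacement are constant.
Degree `R + 1` in `T` is degree `1 - R` in the dual. -/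
theorem exists_locD_eq_of_sumMap (hk : k ≠ 0) {R : ℕ} (hR : R < 2)
    (f : (replaceZ T k).C (R + 1) (R + 1)) (hf : (replaceZ T k).sumMap (R + 1) f = 0) :
    ∃ g, (replaceZ T k).locD (R + 1) R g = f :=
  exact_reindex (basisEquiv T k (R := R + 1) (R' := 1 - R) (m := R) (m' := 1 - R + 1) (by omega)
    (by omega)) (basisEquiv T k (R := R + 1) (R' := 1 - R) (m := R + 1) (m' := 1 - R) (by omega)
    (by omega)) (vertEquiv T (R := R + 1) (R' := 1 - R) (by omega))
    (fun _ _ => and_congr Iff.rfl eq_comm) (fun _ _ => Iff.rfl)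
    (exact_transpose (ReplaceX.exists_constMap_eq (T := T.dual) hk (R := 1 - R) (by omega))) f hf

/-- The transpose of the vanishing of the first cohomology of `Y_x`, where the `X`-checks of the
dual are the `Z`-checks of `T`. -/
theorem exists_locD_eq (hT : T.LocallyConnected) (hk : k ≠ 0) (f : (replaceZ T k).C 2 1)
    (hf : (replaceZ T k).locD 2 1 f = 0) : ∃ g, (replaceZ T k).locD 2 0 g = f :=
  exact_reindex (basisEquiv T k (R := 2) (R' := 0) (m := 0) (m' := 2) rfl rfl)
    (basisEquiv T k (R := 2) (R' := 0) (m := 1) (m' := 1) rfl rfl)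
    (basisEquiv T k (R := 2) (R' := 0) (m := 2) (m' := 0) rfl rfl)
    (fun _ _ => and_congr Iff.rfl eq_comm) (fun _ _ => and_congr Iff.rfl eq_comm)
    (exact_transpose (ReplaceX.exists_locD_eq hT.dual hk)) f hf

/-- The transposed local coboundary is the cellular boundary, and into top degree it sends an edge
to its two endpoints, an even number. -/
theorem sumMap_locD (R : ℕ) (g : (replaceZ T k).C (R + 1) R) :
    (replaceZ T k).sumMap (R + 1) ((replaceZ T k).locD (R + 1) R g) = 0 := by
  refine LinearMap.congr_fun (incidenceMap_comp_eq_zero fun a v => ?_) g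
  obtain ⟨⟨⟨v', w⟩, hw⟩, h, h'⟩ := a
  obtain ⟨v, hv⟩ := v
  change w ∈ localCells (T := T.dual) k v' at hw
  change T.deg v' = R + 1 at h
  change 2 - (2 - T.deg v' + w.dim) = R at h'
  have hle := T.deg_le v'
  by_cases hvv : v' = v
  · subst hvv
    have hd : w.dim = 1 := by
      have h2 : 2 - T.deg v' + w.dim ≤ 2 := local_dim_le hw
      omega
    obtain ⟨u, u', hne, hu⟩ := exists_facets_of_dim_one hd
    have key : ∀ c, ProdCell.Facet c w → 2 - (2 - T.deg v' + c.dim) = R + 1 := by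
      intro c hc
      have := hc.dim_eq
      omega
    have hu1 := (hu u).2 (.inl rfl)
    have hu2 := (hu u').2 (.inr rfl)
    refine (congrArg Even ?_).mpr even_two
    rw [Set.ncard_eq_two]
    refine ⟨⟨⟨(v', u), local_closed hu1 hw⟩, h, key u hu1⟩,
      ⟨⟨(v', u'), local_closed hu2 hw⟩, h, key u' hu2⟩, ?_, ?_⟩
    · intro he
      exact hne (Prod.mk.inj (Subtype.mk.inj (Subtype.mk.inj he))).2
    · ext c
      constructor
      · rintro ⟨⟨⟨h1, h2⟩ | ⟨h1, -⟩, h3⟩, h4⟩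
        · rcases (hu _).1 h2 with h5 | h5
          · exact .inl (Subtype.ext (Subtype.ext (Prod.ext h1 h5)))
          · exact .inr (Subtype.ext (Subtype.ext (Prod.ext h1 h5)))
        · exact (ne_of_inc h1 h3.symm).elim
      · rintro (rfl | rfl)
        · exact ⟨⟨.inl ⟨rfl, hu1⟩, rfl⟩, rfl⟩
        · exact ⟨⟨.inl ⟨rfl, hu2⟩, rfl⟩, rfl⟩
  · refine (congrArg Even (?_ : _ = 0)).mpr (by simp)
    rw [Set.ncard_eq_zero, Set.eq_empty_iff_forall_notMem]
    rintro c ⟨⟨-, h1⟩, h2⟩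
    exact hvv (h1.trans h2)

/-- The transpose of `conn_constMap`, checked on matrix entries: from `(v', w)` to `v` each
composite has exactly one path if `v'` and `v` are adjacent, through the copy of `w` over `v` or
through `v'`, and none otherwise. -/
theorem sumMap_conn (R : ℕ) (f : (replaceZ T k).C R R) :
    (replaceZ T k).sumMap (R + 1) ((replaceZ T k).conn R R f) =
      T.coboundary R ((replaceZ T k).sumMap R f) := by
  refine LinearMap.congr_fun (incidenceMap_comp_eq fun a v => ?_) f
  obtain ⟨⟨⟨v', w⟩, hw⟩, h, h'⟩ := a
  obtain ⟨v, hv⟩ := v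
  change w ∈ localCells (T := T.dual) k v' at hw
  change T.deg v' = R at h
  change 2 - (2 - T.deg v' + w.dim) = R at h'
  by_cases hi : T.inc v' v
  · have hdeg := T.inc_deg hi
    have h2 := T.deg_le v
    have hd : 2 - T.deg v' + w.dim ≤ 2 := local_dim_le hw
    have hb : 2 - (2 - T.deg v + w.dim) = R + 1 := by omega
    have hw' : w ∈ localCells (T := T.dual) k v := local_mono (T := T.dual) hi hw
    refine (congrArg Even ?_).mpr even_two
    have e1 : (1 : ℕ) + 1 = 2 := rfl
    rw [← e1]
    congr 1 <;> rw [Set.ncard_eq_one]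
    · refine ⟨⟨⟨(v, w), hw'⟩, hv, hb⟩, ?_⟩
      ext c
      constructor
      · rintro ⟨⟨⟨h1, -⟩ | ⟨-, h1⟩, h3⟩, h4⟩
        · exact (ne_of_inc h3 h1.symm).elim
        · exact Subtype.ext (Subtype.ext (Prod.ext h4 h1))
      · rintro rfl
        exact ⟨⟨.inr ⟨hi, rfl⟩, hi⟩, rfl⟩
    · refine ⟨⟨v', h⟩, ?_⟩
      ext c
      constructor
      · rintro ⟨h1, -⟩
        exact Subtype.ext h1.symm
      · rintro rfl
        exact ⟨rfl, hi⟩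
  · refine (congrArg Even (?_ : _ = 0)).mpr (by simp)
    rw [Nat.add_eq_zero_iff]
    constructor <;> rw [Set.ncard_eq_zero, Set.eq_empty_iff_forall_notMem]
    · rintro c ⟨⟨-, h1⟩, h2⟩
      change T.inc v' c.1.1.1 at h1
      change c.1.1.1 = v at h2
      exact hi (h2 ▸ h1)
    · rintro c ⟨h1, h2⟩
      change v' = c.1 at h1
      change T.inc c.1 v at h2
      exact hi (h1 ▸ h2)

/-- The vertex `v` at height `b` of `Y_v` as a basis element of the code. -/
def basisPoint (hT : T.LocallyConnected) (k : ℕ) (b : Bool) (R : ℕ) (v : T.Vert R) :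
    (replaceZ T k).Basis R R :=
  ⟨ReplaceX.basePoint hT.dual k b v.1, v.2, by
    change 2 - (2 - T.deg v.1 + (ReplaceX.basePoint hT.dual k b v.1).1.2.dim) = R
    have h1 := v.2
    have h2 := T.deg_le v.1
    have h3 := ReplaceX.dim_basePoint hT.dual k b v.1
    omega⟩

theorem isEmpty_basis {R m : ℕ} (h : R < m) : IsEmpty ((replaceZ T k).Basis R m) :=
  ⟨fun c => by
    have h1 : T.deg c.1.1.1 = R := c.2.1
    have h2 : 2 - (2 - T.deg c.1.1.1 + c.1.1.2.dim) = m := c.2.2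
    have h3 := T.deg_le c.1.1.1
    omega⟩

theorem mem_locZ (R : ℕ) (f : (replaceZ T k).C R R) : f ∈ (replaceZ T k).locZ R R := by
  have := isEmpty_basis (T := T) (k := k) (show R < R + 1 by omega)
  exact Subsingleton.elim _ _

theorem sumMap_surjective (hT : T.LocallyConnected) (R : ℕ) :
    Function.Surjective ((replaceZ T k).sumMap R) := by
  classical
  intro g
  -- A preimage supported on a single point of each local complex.
  refine ⟨fun c : (replaceZ T k).Basis R R => if c = basisPoint hT k false R ⟨c.1.1.1, c.2.1⟩ then g ⟨c.1.1.1, c.2.1⟩ else 0,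
    ?_⟩
  let _ := Fintype.ofFinite ((replaceZ T k).Basis R R)
  ext v
  change (∑ c : (replaceZ T k).Basis R R, if (replaceZ T k).base c.1 = v.1 then _ else 0) = g v
  rw [Finset.sum_eq_single (basisPoint hT k false R v)]
  · exact (if_pos rfl).trans (if_pos rfl)
  · intro c _ hc
    split_ifs with h1 h2
    · obtain ⟨v, hv⟩ := v
      change c.1.1.1 = v at h1
      subst h1
      exact (hc h2).elim
    · rfl
    · rfl
  · intro h
    exact (h (Finset.mem_univ _)).elim

/-- In top degree everything is a cocycle, and the coboundaries are exactly the kernel of the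
surjective local sum. -/
theorem exists_H_equiv_sum (hT : T.LocallyConnected) (hk : k ≠ 0) {R : ℕ} (hR : R < 2) :
    ∃ φ : (replaceZ T k).H (R + 1) (R + 1) ≃ₗ[ZMod 2] T.Cochain (R + 1),
      (replaceZ T k).IsLocal φ ∧ ∀ f : (replaceZ T k).locZ (R + 1) (R + 1),
        φ (Submodule.Quotient.mk f) = (replaceZ T k).sumMap (R + 1) f.1 := by
  classical
  obtain ⟨φ, hφ⟩ := (replaceZ T k).exists_H_equiv ((replaceZ T k).sumMap (R + 1)) (fun f _ =>
    ⟨exists_locD_eq_of_sumMap hk hR f, by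
      rintro ⟨g, rfl⟩
      exact sumMap_locD R g⟩)
    (fun y => by
      obtain ⟨f, hf⟩ := sumMap_surjective (k := k) hT (R + 1) y
      exact ⟨f, mem_locZ _ f, hf⟩)
  refine ⟨φ, fun f v hf => ?_, hφ⟩
  rw [hφ]
  let _ := Fintype.ofFinite ((replaceZ T k).Basis (R + 1) (R + 1))
  exact (incidenceMap_apply_eq_sum f.1 v
    {c : (replaceZ T k).Basis (R + 1) (R + 1) | (replaceZ T k).base c.1 = v.1} (fun _ => 0) id
    (fun a ha => Finset.mem_filter.2 ⟨Finset.mem_univ _, ha⟩) (fun _ _ _ _ h => h)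
    (fun c hc => ⟨c, (Finset.mem_filter.1 hc).2, rfl⟩) hf).trans Finset.sum_const_zero

/-- The local complex over an `X`-check is now two points in degree `0`. Evaluation at the points is
the isomorphism, and adding the two values is the local sum. -/
theorem exists_H_equiv_pair (hT : T.LocallyConnected) :
    ∃ φ : (replaceZ T k).H 0 0 ≃ₗ[ZMod 2] (T.Vert 0 → ZMod 2 × ZMod 2),
      (replaceZ T k).IsLocal φ ∧ ∀ f : (replaceZ T k).locZ 0 0,
        codiagonal (T.Vert 0) (φ (Submodule.Quotient.mk f)) = (replaceZ T k).sumMap 0 f.1 := by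
  classical
  let ev : (replaceZ T k).C 0 0 →ₗ[ZMod 2] (T.Vert 0 → ZMod 2 × ZMod 2) :=
    { toFun := fun f v => (f (basisPoint hT k false 0 v), f (basisPoint hT k true 0 v))
      map_add' := fun _ _ => rfl
      map_smul' := fun _ _ => rfl }
  have hpt : ∀ c : (replaceZ T k).Basis 0 0, ∃ b, c = basisPoint hT k b 0 ⟨c.1.1.1, c.2.1⟩ := by
    intro c
    have h1 : T.deg c.1.1.1 = 0 := c.2.1
    obtain ⟨b, hb⟩ := ReplaceX.eq_basePoint hT.dual c.1 (by
      change 2 - T.deg c.1.1.1 = 2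
      omega)
    exact ⟨b, Subtype.ext hb⟩
  obtain ⟨φ, hφ⟩ := (replaceZ T k).exists_H_equiv ev (fun f _ => by
      change _ ↔ f ∈ (⊥ : Submodule (ZMod 2) _)
      rw [Submodule.mem_bot]
      constructor
      · intro h
        ext c
        have h' := Prod.mk.inj (congrFun h ⟨c.1.1.1, c.2.1⟩)
        obtain ⟨_ | _, hb⟩ := hpt c <;> rw [hb]
        exacts [h'.1, h'.2]
      · rintro rfl
        exact map_zero _)
    (fun y => ⟨fun c => if c.1.1.2.2 = some true then (y ⟨c.1.1.1, c.2.1⟩).2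
      else (y ⟨c.1.1.1, c.2.1⟩).1, mem_locZ _ _, by
        ext v <;> simp [ev, basisPoint, ReplaceX.basePoint]⟩)
  refine ⟨φ, fun f v hf => ?_, fun f => ?_⟩
  · rw [hφ]
    exact Prod.ext (hf _ rfl) (hf _ rfl)
  · rw [hφ]
    ext v
    -- The height tells the two points over `v` apart, which turns the local sum into a sum over
    -- `Bool`.
    have hpt' : ∀ c : (replaceZ T k).Basis 0 0, (replaceZ T k).base c.1 = v.1 →
        c = basisPoint hT k (decide (c.1.1.2.2 = some true)) 0 v := by
      intro c hc
      obtain ⟨b, hb⟩ := hpt c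
      have hv : (⟨c.1.1.1, c.2.1⟩ : T.Vert 0) = v := Subtype.ext hc
      rw [hv] at hb
      rw [hb]
      cases b <;> rfl
    symm
    refine (incidenceMap_apply_eq_sum f.1 v Finset.univ
      (fun b => f.1 (basisPoint hT k b 0 v)) (fun c => decide (c.1.1.2.2 = some true))
      (fun _ _ => Finset.mem_univ _) ?_ ?_ ?_).trans ?_
    · intro c c' h h' he
      rw [hpt' c h, hpt' c' h', he]
    · intro b _
      exact ⟨basisPoint hT k b 0 v, rfl, by cases b <;> rfl⟩
    · intro c h
      exact congrArg f.1 (hpt' c h)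
    · rw [Fintype.sum_bool, add_comm]
      rfl

end ReplaceZ

open ReplaceZ in
/-- The induced complex of the `Z`-replacement. -/
theorem replaceZ_induced (hT : T.LocallyConnected) (hk : k ≠ 0) (E : EmbeddedCode T)
    (hE : E = replaceZ T k) :
    ∃ (φX : E.H 0 0 ≃ₗ[ZMod 2] (T.Vert 0 → ZMod 2 × ZMod 2))
      (φQ : E.H 1 1 ≃ₗ[ZMod 2] T.Cochain 1)
      (φZ : E.H 2 2 ≃ₗ[ZMod 2] T.Cochain 2)
      (Φ₀ : E.Induced 0 ≃ₗ[ZMod 2] (T.Vert 0 → ZMod 2 × ZMod 2) × E.H 2 0 × E.H 1 0)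
      (Φ₁ : E.Induced 1 ≃ₗ[ZMod 2] T.Cochain 1)
      (Φ₂ : E.Induced 2 ≃ₗ[ZMod 2] T.Cochain 2),
      E.IsLocal φX ∧ E.IsLocal φQ ∧ E.IsLocal φZ ∧
      (∀ h, Φ₀ h = (φX h.1, h.2.2, h.2.1)) ∧ (∀ h, Φ₁ h = φQ h.2.1) ∧ (∀ h, Φ₂ h = φZ h.2.2) ∧
      (∀ h, Φ₁ (E.inducedD 0 h) = T.coboundary 0 (codiagonal (T.Vert 0) (Φ₀ h).1)) ∧
      (∀ h, Φ₂ (E.inducedD 1 h) = T.coboundary 1 (Φ₁ h)) := by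
  subst hE
  obtain ⟨φX, lX, hX⟩ := exists_H_equiv_pair (k := k) hT
  obtain ⟨φQ, lQ, hQ⟩ := exists_H_equiv_sum hT hk (R := 0) (by omega)
  obtain ⟨φZ, lZ, hZ⟩ := exists_H_equiv_sum hT hk (R := 1) (by omega)
  -- Here `C_R` ends in degree `R`, so the vanishing mirrors the other case: `C_X` and `C_Q` stop
  -- before degree `2`, `C_X` before degree `1`, and `H^1(C_Z) = 0` by `exists_locD_eq`.
  have i01 := isEmpty_basis (T := T) (k := k) (R := 0) (m := 1) (by omega)
  have i02 := isEmpty_basis (T := T) (k := k) (R := 0) (m := 2) (by omega)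
  have i12 := isEmpty_basis (T := T) (k := k) (R := 1) (m := 2) (by omega)
  have s01 := (replaceZ T k).H_subsingleton_of_isEmpty (R := 0) (m := 1)
  have s02 := (replaceZ T k).H_subsingleton_of_isEmpty (R := 0) (m := 2)
  have s12 := (replaceZ T k).H_subsingleton_of_isEmpty (R := 1) (m := 2)
  have s21 : Subsingleton ((replaceZ T k).H 2 1) :=
    (replaceZ T k).H_subsingleton fun f hf => exists_locD_eq hT hk f hf
  let Φ₀ : (replaceZ T k).Induced 0 ≃ₗ[ZMod 2]
      (T.Vert 0 → ZMod 2 × ZMod 2) × (replaceZ T k).H 2 0 × (replaceZ T k).H 1 0 :=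
    LinearEquiv.ofBijective
      (LinearMap.prod (φX.toLinearMap ∘ₗ LinearMap.fst _ _ _)
        (LinearMap.prod (LinearMap.snd _ _ _ ∘ₗ LinearMap.snd _ _ _)
          (LinearMap.fst _ _ _ ∘ₗ LinearMap.snd _ _ _)))
      ⟨fun h h' he => Prod.ext (φX.injective (Prod.mk.inj he).1)
        (Prod.ext (Prod.mk.inj (Prod.mk.inj he).2).2 (Prod.mk.inj (Prod.mk.inj he).2).1),
        fun y => ⟨(φX.symm y.1, y.2.2, y.2.1), Prod.ext (φX.apply_symm_apply y.1) rfl⟩⟩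
  let Φ₁ : (replaceZ T k).Induced 1 ≃ₗ[ZMod 2] T.Cochain 1 :=
    LinearEquiv.ofBijective (φQ.toLinearMap ∘ₗ LinearMap.fst _ _ _ ∘ₗ LinearMap.snd _ _ _)
      ⟨fun h h' he => Prod.ext (Subsingleton.elim _ _)
        (Prod.ext (φQ.injective he) (Subsingleton.elim _ _)),
        fun y => ⟨(0, φQ.symm y, 0), φQ.apply_symm_apply y⟩⟩
  let Φ₂ : (replaceZ T k).Induced 2 ≃ₗ[ZMod 2] T.Cochain 2 :=
    LinearEquiv.ofBijective (φZ.toLinearMap ∘ₗ LinearMap.snd _ _ _ ∘ₗ LinearMap.snd _ _ _)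
      ⟨fun h h' he => Prod.ext (Subsingleton.elim _ _)
        (Prod.ext (Subsingleton.elim _ _) (φZ.injective he)),
        fun y => ⟨(0, 0, φZ.symm y), φZ.apply_symm_apply y⟩⟩
  refine ⟨φX, φQ, φZ, Φ₀, Φ₁, Φ₂, lX, lQ, lZ, fun _ => rfl, fun _ => rfl, fun _ => rfl, ?_, ?_⟩
  -- Only the component from `H^0(C_X)` matters: `H^0(C_Q)` maps to `H^1(C_Z) = 0`, and nothing
  -- leaves `H^0(C_Z)`.
  · rintro ⟨h, -⟩
    obtain ⟨f, rfl⟩ := Submodule.Quotient.mk_surjective _ h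
    change φQ ((replaceZ T k).Hconn 0 0 (Submodule.Quotient.mk f)) =
      T.coboundary 0 (codiagonal (T.Vert 0) (φX (Submodule.Quotient.mk f)))
    rw [hX, EmbeddedCode.Hconn_mk, ← sumMap_conn]
    exact hQ _
  · rintro ⟨-, h, -⟩
    obtain ⟨f, rfl⟩ := Submodule.Quotient.mk_surjective _ h
    change φZ ((replaceZ T k).Hconn 1 1 (Submodule.Quotient.mk f)) =
      T.coboundary 1 (φQ (Submodule.Quotient.mk f))
    rw [hQ, EmbeddedCode.Hconn_mk, ← sumMap_conn]
    exact hZ _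

end CodeReplacement

/-! ### The statement for the levels of the construction -/

open CodeReplacement in
theorem mainTheorem11 (ℓ : ℕ) (hodd : Odd ℓ) (hℓ : 3 ≤ ℓ) (i : ℕ) (T : TannerSquareComplex)
    (hT : T = level ℓ i) :
    (Even i →
      ∃ E : EmbeddedCode T, E = replaceX T ((ℓ - 1) / 2) ∧ E.total = level ℓ (i + 1) ∧
      ∃ (φX : E.H 0 0 ≃ₗ[ZMod 2] T.Cochain 0)
        (φQ : E.H 1 1 ≃ₗ[ZMod 2] T.Cochain 1)
        (φZ : E.H 2 2 ≃ₗ[ZMod 2] (T.Vert 2 → ZMod 2 × ZMod 2))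
        (Φ₀ : E.Induced 0 ≃ₗ[ZMod 2] T.Cochain 0)
        (Φ₁ : E.Induced 1 ≃ₗ[ZMod 2] T.Cochain 1)
        (Φ₂ : E.Induced 2 ≃ₗ[ZMod 2] (T.Vert 2 → ZMod 2 × ZMod 2) × E.H 0 2 × E.H 1 2),
        E.IsLocal φX ∧ E.IsLocal φQ ∧ E.IsLocal φZ ∧
        (∀ h, Φ₀ h = φX h.1) ∧ (∀ h, Φ₁ h = φQ h.2.1) ∧ (∀ h, Φ₂ h = (φZ h.2.2, h.1, h.2.1)) ∧
        (∀ h, Φ₁ (E.inducedD 0 h) = T.coboundary 0 (Φ₀ h)) ∧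
        (∀ h, Φ₂ (E.inducedD 1 h) = (diagonal (T.Vert 2) (T.coboundary 1 (Φ₁ h)), 0, 0))) ∧
    (Odd i →
      ∃ E : EmbeddedCode T, E = replaceZ T ((ℓ - 1) / 2) ∧ E.total = level ℓ (i + 1) ∧
      ∃ (φX : E.H 0 0 ≃ₗ[ZMod 2] (T.Vert 0 → ZMod 2 × ZMod 2))
        (φQ : E.H 1 1 ≃ₗ[ZMod 2] T.Cochain 1)
        (φZ : E.H 2 2 ≃ₗ[ZMod 2] T.Cochain 2)
        (Φ₀ : E.Induced 0 ≃ₗ[ZMod 2] (T.Vert 0 → ZMod 2 × ZMod 2) × E.H 2 0 × E.H 1 0)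
        (Φ₁ : E.Induced 1 ≃ₗ[ZMod 2] T.Cochain 1)
        (Φ₂ : E.Induced 2 ≃ₗ[ZMod 2] T.Cochain 2),
        E.IsLocal φX ∧ E.IsLocal φQ ∧ E.IsLocal φZ ∧
        (∀ h, Φ₀ h = (φX h.1, h.2.2, h.2.1)) ∧ (∀ h, Φ₁ h = φQ h.2.1) ∧ (∀ h, Φ₂ h = φZ h.2.2) ∧
        (∀ h, Φ₁ (E.inducedD 0 h) = T.coboundary 0 (codiagonal (T.Vert 0) (Φ₀ h).1)) ∧
        (∀ h, Φ₂ (E.inducedD 1 h) = T.coboundary 1 (Φ₁ h))) := by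
  subst hT
  -- With at least one subdivision edge per edge of `T`, the two ends of an edge have distinct
  -- positions.
  have hk : (ℓ - 1) / 2 ≠ 0 := by omega
  have hlc := level_locallyConnected hk i
  refine ⟨fun hi => ⟨_, rfl, ?_, replaceX_induced hlc hk _ rfl⟩,
    fun hi => ⟨_, rfl, ?_, replaceZ_induced hlc hk _ rfl⟩⟩
  · rw [level, if_pos hi]
  · rw [level, if_neg (Nat.not_even_iff_odd.2 hi)]
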